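/- Let $1<\alpha,\beta<2$, $-\infty<x_L<x_R<\infty$, $-\infty<y_L<y_R<\infty$, $T>0$, $\Omega=(x_L,x_R)\times(y_L,y_R)$. Let $d_+,d_-$ be functions on $(x_L,x_R)$ and $e_+,e_-$ functions on $(y_L,y_R)$, where $d_+,e_+$ are nonnegative and bounded and $d_-=\kappa_\alpha d_+$, $e_-=\kappa_\beta e_+$ with constants $\kappa_\alpha,\kappa_\beta\ge 0$. Let $u$ be a solution of $$u_t=d_+(x)\,{}_{x_L}D_x^{\alpha}u+d_-(x)\,{}_xD_{x_R}^{\alpha}u+e_+(y)\,{}_{y_L}D_y^{\beta}u+e_-(y)\,{}_yD_{y_R}^{\beta}u+f(x,y,t),\qquad (x,y)\in\Omega,\ 0<t\le T,$$ with $u(x,y,0)=u_0(x,y)$ in $\Omega$ and $u=0$ on $\partial\Omega\times(0,T]$, where $${}_{x_L}D_x^{\alpha}v(x)=\frac1{\Gamma(2-\alpha)}\frac{d^2}{dx^2}\int_{x_L}^x (x-\xi)^{1-\alpha}v(\xi)\,d\xi,\qquad {}_{x}D_{x_R}^{\alpha}v(x)=\frac1{\Gamma(2-\alpha)}\frac{d^2}{dx^2}\int_x^{x_R}(\xi-x)^{1-\alpha}v(\xi)\,d\xi$$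 are the Riemann–Liouville derivatives (analogously in $y$ with order $\beta$). Smoothness of $u$: for each $(x,y)\in\Omega$, $u(x,y,\cdot)\in C^3[0,T]$; for $k=0,1,2,3$ and $t\in[0,T]$ the extension $v_k(\cdot,\cdot,t)$ of $\partial_t^ku(\cdot,\cdot,t)$ by zero from $\Omega$ to $\mathbb R^2$ is continuous (and integrable), and, with $\widehat v(\omega)=\int_{\mathbb R^2}e^{i(\omega_1x+\omega_2y)}v(x,y)\,dx\,dy$, the integrals $$\int_{\mathbb R^2}(1+|\omega_1|)^{a}(1+|\omega_2|)^{b}\,|\widehat{v_k}(\omega,t)|\,d\omega$$ are finite and bounded uniformly in $t\in[0,T]$, for $(a,b)=(\alpha+4,\beta)$ and $(\alpha,\beta+4)$ if $k=0$, and for $(a,b)=(\alpha,\beta)$ if $k=1,2,3$. The matrices: for $\gamma\in\{\alpha,\beta\}$ let $q_k^\gamma$ be the Taylor coefficients of $(\tfrac32-2\zeta+\tfrac12\zeta^2)^\gamma$, i.e. $q_k^{\gamma}=(\tfrac32)^\gamma\sum_{m=0}^k3^{-m}g_m^\gamma g_{k-m}^\gamma$ with $g_k^\gamma=(-1)^k\binom{\gamma}{k}$,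 and $q_k^\gamma=0$ for $k<0$. For integers $p$ let $A_p^\gamma=(q^\gamma_{p+i-j})_{i,j}$, and put $$A_{p,q}^\gamma=\tfrac{q}{q-p}A_p^\gamma+\tfrac{p}{p-q}A_q^\gamma,\qquad A_{p,q,r,s}^\gamma=\tfrac{3rs+2\gamma}{3(rs-pq)}A_{p,q}^\gamma+\tfrac{3pq+2\gamma}{3(pq-rs)}A_{r,s}^\gamma,$$ $$A_\gamma=A_{p,q,r,s,\bar p,\bar q,\bar r,\bar s}^\gamma=\frac{a\bar b}{a\bar b-\bar ab}A_{p,q,r,s}^\gamma+\frac{\bar ab}{\bar ab-a\bar b}A_{\bar p,\bar q,\bar r,\bar s}^\gamma,$$ where $a=rs-pq$, $b=6pqrs(r+s-p-q)+4\gamma[rs(r+s)-pq(p+q)]+9\gamma(rs-pq)$, and $\bar a,\bar b$ are the same expressions in $\bar p,\bar q,\bar r,\bar s$. The parameters $(p,q,r,s,\bar p,\bar q,\bar r,\bar s)$ (the same for $\alpha$ and $\beta$) satisfy $a\bar b\ne\bar ab$ for $\gamma=\alpha$ and for $\gamma=\beta$, and are either $(1,2,1,-2,1,\bar q,1,\bar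 s)$ with $|\bar q|,|\bar s|\ge2$, $\bar q\bar s<0$, $(\bar q,\bar s)\ne(2,-2)$, or one of $(1,2,1,0,1,2,1,-2)$, $(1,2,1,0,1,-1,1,-2)$, $(1,2,1,-1,1,2,1,-2)$, $(1,2,1,-1,1,-1,1,-2)$, $(1,0,1,-1,1,2,1,-2)$, $(1,0,1,-2,1,2,1,-2)$, $(1,-1,1,-2,1,2,1,-2)$. The scheme: for positive integers $N_x,N_y,N_t$ let $\Delta x=(x_R-x_L)/N_x$, $\Delta y=(y_R-y_L)/N_y$, $\tau=T/N_t$, $x_i=x_L+i\Delta x$, $y_j=y_L+j\Delta y$, $t_n=n\tau$, $t_{n+1/2}=(n+\tfrac12)\tau$; $D_\pm=\mathrm{diag}(d_\pm(x_i))_{i=1}^{N_x-1}$, $E_\pm=\mathrm{diag}(e_\pm(y_j))_{j=1}^{N_y-1}$ (so $D_-=\kappa_\alpha D_+$, $E_-=\kappa_\beta E_+$), and, with $A_\alpha$ of size $N_x-1$ and $A_\beta$ of size $N_y-1$, $$\mathcal A_x=\frac{\tau}{2(\Delta x)^\alpha}\,I\otimes(D_+A_\alpha+D_-A_\alpha^T),\qquad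 \mathcal A_y=\frac{\tau}{2(\Delta y)^\beta}\,(E_+A_\beta+E_-A_\beta^T)\otimes I .$$ Let $\mathbf U^n=(u_{i,j}^n)_{1\le i\le N_x-1,\,1\le j\le N_y-1}$ satisfy $u_{i,j}^0=u_0(x_i,y_j)$ and $$(I-\mathcal A_x)(I-\mathcal A_y)\mathbf U^{n+1}=(I+\mathcal A_x)(I+\mathcal A_y)\mathbf U^n+\tau\mathbf F^{n+1/2},\qquad 0\le n<N_t,$$ where $\mathbf F^{n+1/2}=(f(x_i,y_j,t_{n+1/2}))_{i,j}$. Then there is a constant $C>0$, independent of $N_x,N_y,N_t$ and $n$, such that for all positive integers $N_x,N_y,N_t$ and all $0\le n\le N_t$ $$\Big(\Delta x\,\Delta y\sum_{i=1}^{N_x-1}\sum_{j=1}^{N_y-1}|u(x_i,y_j,t_n)-u_{i,j}^n|^2\Big)^{1/2}\le C\big(\tau^2+(\Delta x)^4+(\Delta y)^4\big).$$ -/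

import Mathlib

open Set MeasureTheory
open scoped Kronecker Matrix

namespace WSLD

noncomputable section

/-! ### Riemann-Liouville derivatives and the differential equation -/

/-- Left Riemann-Liouville derivative of order `α ∈ (1,2)` with base point `a`, at `x > a`. -/
def leftRL (α a : ℝ) (v : ℝ → ℝ) (x : ℝ) : ℝ :=
  1 / Real.Gamma (2 - α) *
    deriv (deriv (fun z => ∫ ξ in a..z, (z - ξ) ^ (1 - α) * v ξ)) x

/-- Right Riemann-Liouville derivative of order `α ∈ (1,2)` with base point `b`, at `x < b`. -/
def rightRL (α b : ℝ) (v : ℝ → ℝ) (x : ℝ) : ℝ :=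
  1 / Real.Gamma (2 - α) *
    deriv (deriv (fun z => ∫ ξ in z..b, (ξ - z) ^ (1 - α) * v ξ)) x

/-- The open rectangle `Ω = (xL, xR) × (yL, yR)`. -/
def domain (xL xR yL yR : ℝ) : Set (ℝ × ℝ) := Ioo xL xR ×ˢ Ioo yL yR

/-- `u x y t` solves, with zero boundary values and initial value `u₀`, the equation
`u_t = d₊(x) D_{x,left}^α u + d₋(x) D_{x,right}^α u
  + e₊(y) D_{y,left}^β u + e₋(y) D_{y,right}^β u + f` in `Ω × (0,T]`
(the time derivative at `t = T` is one-sided). -/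
structure IsExactSolution (α β xL xR yL yR T : ℝ) (dp dm ep em : ℝ → ℝ)
    (f : ℝ → ℝ → ℝ → ℝ) (u₀ : ℝ → ℝ → ℝ) (u : ℝ → ℝ → ℝ → ℝ) : Prop where
  pde : ∀ x y t : ℝ, (x, y) ∈ domain xL xR yL yR → t ∈ Ioc 0 T →
    HasDerivWithinAt (fun s => u x y s)
      (dp x * leftRL α xL (fun ξ => u ξ y t) x + dm x * rightRL α xR (fun ξ => u ξ y t) x
        + ep y * leftRL β yL (fun η => u x η t) y + em y * rightRL β yR (fun η => u x η t) y
        + f x y t) (Icc 0 T) t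
  initial : ∀ x y : ℝ, (x, y) ∈ domain xL xR yL yR → u x y 0 = u₀ x y
  boundary : ∀ x y t : ℝ, (x, y) ∈ frontier (domain xL xR yL yR) → t ∈ Ioc 0 T → u x y t = 0

/-! ### Smoothness of the zero extended solution -/

/-- Extension by zero of a function from the open rectangle to the whole plane. -/
def zeroExt (xL xR yL yR : ℝ) (v : ℝ → ℝ → ℝ) : ℝ × ℝ → ℝ :=
  (domain xL xR yL yR).indicator (fun p => v p.1 p.2)

/-- The Fourier transform `v̂(ω) = ∫ exp(i(ω₁ x + ω₂ y)) v(x,y) dx dy`. -/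
def fourier2 (v : ℝ × ℝ → ℝ) (ω : ℝ × ℝ) : ℂ :=
  ∫ p : ℝ × ℝ, Complex.exp (Complex.I * ((ω.1 * p.1 + ω.2 * p.2 : ℝ) : ℂ)) * (v p : ℂ)

/-- `v` is continuous and integrable on the plane, and its Fourier transform satisfies
`∫ (1+|ω₁|)^a (1+|ω₂|)^b |v̂(ω)| dω ≤ K`. -/
structure FourierBound (a b K : ℝ) (v : ℝ × ℝ → ℝ) : Prop where
  continuous : Continuous v
  integrable : Integrable v
  integrable_fourier :
    Integrable (fun ω : ℝ × ℝ => (1 + |ω.1|) ^ a * (1 + |ω.2|) ^ b * ‖fourier2 v ω‖)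
  integral_le : ∫ ω : ℝ × ℝ, (1 + |ω.1|) ^ a * (1 + |ω.2|) ^ b * ‖fourier2 v ω‖ ≤ K

/-- The `k`-th time derivative of `u` on `[0,T]`, extended by zero in space, at time `t`. -/
def timeDeriv (xL xR yL yR T : ℝ) (u : ℝ → ℝ → ℝ → ℝ) (k : ℕ) (t : ℝ) : ℝ × ℝ → ℝ :=
  zeroExt xL xR yL yR (fun x y => iteratedDerivWithin k (fun s => u x y s) (Icc 0 T) t)

/-- The smoothness of the solution: it is `C³` in time up to `t = 0` and `t = T`; uniformly in
`t`, its zero extension has mixed derivatives of orders `(α+4, β)` and `(α, β+4)` with integrable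
Fourier transform, and the zero extensions of its first three time derivatives have mixed
derivatives of order `(α, β)` with integrable Fourier transform. -/
structure IsSmoothSolution (α β xL xR yL yR T : ℝ) (u : ℝ → ℝ → ℝ → ℝ) : Prop where
  contDiffOn : ∀ x y : ℝ, (x, y) ∈ domain xL xR yL yR →
    ContDiffOn ℝ 3 (fun s => u x y s) (Icc 0 T)
  space : ∃ K : ℝ, ∀ t ∈ Icc 0 T,
    FourierBound (α + 4) β K (timeDeriv xL xR yL yR T u 0 t) ∧
    FourierBound α (β + 4) K (timeDeriv xL xR yL yR T u 0 t)
  time : ∃ K : ℝ, ∀ k ∈ ({1, 2, 3} : Set ℕ), ∀ t ∈ Icc 0 T,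
    FourierBound α β K (timeDeriv xL xR yL yR T u k t)

/-! ### Weighted and shifted Lubich difference matrices -/

/-- `g_k = (-1)^k binom(α, k)`, the Taylor coefficients of `(1 - ζ)^α`. -/
def g (α : ℝ) : ℕ → ℝ
  | 0 => 1
  | k + 1 => (1 - (α + 1) / ((k : ℝ) + 1)) * g α k

/-- The Taylor coefficients `q_k` of `(3/2 - 2ζ + ζ²/2)^α`. -/
def lubich (α : ℝ) (k : ℕ) : ℝ :=
  (3 / 2 : ℝ) ^ α * ∑ m ∈ Finset.range (k + 1), ((3 : ℝ) ^ m)⁻¹ * g α m * g α (k - m)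

/-- The coefficients `q_k` for integer index, zero for `k < 0`. -/
def lubichZ (α : ℝ) (k : ℤ) : ℝ := if k < 0 then 0 else lubich α k.toNat

/-- The Toeplitz matrix `A_p^α` with entries `q_{p+i-j}`. -/
def A1 (α : ℝ) (n : ℕ) (p : ℤ) : Matrix (Fin n) (Fin n) ℝ :=
  Matrix.of fun i j => lubichZ α (p + (i : ℤ) - (j : ℤ))

/-- `A_{p,q}^α = w_p A_p^α + w_q A_q^α`. -/
def A2 (α : ℝ) (n : ℕ) (p q : ℤ) : Matrix (Fin n) (Fin n) ℝ :=
  ((q : ℝ) / (q - p)) • A1 α n p + ((p : ℝ) / (p - q)) • A1 α n q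

/-- `A_{p,q,r,s}^α = w_{p,q} A_{p,q}^α + w_{r,s} A_{r,s}^α`. -/
def A3 (α : ℝ) (n : ℕ) (p q r s : ℤ) : Matrix (Fin n) (Fin n) ℝ :=
  ((3 * r * s + 2 * α) / (3 * (r * s - p * q)) : ℝ) • A2 α n p q
    + ((3 * p * q + 2 * α) / (3 * (p * q - r * s)) : ℝ) • A2 α n r s

/-- `a_{p,q,r,s} = rs - pq`. -/
def aCoeff (p q r s : ℤ) : ℝ := r * s - p * q

/-- `b_{p,q,r,s} = 6pqrs(r+s-p-q) + 4α[rs(r+s) - pq(p+q)] + 9α(rs - pq)`. -/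
def bCoeff (α : ℝ) (p q r s : ℤ) : ℝ :=
  6 * p * q * r * s * (r + s - p - q) + 4 * α * (r * s * (r + s) - p * q * (p + q))
    + 9 * α * (r * s - p * q)

/-- The eight integer shifts `(p, q, r, s, p̄, q̄, r̄, s̄)`. -/
structure Shifts where
  p : ℤ
  q : ℤ
  r : ℤ
  s : ℤ
  pb : ℤ
  qb : ℤ
  rb : ℤ
  sb : ℤ

/-- `a b̄ ≠ ā b`, so that the fourth order weights are defined. -/
def Shifts.Nondegenerate (P : Shifts) (α : ℝ) : Prop :=
  aCoeff P.p P.q P.r P.s * bCoeff α P.pb P.qb P.rb P.sb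
    ≠ aCoeff P.pb P.qb P.rb P.sb * bCoeff α P.p P.q P.r P.s

/-- The fourth order WSLD matrix
`w_{p,q,r,s} A_{p,q,r,s}^α + w_{p̄,q̄,r̄,s̄} A_{p̄,q̄,r̄,s̄}^α`. -/
def A4 (α : ℝ) (P : Shifts) (n : ℕ) : Matrix (Fin n) (Fin n) ℝ :=
  let a := aCoeff P.p P.q P.r P.s
  let ab := aCoeff P.pb P.qb P.rb P.sb
  let b := bCoeff α P.p P.q P.r P.s
  let bb := bCoeff α P.pb P.qb P.rb P.sb
  (a * bb / (a * bb - ab * b)) • A3 α n P.p P.q P.r P.s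
    + (ab * b / (ab * b - a * bb)) • A3 α n P.pb P.qb P.rb P.sb

/-- The shifts of the effective fourth order schemes. -/
def Shifts.Effective (P : Shifts) : Prop :=
  (∃ q s : ℤ, 2 ≤ |q| ∧ 2 ≤ |s| ∧ (q, s) ≠ (2, -2) ∧ q * s < 0 ∧
    P = ⟨1, 2, 1, -2, 1, q, 1, s⟩) ∨
  P = ⟨1, 2, 1, 0, 1, 2, 1, -2⟩ ∨
  P = ⟨1, 2, 1, 0, 1, -1, 1, -2⟩ ∨
  P = ⟨1, 2, 1, -1, 1, 2, 1, -2⟩ ∨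
  P = ⟨1, 2, 1, -1, 1, -1, 1, -2⟩ ∨
  P = ⟨1, 0, 1, -1, 1, 2, 1, -2⟩ ∨
  P = ⟨1, 0, 1, -2, 1, 2, 1, -2⟩ ∨
  P = ⟨1, -1, 1, -2, 1, 2, 1, -2⟩

/-! ### The fully discrete scheme -/

/-- The step size of the uniform mesh with `N` cells on `[a,b]`. -/
def step (a b : ℝ) (N : ℕ) : ℝ := (b - a) / N

/-- The interior mesh points `a + (i+1)h`, `i = 0, …, N-2`. -/
def node (a b : ℝ) (N : ℕ) (i : Fin (N - 1)) : ℝ := a + ((i : ℝ) + 1) * step a b N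

/-- Indices `(j, i)` of the interior mesh points `(x_i, y_j)`. -/
abbrev Idx (Nx Ny : ℕ) : Type := Fin (Ny - 1) × Fin (Nx - 1)

/-- The matrix `D₊ A_α + D₋ A_αᵀ`, with `D₊`, `D₋` the diagonal matrices of mesh values. -/
def coeffMatrix (α : ℝ) (P : Shifts) (a b : ℝ) (N : ℕ) (dp dm : ℝ → ℝ) :
    Matrix (Fin (N - 1)) (Fin (N - 1)) ℝ :=
  Matrix.diagonal (fun i => dp (node a b N i)) * A4 α P (N - 1)
    + Matrix.diagonal (fun i => dm (node a b N i)) * (A4 α P (N - 1))ᵀ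

/-- `𝒜_x = τ / (2 Δx^α) · I ⊗ (D₊ A_α + D₋ A_αᵀ)`. -/
def Ax (α : ℝ) (P : Shifts) (xL xR : ℝ) (Nx Ny : ℕ) (τ : ℝ) (dp dm : ℝ → ℝ) :
    Matrix (Idx Nx Ny) (Idx Nx Ny) ℝ :=
  (τ / (2 * step xL xR Nx ^ α)) •
    ((1 : Matrix (Fin (Ny - 1)) (Fin (Ny - 1)) ℝ) ⊗ₖ coeffMatrix α P xL xR Nx dp dm)

/-- `𝒜_y = τ / (2 Δy^β) · (E₊ A_β + E₋ A_βᵀ) ⊗ I`. -/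
def Ay (β : ℝ) (P : Shifts) (yL yR : ℝ) (Nx Ny : ℕ) (τ : ℝ) (ep em : ℝ → ℝ) :
    Matrix (Idx Nx Ny) (Idx Nx Ny) ℝ :=
  (τ / (2 * step yL yR Ny ^ β)) •
    (coeffMatrix β P yL yR Ny ep em ⊗ₖ (1 : Matrix (Fin (Nx - 1)) (Fin (Nx - 1)) ℝ))

/-- `U` satisfies the scheme
`(I - 𝒜_x)(I - 𝒜_y) U^{n+1} = (I + 𝒜_x)(I + 𝒜_y) U^n + τ F^{n+1/2}`, `0 ≤ n < Nt`,
with `τ = T / Nt`, started from the mesh values of `u₀`. -/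
structure IsSchemeSolution (α β : ℝ) (P : Shifts) (xL xR yL yR T : ℝ) (dp dm ep em : ℝ → ℝ)
    (f : ℝ → ℝ → ℝ → ℝ) (u₀ : ℝ → ℝ → ℝ) (Nx Ny Nt : ℕ) (U : ℕ → Idx Nx Ny → ℝ) : Prop where
  initial : ∀ k : Idx Nx Ny, U 0 k = u₀ (node xL xR Nx k.2) (node yL yR Ny k.1)
  recursion : ∀ n < Nt,
    ((1 - Ax α P xL xR Nx Ny (T / Nt) dp dm) * (1 - Ay β P yL yR Nx Ny (T / Nt) ep em)) *ᵥ U (n + 1)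
      = ((1 + Ax α P xL xR Nx Ny (T / Nt) dp dm) * (1 + Ay β P yL yR Nx Ny (T / Nt) ep em)) *ᵥ U n
        + (T / Nt) • (fun k : Idx Nx Ny =>
            f (node xL xR Nx k.2) (node yL yR Ny k.1) (((n : ℝ) + 1 / 2) * (T / Nt)))

/-- The discrete 2-norm `(Δx Δy ∑ |v_{i,j}|²)^{1/2}` of a mesh function. -/
def discreteNorm (xL xR yL yR : ℝ) (Nx Ny : ℕ) (v : Idx Nx Ny → ℝ) : ℝ :=
  Real.sqrt (step xL xR Nx * step yL yR Ny * ∑ k, v k ^ 2)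

end

end WSLD

/-! The proof is consistency plus stability, arranged so that the coefficients may vanish.

Stability. On the mesh write `D₊ = X²`, `E₊ = Y²` with `X`, `Y` diagonal, and let `Bx`, `By` be the
Kronecker lifts of `h^{-γ}(A + κ Aᵀ)`. These are dissipative, but `X² Bx` in general is not, and
without a positive lower bound on the coefficients one cannot divide by them. Instead one uses `(1 -
c X² Bx) X = X (1 - c X Bx X)`: the operator `X Bx X` is dissipative, so a source lying in the range
of `X` produces an error `X w` with `w` controlled in the Euclidean norm. By `residual_identity` the
truncation error is `a + X² b + Y² d + X² Y² g`. Only the time quadrature error `a` has no weight in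
front. It is summed directly, and this is harmless because `Bx a`, `By a` and `Bx By a` are small as
well. Accordingly the error is `z + X w₁ + Y w₂ + X Y w₃` (`adi_error_bound`). The Kronecker
structure supplies the commutation relations needed.

Dissipativity. Let `P(ζ) = 3/2 - 2ζ + ζ²/2`. The quadratic form of the Toeplitz matrix is an average
over the unit circle of `Re (P(ζ)^α W(ζ))` against a nonnegative weight, where `W` is the
exponential sum of the shifts (`IsStableFourthOrder.sum_mul_lubichZ_nonpos`). Since `P^α = P^{α-1}
P` and `Re P ≥ 0`, the inequality `tan (δ a) ≤ δ tan a` reduces the sign for real `α` to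
inequalities for `P W` and `P² W` (`re_cpow_mul_nonpos`, `re_symBase_cpow_mul_nonpos`), which become
polynomial in `sin² (θ/2)`. For shifts in `{-2, …, 2}` the moment conditions leave one parameter and
the criterion is affine in it. For the infinite family, `W` is the third order sum at `1, 2, -2`
plus a multiple of a third difference that is bounded independently of the shifts. Both cases end in
`Shifts.isStableFourthOrder`.

Consistency. The moments of the weights cancel the expansion of `P(e^{-z})^α` up to a relative error
`O(z⁴)` (`IsStableFourthOrder.exists_norm_symbol_sub_le`). On zero extended functions with
integrable Fourier transform, a matrix row acts as the Fourier multiplier given by its symbol, and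
the Riemann-Liouville derivatives act as `(∓ i k)^α` (`FourierRep.leftRL_eq`,
`FourierRep.rightRL_eq`). Every mesh quantity is then bounded by a weighted Fourier integral
(`abs_multiplier_le`). Midpoint formulas in time, applied before and after the difference operators,
give `IsSmoothSolution.exists_consistency_bound`. -/

namespace WSLD

/-! ### Stability of alternating direction schemes with degenerate coefficients -/

section ADI

variable {V : Type*} [NormedAddCommGroup V] [InnerProductSpace ℝ V]

open scoped InnerProductSpace

/-- A dissipative operator. -/
def Dissipative (A : Module.End ℝ V) : Prop := ∀ v, ⟪A v, v⟫_ℝ ≤ 0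

/-- Pairing `v - A v` with `v` gives at least `‖v‖²`; Cauchy-Schwarz then cancels one factor `‖v‖`.
-/
theorem Dissipative.norm_le {A : Module.End ℝ V} (hA : Dissipative A) (v : V) :
    ‖v‖ ≤ ‖v - A v‖ := by
  have h1 : ⟪v - A v, v⟫_ℝ ≤ ‖v - A v‖ * ‖v‖ := real_inner_le_norm _ _
  rw [inner_sub_left, real_inner_self_eq_norm_sq] at h1
  have h2 := hA v
  by_contra! h
  have h3 : 0 < ‖v‖ := (norm_nonneg _).trans_lt h
  nlinarith

/-- The two squared norms differ only in the sign of `2⟪v, A v⟫ ≤ 0`. Together with the resolvent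
this makes the Cayley transform a contraction. -/
theorem Dissipative.norm_one_add_le {A : Module.End ℝ V} (hA : Dissipative A) (v : V) :
    ‖v + A v‖ ≤ ‖v - A v‖ := by
  have h2 := hA v
  rw [real_inner_comm] at h2
  have h3 := norm_add_sq_real v (A v)
  have h4 := norm_sub_sq_real v (A v)
  exact le_of_sq_le_sq (by linarith) (norm_nonneg _)

theorem Dissipative.isUnit [FiniteDimensional ℝ V] {A : Module.End ℝ V} (hA : Dissipative A) :
    IsUnit (1 - A) := by
  rw [Module.End.isUnit_iff]
  have : Function.Injective ((1 - A : Module.End ℝ V)) := by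
    rw [← LinearMap.ker_eq_bot, LinearMap.ker_eq_bot']
    intro v hv
    have := hA.norm_le v
    simp only [LinearMap.sub_apply, Module.End.one_apply] at hv
    rw [hv, norm_zero] at this
    simpa using this
  exact ⟨this, LinearMap.injective_iff_surjective.1 this⟩

/-- The resolvent `(1 - A)⁻¹`. -/
noncomputable def resolvent (A : Module.End ℝ V) : Module.End ℝ V := Ring.inverse (1 - A)

theorem Dissipative.mul_resolvent [FiniteDimensional ℝ V] {A : Module.End ℝ V} (hA : Dissipative A) :
    (1 - A) * resolvent A = 1 := Ring.mul_inverse_cancel _ hA.isUnit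

theorem Dissipative.resolvent_mul [FiniteDimensional ℝ V] {A : Module.End ℝ V} (hA : Dissipative A) :
    resolvent A * (1 - A) = 1 := Ring.inverse_mul_cancel _ hA.isUnit

theorem Dissipative.norm_resolvent_le [FiniteDimensional ℝ V] {A : Module.End ℝ V} (hA : Dissipative A) (v : V) :
    ‖resolvent A v‖ ≤ ‖v‖ := by
  have h := hA.norm_le (resolvent A v)
  have h2 : (1 - A) (resolvent A v) = v := by
    rw [← Module.End.mul_apply, hA.mul_resolvent, Module.End.one_apply]
  simp only [LinearMap.sub_apply, Module.End.one_apply] at h2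
  rwa [h2] at h

theorem Dissipative.norm_cayley_le [FiniteDimensional ℝ V] {A : Module.End ℝ V} (hA : Dissipative A) (v : V) :
    ‖((1 + A) * resolvent A) v‖ ≤ ‖v‖ := by
  have h := hA.norm_one_add_le (resolvent A v)
  have h2 : (1 - A) (resolvent A v) = v := by
    rw [← Module.End.mul_apply, hA.mul_resolvent, Module.End.one_apply]
  simp only [LinearMap.sub_apply, Module.End.one_apply] at h2
  rw [h2] at h
  simpa using h

/-- Lets an auxiliary operator `S` pass through an evolution: `S w` evolves with source `S s`, so it
obeys the same bound. -/
theorem Dissipative.commute_resolvent [FiniteDimensional ℝ V] {A S : Module.End ℝ V}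
    (hA : Dissipative A) (h : Commute S A) : Commute S (resolvent A) := by
  have h1 : Commute S (1 - A) := (Commute.one_right S).sub_right h
  calc S * resolvent A = (resolvent A * (1 - A)) * (S * resolvent A) := by
        rw [hA.resolvent_mul, one_mul]
    _ = resolvent A * ((1 - A) * S) * resolvent A := by noncomm_ring
    _ = resolvent A * S * ((1 - A) * resolvent A) := by rw [← h1.eq]; noncomm_ring
    _ = resolvent A * S := by rw [hA.mul_resolvent, mul_one]

/-- One directional Crank-Nicolson evolution with a source. -/
theorem Dissipative.exists_evolution [FiniteDimensional ℝ V] {A : Module.End ℝ V} (hA : Dissipative A) (τ : ℝ)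
    (hτ : 0 ≤ τ) (s : ℕ → V) :
    ∃ w : ℕ → V, w 0 = 0 ∧ (∀ n, (1 - A) (w (n + 1)) = (1 + A) (w n) + τ • s n) ∧
      ∀ S : Module.End ℝ V, Commute S A → ∀ K : ℝ, ∀ n, (∀ k < n, ‖S (s k)‖ ≤ K) →
        ‖S (w n)‖ ≤ n * τ * K := by
  let w : ℕ → V := fun n => Nat.rec 0 (fun n x => ((1 + A) * resolvent A) x +
    τ • resolvent A (s n)) n
  have hw : ∀ n, w (n + 1) = ((1 + A) * resolvent A) (w n) + τ • resolvent A (s n) := fun n => rfl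
  have h1 : (1 - A) * ((1 + A) * resolvent A) = 1 + A := by
    have : (1 - A) * ((1 + A) * resolvent A) = (1 + A) * ((1 - A) * resolvent A) := by noncomm_ring
    rw [this, hA.mul_resolvent, mul_one]
  refine ⟨w, rfl, fun n => ?_, fun S hS K n => ?_⟩
  · rw [hw, map_add, map_smul, ← Module.End.mul_apply, h1, ← Module.End.mul_apply,
      hA.mul_resolvent, Module.End.one_apply]
  · induction n with
    | zero => intro _; simp [w]
    | succ n ih =>
      intro hK
      have hR := hA.commute_resolvent hS
      have hG : Commute S ((1 + A) * resolvent A) :=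
        ((Commute.one_right S).add_right hS).mul_right hR
      have e : S (w (n + 1)) = ((1 + A) * resolvent A) (S (w n)) + τ • resolvent A (S (s n)) := by
        rw [hw, map_add, map_smul, ← Module.End.mul_apply S, hG.eq, ← Module.End.mul_apply S,
          hR.eq]
        rfl
      rw [e]
      have i1 := ih fun k hk => hK k (by omega)
      have i2 := hA.norm_cayley_le (S (w n))
      have i3 := hA.norm_resolvent_le (S (s n))
      have i4 := hK n (by omega)
      refine (_root_.norm_add_le _ _).trans ?_
      rw [norm_smul, Real.norm_of_nonneg hτ]
      have : τ * ‖resolvent A (S (s n))‖ ≤ τ * K := by gcongr; linarith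
      push_cast
      linarith

/-- Two directional Crank-Nicolson evolution with a source. -/
theorem Dissipative.exists_evolution₂ [FiniteDimensional ℝ V] {A B : Module.End ℝ V} (hA : Dissipative A)
    (hB : Dissipative B) (hAB : Commute A B) (τ : ℝ) (hτ : 0 ≤ τ) (s₁ s₂ s₃ : ℕ → V) :
    ∃ w : ℕ → V, w 0 = 0 ∧ (∀ n, ((1 - A) * (1 - B)) (w (n + 1)) = ((1 + A) * (1 + B)) (w n) +
      τ • ((1 - A) (s₁ n) + (1 - B) (s₂ n) + s₃ n)) ∧
      ∀ K : ℝ, ∀ n, (∀ k < n, ‖s₁ k‖ + ‖s₂ k‖ + ‖s₃ k‖ ≤ K) → ‖w n‖ ≤ n * τ * K := by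
  let G : Module.End ℝ V := ((1 + A) * resolvent A) * ((1 + B) * resolvent B)
  -- Inverting `(1 - A)(1 - B)` on a source `(1 - A) s₁` cancels `1 - A` and leaves only the
  -- contraction `resolvent B`. Hence `‖s₁‖` alone enters, however large `A` is.
  let w : ℕ → V := fun n => Nat.rec 0 (fun n x => G x +
    τ • (resolvent B (s₁ n) + resolvent A (s₂ n) + resolvent A (resolvent B (s₃ n)))) n
  have hw : ∀ n, w (n + 1) = G (w n) + τ • (resolvent B (s₁ n) + resolvent A (s₂ n) +
    resolvent A (resolvent B (s₃ n))) := fun n => rfl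
  have hAB' : Commute (1 - A) (1 - B) :=
    ((Commute.one_right _).sub_right ((Commute.one_left _).sub_left hAB))
  have hRB : Commute (resolvent A) (1 - B) :=
    ((Commute.one_right _).sub_right (hA.commute_resolvent hAB.symm).symm)
  have hRA : Commute (1 + A) (1 - B) :=
    ((Commute.one_right _).sub_right ((Commute.one_left _).add_left hAB))
  have h1 : (1 - A) * (1 - B) * G = (1 + A) * (1 + B) := by
    have e1 : (1 - A) * (1 - B) * G = (1 - A) * ((1 - B) * (1 + A)) * resolvent A *
      ((1 + B) * resolvent B) := by simp only [G]; noncomm_ring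
    have e2 : (1 - A) * ((1 + A) * (1 - B)) * resolvent A * ((1 + B) * resolvent B) =
      (1 + A) * (1 - A) * ((1 - B) * resolvent A) * ((1 + B) * resolvent B) := by noncomm_ring
    have e3 : (1 + A) * (1 - A) * (resolvent A * (1 - B)) * ((1 + B) * resolvent B) =
      (1 + A) * ((1 - A) * resolvent A) * (1 + B) * ((1 - B) * resolvent B) := by noncomm_ring
    rw [e1, ← hRA.eq, e2, ← hRB.eq, e3, hA.mul_resolvent, hB.mul_resolvent, mul_one, mul_one]
  have h2 : ∀ x, ((1 - A) * (1 - B)) (resolvent B x) = (1 - A) x := fun x => by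
    rw [← Module.End.mul_apply, mul_assoc, hB.mul_resolvent, mul_one]
  have h3 : ∀ x, ((1 - A) * (1 - B)) (resolvent A x) = (1 - B) x := fun x => by
    rw [hAB'.eq, ← Module.End.mul_apply, mul_assoc, hA.mul_resolvent, mul_one]
  have h4 : ∀ x, (1 - B) (resolvent B x) = x := fun x => by
    rw [← Module.End.mul_apply, hB.mul_resolvent, Module.End.one_apply]
  refine ⟨w, rfl, fun n => ?_, fun K n => ?_⟩
  · rw [hw, map_add, map_smul, ← Module.End.mul_apply _ G, h1, map_add, map_add, h2, h3, h3, h4]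
  · induction n with
    | zero => intro _; simp [w]
    | succ n ih =>
      intro hK
      have i1 := ih fun k hk => hK k (by omega)
      have i2 : ‖G (w n)‖ ≤ ‖w n‖ := (hA.norm_cayley_le _).trans (hB.norm_cayley_le _)
      have i3 := hB.norm_resolvent_le (s₁ n)
      have i4 := hA.norm_resolvent_le (s₂ n)
      have i5 := (hA.norm_resolvent_le (resolvent B (s₃ n))).trans (hB.norm_resolvent_le _)
      have i6 := hK n (by omega)
      rw [hw]
      refine (_root_.norm_add_le _ _).trans ?_
      rw [norm_smul, Real.norm_of_nonneg hτ]
      have : τ * ‖resolvent B (s₁ n) + resolvent A (s₂ n) + resolvent A (resolvent B (s₃ n))‖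
          ≤ τ * K := by
        gcongr
        exact (norm_add₃_le).trans (by linarith)
      push_cast
      linarith

/-- Symmetry of `X` gives `⟪X B X v, v⟫ = ⟪B (X v), X v⟫`. Invertibility of `X` plays no role. -/
theorem dissipative_conj {X B : Module.End ℝ V} (hX : ∀ v w, ⟪X v, w⟫_ℝ = ⟪v, X w⟫_ℝ)
    (hB : Dissipative B) {c : ℝ} (hc : 0 ≤ c) : Dissipative (c • (X * B * X)) := fun v => by
  simp only [LinearMap.smul_apply, Module.End.mul_apply, inner_smul_left, hX]
  exact mul_nonpos_of_nonneg_of_nonpos (by simpa using hc) (hB _)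

/-- A kernel vector is `v = X q` with `q = c X B v`, and this `q` lies in the kernel of `1 - c X B
X`, which is trivial by dissipativity. -/
theorem injective_one_sub_smul_sq {X B : Module.End ℝ V}
    (hX : ∀ v w, ⟪X v, w⟫_ℝ = ⟪v, X w⟫_ℝ) (hB : Dissipative B) {c : ℝ} (hc : 0 ≤ c) (v : V)
    (hv : (1 - c • (X * X * B)) v = 0) : v = 0 := by
  have h0 : v = X (c • X (B v)) := by
    have : v - c • X (X (B v)) = 0 := by simpa using hv
    rw [map_smul]; exact sub_eq_zero.1 this
  set q := c • X (B v) with hq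
  have h1 : (1 - c • (X * B * X)) q = 0 := by
    have : q - c • X (B (X q)) = 0 := by rw [← h0, ← hq, sub_self]
    simpa using this
  have h2 := (dissipative_conj hX hB hc).norm_le q
  have h3 : q - (c • (X * B * X)) q = 0 := by simpa using h1
  rw [h3, norm_zero] at h2
  rw [h0, norm_le_zero_iff.1 h2, map_zero]

end ADI
end WSLD

/-! ### The error bound for a factored scheme with degenerate weights. -/

namespace WSLD

section ADI

variable {V : Type*} [NormedAddCommGroup V] [InnerProductSpace ℝ V] [FiniteDimensional ℝ V]

open scoped InnerProductSpace

/-- Error bound for the scheme `(1 - c X²Bx)(1 - c Y²By) e' = (1 + c X²Bx)(1 + c Y²By) e + τ r`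
with sources `r = a + X² b + Y² d + X² Y² g` which are compatible with the weights. -/
theorem adi_error_bound {X Y Bx By : Module.End ℝ V}
    (hX : ∀ v w, ⟪X v, w⟫_ℝ = ⟪v, X w⟫_ℝ) (hY : ∀ v w, ⟪Y v, w⟫_ℝ = ⟪v, Y w⟫_ℝ)
    (hBx : Dissipative Bx) (hBy : Dissipative By)
    (hXY : Commute X Y) (hXB : Commute X By) (hYB : Commute Y Bx) (hBB : Commute Bx By)
    {M : ℝ} (hM : 0 ≤ M) (hXM : ∀ v, ‖X v‖ ≤ M * ‖v‖) (hYM : ∀ v, ‖Y v‖ ≤ M * ‖v‖)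
    {τ T ε : ℝ} (hτ : 0 ≤ τ) (hε : 0 ≤ ε) {N : ℕ} (hN : N * τ ≤ T) (hτT : τ ≤ T)
    (e a b d g : ℕ → V) (he0 : e 0 = 0)
    (he : ∀ n < N, ((1 - (τ / 2) • (X * X * Bx)) * (1 - (τ / 2) • (Y * Y * By))) (e (n + 1)) =
      ((1 + (τ / 2) • (X * X * Bx)) * (1 + (τ / 2) • (Y * Y * By))) (e n) +
        τ • (a n + X (X (b n)) + Y (Y (d n)) + X (X (Y (Y (g n))))))
    (ha : ∀ n < N, ‖a n‖ ≤ ε) (hax : ∀ n < N, ‖Bx (a n)‖ ≤ ε) (hay : ∀ n < N, ‖By (a n)‖ ≤ ε)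
    (haxy : ∀ n < N, ‖Bx (By (a n))‖ ≤ ε) (hb : ∀ n < N, ‖b n‖ ≤ ε)
    (hby : ∀ n < N, ‖By (b n)‖ ≤ ε) (hd : ∀ n < N, ‖d n‖ ≤ ε) (hdx : ∀ n < N, ‖Bx (d n)‖ ≤ ε)
    (hg : ∀ n < N, ‖g n‖ ≤ ε) (n : ℕ) (hn : n ≤ N) :
    ‖e n‖ ≤ (T + 2 * (M * (T * (M * (1 + T)))) +
      M * (M * (T * (2 * (M * (T * (M * (1 + T)))) +
        M * (M * (1 + T ^ 2 + 2 * (T * (1 + T)))))))) * ε := by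
  have hT : 0 ≤ T := hτ.trans hτT
  obtain ⟨c, hc⟩ : ∃ c, c = τ / 2 := ⟨_, rfl⟩
  have hτc : τ = 2 * c := by rw [hc]; ring
  have hc0 : 0 ≤ c := by rw [hc]; positivity
  rw [← hc] at he
  -- commutation as rewriting rules on vectors
  have cXY : ∀ v, Y (X v) = X (Y v) := fun v => (congrArg (· v) hXY.eq).symm
  have cXB : ∀ v, By (X v) = X (By v) := fun v => (congrArg (· v) hXB.eq).symm
  have cYB : ∀ v, Bx (Y v) = Y (Bx v) := fun v => (congrArg (· v) hYB.eq).symm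
  have cBB : ∀ v, By (Bx v) = Bx (By v) := fun v => (congrArg (· v) hBB.eq).symm
  -- the plain part
  let z : ℕ → V := fun n => τ • ∑ k ∈ Finset.range n, a k
  have hz1 : ∀ n, z (n + 1) = z n + τ • a n := fun n => by
    simp only [z, Finset.sum_range_succ, smul_add]
  have hzS : ∀ S : Module.End ℝ V, (∀ n < N, ‖S (a n)‖ ≤ ε) → ∀ n ≤ N, ‖S (z n)‖ ≤ T * ε := by
    intro S hS n hn
    simp only [z, map_smul, map_sum, norm_smul, Real.norm_of_nonneg hτ]
    have h1 : ‖∑ k ∈ Finset.range n, S (a k)‖ ≤ n * ε := by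
      refine (norm_sum_le_of_le _ (f := fun k => S (a k)) (n := fun _ => ε) fun k hk =>
        hS k (by have := Finset.mem_range.1 hk; omega)).trans (by simp)
    calc τ * _ ≤ τ * (n * ε) := by gcongr
      _ ≤ τ * (N * ε) := by gcongr
      _ = N * τ * ε := by ring
      _ ≤ T * ε := by gcongr
  -- Inserting `z` into the scheme reproduces `τ a`, together with `-(τ/2) X² Bx (z' + z)`, the
  -- analogous term in `Y² By`, and, because `z' - z = τ a`, the mixed term `τ c² X² Y² Bx By a`.
  -- The primed sources compensate for these.
  let b' : ℕ → V := fun n => b n + (1 / 2 : ℝ) • Bx (z (n + 1) + z n)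
  let d' : ℕ → V := fun n => d n + (1 / 2 : ℝ) • By (z (n + 1) + z n)
  let g' : ℕ → V := fun n => g n - (c ^ 2) • Bx (By (a n))
  have half : ∀ p q r : V, ∀ ε' : ℝ, ‖p‖ ≤ ε → ‖q‖ ≤ ε' → ‖r‖ ≤ ε' →
      ‖p + (1 / 2 : ℝ) • (q + r)‖ ≤ ε + ε' := by
    intro p q r ε' hp hq hr
    refine (norm_add_le _ _).trans ?_
    rw [norm_smul, Real.norm_of_nonneg (by norm_num)]
    have := norm_add_le q r
    linarith
  have hb' : ∀ n < N, ‖b' n‖ ≤ (1 + T) * ε := fun n hn => by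
    simp only [b', map_add]
    exact (half _ _ _ _ (hb n hn) (hzS Bx hax _ (by omega)) (hzS Bx hax _ (by omega))).trans
      (by linarith)
  have hb'y : ∀ n < N, ‖By (b' n)‖ ≤ (1 + T) * ε := fun n hn => by
    simp only [b', map_add, map_smul, cBB]
    exact (half _ _ _ _ (hby n hn) (hzS (Bx * By) haxy _ (by omega))
      (hzS (Bx * By) haxy _ (by omega))).trans (by linarith)
  have hd' : ∀ n < N, ‖d' n‖ ≤ (1 + T) * ε := fun n hn => by
    simp only [d', map_add]
    exact (half _ _ _ _ (hd n hn) (hzS By hay _ (by omega)) (hzS By hay _ (by omega))).trans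
      (by linarith)
  have hd'x : ∀ n < N, ‖Bx (d' n)‖ ≤ (1 + T) * ε := fun n hn => by
    simp only [d', map_add, map_smul]
    exact (half _ _ _ _ (hdx n hn) (hzS (Bx * By) haxy _ (by omega))
      (hzS (Bx * By) haxy _ (by omega))).trans (by linarith)
  -- the one directional parts
  have hAx := dissipative_conj hX hBx hc0
  have hAy := dissipative_conj hY hBy hc0
  -- By the intertwining relation, `X w₁` solves the scheme in the `x` direction with source `X²
  -- b'`, and `Y w₂` the one in the `y` direction with source `Y² d'`.
  obtain ⟨w₁, w₁0, hw₁, bw₁⟩ := hAx.exists_evolution τ hτ (fun n => X (b' n))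
  obtain ⟨w₂, w₂0, hw₂, bw₂⟩ := hAy.exists_evolution τ hτ (fun n => Y (d' n))
  have hByAx : Commute By (c • (X * Bx * X)) :=
    (((hXB.symm.mul_right hBB.symm).mul_right hXB.symm)).smul_right c
  have hBxAy : Commute Bx (c • (Y * By * Y)) :=
    (((hYB.symm.mul_right hBB).mul_right hYB.symm)).smul_right c
  have hAxAy : Commute (c • (X * Bx * X)) (c • (Y * By * Y)) :=
    (((((hXY.mul_right hXB).mul_right hXY).mul_left
      ((hYB.symm.mul_right hBB).mul_right hYB.symm)).mul_left
        ((hXY.mul_right hXB).mul_right hXY)).smul_left c).smul_right c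
  have nT : ∀ n ≤ N, ∀ K : ℝ, 0 ≤ K → n * τ * K ≤ T * K := fun n hn K hK => by
    have : (n : ℝ) * τ ≤ N * τ := by gcongr
    gcongr
    linarith
  have hE : 0 ≤ (1 + T) * ε := by positivity
  have hbw₁ : ∀ n ≤ N, ‖w₁ n‖ ≤ T * (M * ((1 + T) * ε)) := fun n hn =>
    (bw₁ 1 (Commute.one_left _) _ n fun k hk => (hXM _).trans
      (mul_le_mul_of_nonneg_left (hb' k (by omega)) hM)).trans (nT n hn _ (by positivity))
  have hbw₂ : ∀ n ≤ N, ‖w₂ n‖ ≤ T * (M * ((1 + T) * ε)) := fun n hn =>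
    (bw₂ 1 (Commute.one_left _) _ n fun k hk => (hYM _).trans
      (mul_le_mul_of_nonneg_left (hd' k (by omega)) hM)).trans (nT n hn _ (by positivity))
  have hbw₁y : ∀ n ≤ N, ‖By (w₁ n)‖ ≤ T * (M * ((1 + T) * ε)) := fun n hn =>
    (bw₁ By hByAx _ n fun k hk => by
      rw [cXB]
      exact (hXM _).trans (mul_le_mul_of_nonneg_left (hb'y k (by omega)) hM)).trans
      (nT n hn _ (by positivity))
  have hbw₂x : ∀ n ≤ N, ‖Bx (w₂ n)‖ ≤ T * (M * ((1 + T) * ε)) := fun n hn =>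
    (bw₂ Bx hBxAy _ n fun k hk => by
      rw [cYB]
      exact (hYM _).trans (mul_le_mul_of_nonneg_left (hd'x k (by omega)) hM)).trans
      (nT n hn _ (by positivity))
  -- the mixed part
  obtain ⟨w₃, w₃0, hw₃, bw₃⟩ := hAx.exists_evolution₂ hAy hAxAy τ hτ
    -- With `p = c X² Bx` and `q = c Y² By`, inserting `X w₁` into the full scheme gives `τ (1 + q)
    -- X² b' - τ Y² By (1 - p) X w₁'`. Apart from `τ X² b'` everything here carries the factor `X
    -- Y`, and `w₃` has to cancel it; likewise for `w₂`. The source bounds use `By w₁` and `Bx w₂`,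
    -- never `Bx w₁` or `By w₂`.
    (fun n => Y (By (w₁ (n + 1)))) (fun n => X (Bx (w₂ (n + 1))))
    (fun n => X (Y (g' n - c • By (b' n) - c • Bx (d' n))))
  have hcT : c ≤ T := by linarith
  have hbw₃ : ∀ n ≤ N, ‖w₃ n‖ ≤ T * (2 * (M * (T * (M * ((1 + T) * ε)))) +
      M * (M * ((1 + T ^ 2 + 2 * (T * (1 + T))) * ε))) := fun n hn => by
    refine (bw₃ _ n fun k hk => ?_).trans (nT n hn _ (by positivity))
    have i1 := (hYM (By (w₁ (k + 1)))).trans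
      (mul_le_mul_of_nonneg_left (hbw₁y (k + 1) (by omega)) hM)
    have i2 := (hXM (Bx (w₂ (k + 1)))).trans
      (mul_le_mul_of_nonneg_left (hbw₂x (k + 1) (by omega)) hM)
    have i3 : ‖g' k - c • By (b' k) - c • Bx (d' k)‖ ≤ (1 + T ^ 2 + 2 * (T * (1 + T))) * ε := by
      have j1 : ‖g' k‖ ≤ (1 + T ^ 2) * ε := by
        refine (norm_sub_le _ _).trans ?_
        rw [norm_smul, Real.norm_of_nonneg (by positivity)]
        have h1 := hg k (by omega)
        have h2 : c ^ 2 * ‖Bx (By (a k))‖ ≤ T ^ 2 * ε := by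
          have := haxy k (by omega)
          gcongr
        linarith
      have j2 : ‖c • By (b' k)‖ ≤ T * ((1 + T) * ε) := by
        rw [norm_smul, Real.norm_of_nonneg hc0]
        have := hb'y k (by omega)
        gcongr
      have j3 : ‖c • Bx (d' k)‖ ≤ T * ((1 + T) * ε) := by
        rw [norm_smul, Real.norm_of_nonneg hc0]
        have := hd'x k (by omega)
        gcongr
      have k1 := norm_sub_le (g' k - c • By (b' k)) (c • Bx (d' k))
      have k2 := norm_sub_le (g' k) (c • By (b' k))
      linarith
    have i4 := (hXM (Y (g' k - c • By (b' k) - c • Bx (d' k)))).trans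
      (mul_le_mul_of_nonneg_left ((hYM _).trans (mul_le_mul_of_nonneg_left i3 hM)) hM)
    linarith
  -- the error equals the sum of the parts
  have key : ∀ n ≤ N, e n = z n + X (w₁ n) + Y (w₂ n) + X (Y (w₃ n)) := by
    intro n
    induction n with
    | zero => intro _; simp [he0, z, w₁0, w₂0, w₃0]
    | succ n ih =>
      intro hn
      have inj : ∀ v, ((1 - c • (X * X * Bx)) * (1 - c • (Y * Y * By))) v = 0 → v = 0 :=
        fun v hv => injective_one_sub_smul_sq hY hBy hc0 v
          (injective_one_sub_smul_sq hX hBx hc0 _ hv)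
      rw [← sub_eq_zero]
      apply inj
      rw [map_sub, he n (by omega), ih (by omega)]
      have cBY : ∀ v, Y (Bx v) = Bx (Y v) := fun v => (cYB v).symm
      -- The factor is `1 + c Y² By`, matching the appearance of `w₁ (n + 1)` rather than `w₁ n` in
      -- the mixed source.
      have q1 := congrArg (X * (1 + c • (Y * Y * By)) : Module.End ℝ V) (hw₁ n)
      have q2 := congrArg (Y * (1 + c • (X * X * Bx)) : Module.End ℝ V) (hw₂ n)
      have q3 := congrArg (X * Y : Module.End ℝ V) (hw₃ n)
      simp only [hz1, hτc, b', d', g', LinearMap.add_apply, LinearMap.sub_apply,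
        LinearMap.smul_apply, Module.End.mul_apply, Module.End.one_apply, map_add, map_sub,
        map_smul, cXY, cXB, cBY, cBB] at q1 q2 q3 ⊢
      linear_combination (norm := module) -q1 - q2 - q3
  rw [key n hn]
  have r1 := hzS 1 ha n hn
  have r2 := (hXM (w₁ n)).trans (mul_le_mul_of_nonneg_left (hbw₁ n hn) hM)
  have r3 := (hYM (w₂ n)).trans (mul_le_mul_of_nonneg_left (hbw₂ n hn) hM)
  have r4 := (hXM (Y (w₃ n))).trans (mul_le_mul_of_nonneg_left ((hYM (w₃ n)).trans
    (mul_le_mul_of_nonneg_left (hbw₃ n hn) hM)) hM)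
  have s1 := norm_add_le (z n + X (w₁ n) + Y (w₂ n)) (X (Y (w₃ n)))
  have s2 := norm_add_le (z n + X (w₁ n)) (Y (w₂ n))
  have s3 := norm_add_le (z n) (X (w₁ n))
  rw [Module.End.one_apply] at r1
  linarith

end ADI
end WSLD

namespace WSLD

/-! ### The generating function of the Lubich coefficients -/

theorem g_succ (α : ℝ) (k : ℕ) : g α (k + 1) = (1 - (α + 1) / ((k : ℝ) + 1)) * g α k := rfl

/-- Coefficient comparison in `F' = -α F / (1 - ζ)` for `F = (1 - ζ)^α`: dividing by `1 - ζ` forms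
partial sums. -/
theorem g_succ_eq_sum (α : ℝ) (n : ℕ) :
    g α (n + 1) = -(α / (n + 1)) * ∑ k ∈ Finset.range (n + 1), g α k := by
  induction n with
  | zero => simp [g]
  | succ n ih =>
    rw [Finset.sum_range_succ, g_succ, ih]
    set S := ∑ k ∈ Finset.range (n + 1), g α k
    push_cast
    have h1 : (n : ℝ) + 1 ≠ 0 := by positivity
    have h2 : (n : ℝ) + 1 + 1 ≠ 0 := by positivity
    field_simp
    ring

/-- By `g_succ_eq_sum`, each partial sum is the previous one times `1 - α/(n+1)`, a factor in `[-1,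
1]`. -/
theorem abs_sum_g_le_one {α : ℝ} (h0 : 0 < α) (h2 : α < 2) (n : ℕ) :
    |∑ k ∈ Finset.range (n + 1), g α k| ≤ 1 := by
  induction n with
  | zero => simp [g]
  | succ n ih =>
    rw [Finset.sum_range_succ, g_succ_eq_sum]
    set S := ∑ k ∈ Finset.range (n + 1), g α k
    have e : S + -(α / (n + 1)) * S = (1 - α / (n + 1)) * S := by ring
    rw [e, abs_mul]
    have h3 : 0 < α / ((n : ℝ) + 1) := by positivity
    have h4 : α / ((n : ℝ) + 1) ≤ α := div_le_self h0.le (by linarith [n.cast_nonneg (α := ℝ)])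
    have h5 : |1 - α / ((n : ℝ) + 1)| ≤ 1 := by rw [abs_le]; constructor <;> linarith
    exact mul_le_one₀ h5 (abs_nonneg _) ih

theorem g_nonneg {α : ℝ} (h1 : 1 < α) (h2 : α < 2) (n : ℕ) : 0 ≤ g α (n + 2) := by
  induction n with
  | zero => simp only [g]; norm_num; nlinarith
  | succ n ih =>
    rw [g_succ]
    refine mul_nonneg ?_ ih
    have : (0 : ℝ) < ((n + 2 : ℕ) : ℝ) + 1 := by positivity
    rw [sub_nonneg, div_le_one this]
    push_cast
    linarith [n.cast_nonneg (α := ℝ)]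

/-- From index 2 on the coefficients are nonnegative, so bounded partial sums suffice. The first two
coefficients are `1` and `-α`, whence the bound `1 - (1 - α) = α` for the rest. -/
theorem summable_g {α : ℝ} (h1 : 1 < α) (h2 : α < 2) : Summable (g α) := by
  rw [← summable_nat_add_iff 2]
  refine summable_of_sum_range_le (c := α) (g_nonneg h1 h2) fun n => ?_
  have h3 := abs_sum_g_le_one (by linarith) h2 (n + 1)
  rw [Finset.sum_range_succ', Finset.sum_range_succ'] at h3
  have h5 := (abs_le.1 h3).2
  have h6 : g α (0 + 1) = -α := by simp [g]
  have h7 : g α 0 = 1 := rfl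
  rw [h6, h7] at h5
  have h8 : ∀ i, g α (i + 1 + 1) = g α (i + 2) := fun i => rfl
  simp only [h8] at h5
  linarith

theorem g_eq_choose (α : ℝ) (k : ℕ) : (g α k : ℂ) = (-1) ^ k * Ring.choose (α : ℂ) k := by
  induction k with
  | zero => simp [g]
  | succ k ih =>
    rw [g_succ]
    push_cast
    rw [ih, Ring.choose_eq_smul, Ring.choose_eq_smul, descPochhammer_succ_right]
    simp only [Polynomial.smeval_mul, Polynomial.smeval_sub, Polynomial.smeval_X, pow_one,
      Polynomial.smeval_natCast, pow_zero, Nat.factorial_succ, smul_eq_mul, Nat.cast_mul]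
    have h1 : ((k : ℂ) + 1) ≠ 0 := by exact_mod_cast Nat.succ_ne_zero k
    have h2 : ((Nat.factorial k : ℕ) : ℂ) ≠ 0 := by exact_mod_cast Nat.factorial_ne_zero k
    push_cast
    field_simp
    simp
    ring

theorem hasSum_g_of_lt (α : ℝ) {ζ : ℂ} (hζ : ‖ζ‖ < 1) :
    HasSum (fun k => (g α k : ℂ) * ζ ^ k) ((1 - ζ) ^ (α : ℂ)) := by
  have h := (Complex.one_add_cpow_hasFPowerSeriesOnBall_zero (a := (α : ℂ))).hasSum (y := -ζ)
    (by
      rw [← ENNReal.ofReal_one, Metric.eball_ofReal]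
      simpa using hζ)
  simp only [binomialSeries_apply, List.ofFn_const, List.prod_replicate, smul_eq_mul] at h
  have e : (fun k => (g α k : ℂ) * ζ ^ k) = fun k => Ring.choose (α : ℂ) k * (-ζ) ^ k := by
    funext k
    rw [g_eq_choose, neg_pow ζ]
    ring
  rw [e, sub_eq_add_neg]
  simpa using h

theorem re_one_sub_nonneg {ζ : ℂ} (hζ : ‖ζ‖ ≤ 1) : 0 ≤ (1 - ζ).re := by
  have := (Complex.re_le_norm ζ).trans hζ
  simpa using this

theorem summable_g_mul_pow {α : ℝ} (h1 : 1 < α) (h2 : α < 2) {ζ : ℂ} (hζ : ‖ζ‖ ≤ 1) :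
    Summable (fun k => ‖(g α k : ℂ) * ζ ^ k‖) := by
  refine Summable.of_nonneg_of_le (fun _ => norm_nonneg _) (fun k => ?_) (summable_g h1 h2).abs
  rw [norm_mul, norm_pow, Complex.norm_real, Real.norm_eq_abs]
  exact mul_le_of_le_one_right (abs_nonneg _) (pow_le_one₀ (norm_nonneg _) hζ)

/-- Both sides are continuous on the closed disc, the series by absolute summability and the power
because `Re (1 - ζ) ≥ 0` and `α > 0` cover the branch point as well. Agreement on the open disc
therefore extends to the boundary circle, where the symbol is needed. -/
theorem hasSum_g {α : ℝ} (h1 : 1 < α) (h2 : α < 2) {ζ : ℂ} (hζ : ‖ζ‖ ≤ 1) :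
    HasSum (fun k => (g α k : ℂ) * ζ ^ k) ((1 - ζ) ^ (α : ℂ)) := by
  have hc : ContinuousOn (fun z : ℂ => ∑' k, (g α k : ℂ) * z ^ k) (Metric.closedBall 0 1) := by
    refine continuousOn_tsum (u := fun k => |g α k|) (fun k => by fun_prop)
      (summable_g h1 h2).abs fun k z hz => ?_
    rw [norm_mul, norm_pow, Complex.norm_real, Real.norm_eq_abs]
    exact mul_le_of_le_one_right (abs_nonneg _) (pow_le_one₀ (norm_nonneg _) (by simpa using hz))
  have hc' : ContinuousOn (fun z : ℂ => (1 - z) ^ (α : ℂ)) (Metric.closedBall 0 1) := by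
    intro z hz
    refine ContinuousAt.continuousWithinAt ?_
    have := Complex.continuousAt_cpow_of_re_pos (p := (1 - z, (α : ℂ)))
      (Or.inl (re_one_sub_nonneg (by simpa using hz))) (by simp; linarith)
    exact ContinuousAt.comp (f := fun z : ℂ => (1 - z, (α : ℂ))) this (by fun_prop)
  have he : EqOn (fun z : ℂ => ∑' k, (g α k : ℂ) * z ^ k) (fun z : ℂ => (1 - z) ^ (α : ℂ))
      (Metric.closedBall 0 1) :=
    EqOn.of_subset_closure (s := Metric.ball 0 1)
      (fun z hz => (hasSum_g_of_lt α (by simpa using hz)).tsum_eq) hc hc'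
      Metric.ball_subset_closedBall (by rw [closure_ball _ one_ne_zero])
  have := he (by simpa using hζ : ζ ∈ Metric.closedBall 0 1)
  simp only at this
  rw [← this]
  exact (summable_g_mul_pow h1 h2 hζ).of_norm.hasSum

/-- The base `3/2 - 2ζ + ζ²/2` of the generating function. -/
noncomputable def symBase (ζ : ℂ) : ℂ := (1 - ζ) * (3 - ζ) / 2

/-- The arguments lie in `[-π/2, π/2]` and `(-π/2, π/2)`, so their sum stays in `(-π, π)` and the
principal logarithm is additive. -/
theorem mul_cpow_of_re {z w : ℂ} (hz : 0 ≤ z.re) (hw : 0 < w.re) (a : ℂ) :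
    (z * w) ^ a = z ^ a * w ^ a := by
  have hw0 : w ≠ 0 := fun h => by simp [h] at hw
  rcases eq_or_ne z 0 with rfl | hz0
  · rcases eq_or_ne a 0 with rfl | ha
    · simp
    · simp [Complex.zero_cpow ha]
  rw [Complex.cpow_def_of_ne_zero hz0, Complex.cpow_def_of_ne_zero hw0,
    Complex.cpow_def_of_ne_zero (mul_ne_zero hz0 hw0), ← Complex.exp_add, ← add_mul,
    Complex.log_mul hz0 hw0]
  have h1 := abs_le.1 (Complex.abs_arg_le_pi_div_two_iff.2 hz)
  have h2 := abs_lt.1 (Complex.abs_arg_lt_pi_div_two_iff.2 (Or.inl hw))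
  constructor <;> linarith [h1.1, h1.2, h2.1, h2.2]

theorem symBase_cpow {α : ℝ} {ζ : ℂ} (hζ : ‖ζ‖ ≤ 1) :
    symBase ζ ^ (α : ℂ) =
      ((3 / 2 : ℝ) ^ α : ℝ) * ((1 - ζ) ^ (α : ℂ) * (1 - ζ / 3) ^ (α : ℂ)) := by
  have h3 : 0 < (1 - ζ / 3).re := by
    have := (Complex.re_le_norm ζ).trans hζ
    have e : (ζ / 3).re = ζ.re / 3 := by
      rw [show (3 : ℂ) = ((3 : ℝ) : ℂ) by norm_num, Complex.div_ofReal_re]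
    rw [Complex.sub_re, e, Complex.one_re]
    linarith
  have e : symBase ζ = (1 - ζ) * (1 - ζ / 3) * ((3 / 2 : ℝ) : ℂ) := by
    rw [symBase]; push_cast; ring
  have e2 : symBase ζ = (1 - ζ) * (((3 / 2 : ℝ) : ℂ) * (1 - ζ / 3)) := by rw [e]; ring
  rw [e2, mul_cpow_of_re (re_one_sub_nonneg hζ) (by rw [Complex.re_ofReal_mul]; positivity),
    mul_cpow_of_re (by rw [Complex.ofReal_re]; norm_num) h3, Complex.ofReal_cpow (by norm_num)]
  ring

theorem lubich_eq {α : ℝ} (k : ℕ) (ζ : ℂ) : (lubich α k : ℂ) * ζ ^ k =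
    ((3 / 2 : ℝ) ^ α : ℝ) * ∑ m ∈ Finset.range (k + 1),
      ((g α m : ℂ) * (ζ / 3) ^ m) * ((g α (k - m) : ℂ) * ζ ^ (k - m)) := by
  rw [lubich]
  push_cast
  rw [mul_assoc, Finset.sum_mul]
  congr 1
  refine Finset.sum_congr rfl fun m hm => ?_
  have : ζ ^ k = ζ ^ m * ζ ^ (k - m) := by
    rw [← pow_add, Nat.add_sub_cancel' (by have := Finset.mem_range.1 hm; omega)]
  rw [this, div_pow]
  field_simp

theorem norm_div_three_le {ζ : ℂ} (hζ : ‖ζ‖ ≤ 1) : ‖ζ / 3‖ ≤ 1 := by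
  rw [norm_div]; norm_num; linarith

theorem summable_norm_lubich_mul_pow {α : ℝ} (h1 : 1 < α) (h2 : α < 2) {ζ : ℂ} (hζ : ‖ζ‖ ≤ 1) :
    Summable (fun k => ‖(lubich α k : ℂ) * ζ ^ k‖) := by
  simp only [lubich_eq, norm_mul (((3 / 2 : ℝ) ^ α : ℝ) : ℂ)]
  exact (summable_norm_sum_mul_range_of_summable_norm
    (summable_g_mul_pow h1 h2 (norm_div_three_le hζ)) (summable_g_mul_pow h1 h2 hζ)).mul_left _

theorem summable_lubich {α : ℝ} (h1 : 1 < α) (h2 : α < 2) : Summable (fun k => |lubich α k|) := by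
  simpa using summable_norm_lubich_mul_pow h1 h2 (ζ := 1) (by simp)

theorem hasSum_lubich {α : ℝ} (h1 : 1 < α) (h2 : α < 2) {ζ : ℂ} (hζ : ‖ζ‖ ≤ 1) :
    HasSum (fun k => (lubich α k : ℂ) * ζ ^ k) (symBase ζ ^ (α : ℂ)) := by
  have h3 := summable_g_mul_pow h1 h2 (norm_div_three_le hζ)
  have h4 := summable_g_mul_pow h1 h2 hζ
  have h5 := tsum_mul_tsum_eq_tsum_sum_range_of_summable_norm h3 h4
  rw [(hasSum_g h1 h2 (norm_div_three_le hζ)).tsum_eq, (hasSum_g h1 h2 hζ).tsum_eq] at h5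
  rw [symBase_cpow hζ, mul_comm ((1 - ζ) ^ (α : ℂ)), h5]
  simp only [lubich_eq]
  exact ((summable_norm_sum_mul_range_of_summable_norm h3 h4).of_norm.hasSum).mul_left _

end WSLD

namespace WSLD

/-! ### A sector criterion for fractional powers -/

/-- This is `tan (δ a) ≤ δ tan a`, cleared of denominators so as to include `a = π/2`. The
difference of the two sides vanishes at `0` and has derivative `(1 - δ²) sin t sin (δ t) ≥ 0`. -/
theorem sin_mul_cos_le {δ a : ℝ} (h0 : 0 ≤ δ) (h1 : δ ≤ 1) (ha : 0 ≤ a) (ha' : a ≤ Real.pi / 2) :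
    Real.sin (δ * a) * Real.cos a ≤ δ * Real.sin a * Real.cos (δ * a) := by
  let F : ℝ → ℝ := fun a => δ * Real.sin a * Real.cos (δ * a) - Real.sin (δ * a) * Real.cos a
  have hF : ∀ t, HasDerivAt F ((1 - δ ^ 2) * Real.sin t * Real.sin (δ * t)) t := by
    intro t
    have hd : HasDerivAt (fun t => δ * t) δ t := by simpa using (hasDerivAt_id t).const_mul δ
    convert! (((Real.hasDerivAt_sin t).const_mul δ).mul (hd.cos)).sub
      (hd.sin.mul (Real.hasDerivAt_cos t)) using 1
    ring
  have hm : MonotoneOn F (Icc 0 (Real.pi / 2)) := by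
    refine monotoneOn_of_deriv_nonneg (convex_Icc _ _)
      (fun t _ => (hF t).continuousAt.continuousWithinAt)
      (fun t _ => (hF t).differentiableAt.differentiableWithinAt) fun t ht => ?_
    rw [interior_Icc] at ht
    rw [(hF t).deriv]
    have hpi := Real.pi_pos
    have i1 : 0 ≤ Real.sin t := Real.sin_nonneg_of_nonneg_of_le_pi ht.1.le (by linarith [ht.2])
    have i2 : 0 ≤ Real.sin (δ * t) := Real.sin_nonneg_of_nonneg_of_le_pi
      (mul_nonneg h0 ht.1.le) (by nlinarith [ht.1, ht.2])
    have i3 : 0 ≤ 1 - δ ^ 2 := by nlinarith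
    positivity
  have := hm ⟨le_refl 0, ha.trans ha'⟩ ⟨ha, ha'⟩ ha
  simp only [F, Real.sin_zero, mul_zero, zero_mul, sub_zero] at this
  linarith

/-- The sector criterion on the unit circle, with `z = e^{ia}` and `w = u + iv`. If `v ≥ 0`, both
terms have the right sign; if `v < 0`, the hypothesis is transported from `a` to `δ a` by the
tangent inequality. -/
theorem re_mul_nonpos_aux {δ a u v : ℝ} (h0 : 0 < δ) (h1 : δ ≤ 1) (ha : 0 ≤ a)
    (ha' : a ≤ Real.pi / 2) (hu : u ≤ 0) (h : Real.cos a * u - δ * Real.sin a * v ≤ 0) :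
    Real.cos (δ * a) * u - Real.sin (δ * a) * v ≤ 0 := by
  have hpi := Real.pi_pos
  have hda : δ * a ≤ a := by nlinarith
  have hda0 : 0 ≤ δ * a := by positivity
  have i1 : 0 ≤ Real.sin (δ * a) := Real.sin_nonneg_of_nonneg_of_le_pi hda0 (by linarith)
  have i2 : 0 ≤ Real.cos (δ * a) := Real.cos_nonneg_of_neg_pi_div_two_le_of_le (by linarith)
    (by linarith)
  rcases le_or_gt 0 v with hv | hv
  · nlinarith [mul_nonneg i1 hv, mul_nonneg i2 (neg_nonneg.2 hu)]
  · rcases eq_or_lt_of_le ha' with e | hlt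
    · rw [e, Real.cos_pi_div_two, Real.sin_pi_div_two] at h
      nlinarith
    · have hc : 0 < Real.cos a := Real.cos_pos_of_mem_Ioo ⟨by linarith, hlt⟩
      have i3 := sin_mul_cos_le h0.le h1 ha ha'
      have i4 : Real.cos a * (Real.cos (δ * a) * u - Real.sin (δ * a) * v) ≤ 0 := by
        nlinarith [mul_le_mul_of_nonneg_right i3 (neg_nonneg.2 hv.le),
          mul_nonneg i2 (neg_nonneg.2 h)]
      by_contra! hcon
      nlinarith [mul_pos hc hcon]

/-- If `w` and the interpolation between `w` and `z w` lie in the left half plane, then so does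
`z ^ δ w`. -/
theorem re_cpow_mul_nonpos {z w : ℂ} {δ : ℝ} (h0 : 0 < δ) (h1 : δ ≤ 1) (hz : 0 ≤ z.re)
    (hw : w.re ≤ 0) (h : (1 - δ) * (z.re * w.re) + δ * (z * w).re ≤ 0) :
    (z ^ (δ : ℂ) * w).re ≤ 0 := by
  rcases eq_or_ne z 0 with rfl | hz0
  · rw [Complex.zero_cpow (by exact_mod_cast h0.ne')]; simp
  have hr : 0 < ‖z‖ := norm_pos_iff.2 hz0
  rw [Complex.mul_re, Complex.cpow_ofReal_re, Complex.cpow_ofReal_im]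
  have hre : z.re = ‖z‖ * Real.cos z.arg := (Complex.norm_mul_cos_arg z).symm
  have him : z.im = ‖z‖ * Real.sin z.arg := (Complex.norm_mul_sin_arg z).symm
  have hab := abs_le.1 (Complex.abs_arg_le_pi_div_two_iff.2 hz)
  -- Division by `‖z‖` turns the interpolation hypothesis into `(1 - δ) cos a · u + δ (cos a · u -
  -- sin a · v) ≤ 0`.
  have h2 : Real.cos z.arg * w.re - δ * Real.sin z.arg * w.im ≤ 0 := by
    rw [Complex.mul_re, hre, him] at h
    by_contra! hcon
    nlinarith [mul_pos hr hcon]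
  have h3 : Real.cos (δ * z.arg) * w.re - Real.sin (δ * z.arg) * w.im ≤ 0 := by
    rcases le_total 0 z.arg with ha | ha
    · exact re_mul_nonpos_aux h0 h1 ha hab.2 hw h2
    · have := re_mul_nonpos_aux (a := -z.arg) (v := -w.im) h0 h1 (by linarith) (by linarith) hw
        (by rw [Real.cos_neg, Real.sin_neg]; linarith)
      rw [mul_neg, Real.cos_neg, Real.sin_neg] at this
      linarith
  rw [mul_comm z.arg]
  have h4 : 0 ≤ ‖z‖ ^ δ := by positivity
  nlinarith [mul_nonneg h4 (neg_nonneg.2 h3)]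

end WSLD

namespace WSLD

/-! ### Polynomial inequalities on the unit interval -/

/-- A Bernstein certificate: minus the polynomial is a positive combination of products of powers of
`y`, `2/5 - y`, `δ`, `1 - δ`. It settles the endpoint `ν = -(7 - 5δ)/16` in
`re_symBase_cpow_mul_trig5_nonpos`, on the left part of the `y` interval. -/
theorem special_lower_bound_left {y δ : ℝ} (hy : 0 ≤ y) (hy' : y ≤ 2/5) (hδ : 0 ≤ δ) (hδ' : δ ≤ 1) :
    (-112/3) * y ^ 4 + (-224/3) * y ^ 5 + (-4) * δ ^ 1 + (-20/3) * δ ^ 1 * y ^ 1 + (128/3) * δ ^ 1 * y ^ 2 + (64) * δ ^ 1 * y ^ 3 + (-224/3) * δ ^ 1 * y ^ 4 + (128/3) * δ ^ 1 * y ^ 5 + (16/3) * δ ^ 2 * y ^ 1 + (-16/3) * δ ^ 2 * y ^ 2 + (-80) * δ ^ 2 * y ^ 3 + (-112/3) * δ ^ 2 * y ^ 4 + (352/3) * δ ^ 2 * y ^ 5 ≤ 0 := by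
  have h2 : 0 ≤ 2/5 - y := by linarith
  have h3 : 0 ≤ 1 - δ := by linarith
  have h4 : 0 ≤ 280/3 * y ^ 4 * (2/5 - y) ^ 1 * (1 - δ) ^ 2 +
      168 * y ^ 5 * (1 - δ) ^ 2 +
      3125/8 * (2/5 - y) ^ 5 * δ ^ 1 * (1 - δ) ^ 1 +
      53125/24 * y ^ 1 * (2/5 - y) ^ 4 * δ ^ 1 * (1 - δ) ^ 1 +
      17125/4 * y ^ 2 * (2/5 - y) ^ 3 * δ ^ 1 * (1 - δ) ^ 1 +
      12275/4 * y ^ 3 * (2/5 - y) ^ 2 * δ ^ 1 * (1 - δ) ^ 1 +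
      4545/8 * y ^ 4 * (2/5 - y) ^ 1 * δ ^ 1 * (1 - δ) ^ 1 +
      515/8 * y ^ 5 * δ ^ 1 * (1 - δ) ^ 1 +
      3125/8 * (2/5 - y) ^ 5 * δ ^ 2 +
      48125/24 * y ^ 1 * (2/5 - y) ^ 4 * δ ^ 2 +
      14125/4 * y ^ 2 * (2/5 - y) ^ 3 * δ ^ 2 +
      10275/4 * y ^ 3 * (2/5 - y) ^ 2 * δ ^ 2 +
      23635/24 * y ^ 4 * (2/5 - y) ^ 1 * δ ^ 2 +
      1979/8 * y ^ 5 * δ ^ 2 := by positivity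
  refine le_of_eq_of_le ?_ (neg_nonpos.2 h4)
  ring

/-- The complementary part of the `y` interval, with the certificate written in degree 6 instead of
5 in `y`. -/
theorem special_lower_bound_right {y δ : ℝ} (hy : 2/5 ≤ y) (hy' : y ≤ 1) (hδ : 0 ≤ δ) (hδ' : δ ≤ 1) :
    (-112/3) * y ^ 4 + (-224/3) * y ^ 5 + (-4) * δ ^ 1 + (-20/3) * δ ^ 1 * y ^ 1 + (128/3) * δ ^ 1 * y ^ 2 + (64) * δ ^ 1 * y ^ 3 + (-224/3) * δ ^ 1 * y ^ 4 + (128/3) * δ ^ 1 * y ^ 5 + (16/3) * δ ^ 2 * y ^ 1 + (-16/3) * δ ^ 2 * y ^ 2 + (-80) * δ ^ 2 * y ^ 3 + (-112/3) * δ ^ 2 * y ^ 4 + (352/3) * δ ^ 2 * y ^ 5 ≤ 0 := by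
  have h1 : 0 ≤ y - 2/5 := by linarith
  have h2 : 0 ≤ 1 - y := by linarith
  have h3 : 0 ≤ 1 - δ := by linarith
  have h4 : 0 ≤ 8960/243 * (1 - y) ^ 6 * (1 - δ) ^ 2 +
      340480/729 * (y - 2/5) ^ 1 * (1 - y) ^ 5 * (1 - δ) ^ 2 +
      1769600/729 * (y - 2/5) ^ 2 * (1 - y) ^ 4 * (1 - δ) ^ 2 +
      4816000/729 * (y - 2/5) ^ 3 * (1 - y) ^ 3 * (1 - δ) ^ 2 +
      7210000/729 * (y - 2/5) ^ 4 * (1 - y) ^ 2 * (1 - δ) ^ 2 +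
      5600000/729 * (y - 2/5) ^ 5 * (1 - y) ^ 1 * (1 - δ) ^ 2 +
      1750000/729 * (y - 2/5) ^ 6 * (1 - δ) ^ 2 +
      10300/729 * (1 - y) ^ 6 * δ ^ 1 * (1 - δ) ^ 1 +
      100/27 * (y - 2/5) ^ 1 * (1 - y) ^ 5 * δ ^ 1 * (1 - δ) ^ 1 +
      125800/243 * (y - 2/5) ^ 2 * (1 - y) ^ 4 * δ ^ 1 * (1 - δ) ^ 1 +
      2855000/729 * (y - 2/5) ^ 3 * (1 - y) ^ 3 * δ ^ 1 * (1 - δ) ^ 1 +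
      767500/81 * (y - 2/5) ^ 4 * (1 - y) ^ 2 * δ ^ 1 * (1 - δ) ^ 1 +
      2312500/243 * (y - 2/5) ^ 5 * (1 - y) ^ 1 * δ ^ 1 * (1 - δ) ^ 1 +
      2500000/729 * (y - 2/5) ^ 6 * δ ^ 1 * (1 - δ) ^ 1 +
      39580/729 * (1 - y) ^ 6 * δ ^ 2 +
      297980/729 * (y - 2/5) ^ 1 * (1 - y) ^ 5 * δ ^ 2 +
      1293400/729 * (y - 2/5) ^ 2 * (1 - y) ^ 4 * δ ^ 2 +
      3385000/729 * (y - 2/5) ^ 3 * (1 - y) ^ 3 * δ ^ 2 +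
      4737500/729 * (y - 2/5) ^ 4 * (1 - y) ^ 2 * δ ^ 2 +
      3137500/729 * (y - 2/5) ^ 5 * (1 - y) ^ 1 * δ ^ 2 +
      250000/243 * (y - 2/5) ^ 6 * δ ^ 2 := by positivity
  refine le_of_eq_of_le ?_ (neg_nonpos.2 h4)
  ring

/-- The endpoint `ν = δ/16`, for which one certificate covers all of `[0, 1]`. -/
theorem special_upper_bound {y δ : ℝ} (hy : 0 ≤ y) (hy' : y ≤ 1) (hδ : 0 ≤ δ) (hδ' : δ ≤ 1) :
    (-112/3) * y ^ 4 + (112/3) * y ^ 5 + (-4) * δ ^ 1 + (-20/3) * δ ^ 1 * y ^ 1 + (44/3) * δ ^ 1 * y ^ 2 + (-20) * δ ^ 1 * y ^ 3 + (-224/3) * δ ^ 1 * y ^ 4 + (272/3) * δ ^ 1 * y ^ 5 + (16/3) * δ ^ 2 * y ^ 1 + (32/3) * δ ^ 2 * y ^ 2 + (-32) * δ ^ 2 * y ^ 3 + (-112/3) * δ ^ 2 * y ^ 4 + (160/3) * δ ^ 2 * y ^ 5 ≤ 0 := by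
  have h2 : 0 ≤ 1 - y := by linarith
  have h3 : 0 ≤ 1 - δ := by linarith
  have h4 : 0 ≤ 112/3 * y ^ 4 * (1 - y) ^ 1 * (1 - δ) ^ 2 +
      4 * (1 - y) ^ 5 * δ ^ 1 * (1 - δ) ^ 1 +
      80/3 * y ^ 1 * (1 - y) ^ 4 * δ ^ 1 * (1 - δ) ^ 1 +
      52 * y ^ 2 * (1 - y) ^ 3 * δ ^ 1 * (1 - δ) ^ 1 +
      56 * y ^ 3 * (1 - y) ^ 2 * δ ^ 1 * (1 - δ) ^ 1 +
      192 * y ^ 4 * (1 - y) ^ 1 * δ ^ 1 * (1 - δ) ^ 1 +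
      4 * (1 - y) ^ 5 * δ ^ 2 +
      64/3 * y ^ 1 * (1 - y) ^ 4 * δ ^ 2 +
      20 * y ^ 2 * (1 - y) ^ 3 * δ ^ 2 +
      24 * y ^ 3 * (1 - y) ^ 2 * δ ^ 2 +
      608/3 * y ^ 4 * (1 - y) ^ 1 * δ ^ 2 := by positivity
  refine le_of_eq_of_le ?_ (neg_nonpos.2 h4)
  ring

/-- This is `121 (1 + 3y) ≤ (11 + 32y - 32y²)²` after division by `y`; it disposes of the square
root in `family_first_power_bound`. -/
theorem family_sq_bound {y : ℝ} (hy : 0 ≤ y) (hy' : y ≤ 11/20) :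
    (-341) + (-320) * y ^ 1 + (2048) * y ^ 2 + (-1024) * y ^ 3 ≤ 0 := by
  have h2 : 0 ≤ 11/20 - y := by linarith
  have h4 : 0 ≤ 248000/121 * (11/20 - y) ^ 3 +
      872000/121 * y ^ 1 * (11/20 - y) ^ 2 +
      549440/121 * y ^ 2 * (11/20 - y) ^ 1 +
      49344/121 * y ^ 3 := by positivity
  refine le_of_eq_of_le ?_ (neg_nonpos.2 h4)
  ring

theorem family_right_bound {y : ℝ} (hy : 11/20 ≤ y) (hy' : y ≤ 1) :
    (22/45) + (154/45) * y ^ 1 + (-44/9) * y ^ 2 + (-128/9) * y ^ 3 + (128/9) * y ^ 4 ≤ 0 := by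
  have h1 : 0 ≤ y - 11/20 := by linarith
  have h2 : 0 ≤ 1 - y := by linarith
  have h4 : 0 ≤ 248512/59049 * (1 - y) ^ 4 +
      4491520/59049 * (y - 11/20) ^ 1 * (1 - y) ^ 3 +
      4241600/19683 * (y - 11/20) ^ 2 * (1 - y) ^ 2 +
      10729600/59049 * (y - 11/20) ^ 3 * (1 - y) ^ 1 +
      1408000/59049 * (y - 11/20) ^ 4 := by positivity
  refine le_of_eq_of_le ?_ (neg_nonpos.2 h4)
  ring

theorem family_square_left_bound {y : ℝ} (hy : 0 ≤ y) (hy' : y ≤ 11/20) :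
    (-4) + (-146/45) * y ^ 1 + (11594/315) * y ^ 2 + (-472/63) * y ^ 3 + (-1024/9) * y ^ 4 + (1024/9) * y ^ 5 ≤ 0 := by
  have h2 : 0 ≤ 11/20 - y := by linarith
  have h4 : 0 ≤ 12800000/161051 * (11/20 - y) ^ 5 +
      627392000/1449459 * y ^ 1 * (11/20 - y) ^ 4 +
      806486400/1127357 * y ^ 2 * (11/20 - y) ^ 3 +
      3739961600/10146213 * y ^ 3 * (11/20 - y) ^ 2 +
      191242880/1449459 * y ^ 4 * (11/20 - y) ^ 1 +
      117358592/10146213 * y ^ 5 := by positivity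
  refine le_of_eq_of_le ?_ (neg_nonpos.2 h4)
  ring

theorem family_square_right_bound {y : ℝ} (hy : 11/20 ≤ y) (hy' : y ≤ 1) :
    (-4/45) + (76/15) * y ^ 1 + (176/9) * y ^ 2 + (-256/9) * y ^ 3 + (-1024/9) * y ^ 4 + (1024/9) * y ^ 5 ≤ 0 := by
  have h1 : 0 ≤ y - 11/20 := by linarith
  have h2 : 0 ≤ 1 - y := by linarith
  have h4 : 0 ≤ 23161856/531441 * (1 - y) ^ 5 +
      412564480/531441 * (y - 11/20) ^ 1 * (1 - y) ^ 4 +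
      1678668800/531441 * (y - 11/20) ^ 2 * (1 - y) ^ 3 +
      2620544000/531441 * (y - 11/20) ^ 3 * (1 - y) ^ 2 +
      1504384000/531441 * (y - 11/20) ^ 4 * (1 - y) ^ 1 +
      112640000/531441 * (y - 11/20) ^ 5 := by positivity
  refine le_of_eq_of_le ?_ (neg_nonpos.2 h4)
  ring

/-- The certificate uses the Bernstein basis of degree 8, although the polynomial has degree 5. -/
theorem family_square_two_bound {y : ℝ} (hy : 0 ≤ y) (hy' : y ≤ 1) :
    (-148/45) + (4/5) * y ^ 1 + (256/9) * y ^ 2 + (-320/9) * y ^ 3 + (-1280/9) * y ^ 4 + (1280/9) * y ^ 5 ≤ 0 := by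
  have h2 : 0 ≤ 1 - y := by linarith
  have h4 : 0 ≤ 148/45 * (1 - y) ^ 8 +
      1148/45 * y ^ 1 * (1 - y) ^ 7 +
      2612/45 * y ^ 2 * (1 - y) ^ 6 +
      484/15 * y ^ 3 * (1 - y) ^ 5 +
      860/9 * y ^ 4 * (1 - y) ^ 4 +
      16628/45 * y ^ 5 * (1 - y) ^ 3 +
      19388/45 * y ^ 6 * (1 - y) ^ 2 +
      7652/45 * y ^ 7 * (1 - y) ^ 1 +
      48/5 * y ^ 8 := by positivity
  refine le_of_eq_of_le ?_ (neg_nonpos.2 h4)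
  ring


end WSLD

namespace WSLD

/-! ### Dissipativity of the symbol: shifts in `{-2, …, 2}` -/

/-- The trigonometric polynomial with weights `X₁, …` at the shifts `1, 2, 0, -1, -2`. -/
noncomputable def trig5 (ζ : ℂ) (X₁ X₂ X₀ Y₁ Y₂ : ℝ) : ℂ :=
  X₁ * ζ⁻¹ + X₂ * ζ⁻¹ ^ 2 + X₀ + Y₁ * ζ + Y₂ * ζ ^ 2

/-- For `ζ = e^{iθ}` these are `y = sin² (θ/2)` and `s = sin θ`. The real parts computed below are
even in `s`, hence polynomials in `y`. -/
theorem exists_circle_coords {ζ : ℂ} (hζ : ‖ζ‖ = 1) :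
    ∃ y s : ℝ, 0 ≤ y ∧ y ≤ 1 ∧ s ^ 2 = 4 * y * (1 - y) ∧ ζ = ⟨1 - 2 * y, s⟩ ∧
      ζ⁻¹ = ⟨1 - 2 * y, -s⟩ := by
  have h1 : ζ.re ^ 2 + ζ.im ^ 2 = 1 := by
    have := Complex.sq_norm ζ
    rw [hζ, Complex.normSq_apply] at this
    nlinarith
  have h2 : -1 ≤ ζ.re := by nlinarith [sq_nonneg ζ.im]
  have h3 : ζ.re ≤ 1 := by nlinarith [sq_nonneg ζ.im]
  refine ⟨(1 - ζ.re) / 2, ζ.im, by linarith, by linarith, by nlinarith, ?_, ?_⟩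
  · apply Complex.ext <;> simp
    ring
  · rw [Complex.inv_def, Complex.normSq_eq_norm_sq, hζ]
    apply Complex.ext <;> simp
    ring

/-- In particular the real part is `4y² = (1 - cos θ)² ≥ 0`, which makes the sector criterion
applicable. -/
theorem symBase_eq {y s : ℝ} (hs : s ^ 2 = 4 * y * (1 - y)) :
    symBase ⟨1 - 2 * y, s⟩ = ⟨4 * y ^ 2, -(s * (1 + 2 * y))⟩ := by
  apply Complex.ext
  · simp [symBase]
    linear_combination (-1 / 2 : ℝ) * hs
  · simp [symBase]
    ring

theorem re_symBase_mul_trig5 {y s : ℝ} (hs : s ^ 2 = 4 * y * (1 - y)) {ζ : ℂ}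
    (hζ : ζ = ⟨1 - 2 * y, s⟩) (hζ' : ζ⁻¹ = ⟨1 - 2 * y, -s⟩) (X₁ X₂ X₀ Y₁ Y₂ : ℝ) :
    (symBase ζ * trig5 ζ X₁ X₂ X₀ Y₁ Y₂).re =
      X₁ * (-4 * y) + X₂ * (-8 * y + 12 * y ^ 2) + X₀ * (4 * y ^ 2) +
        Y₁ * (4 * y + 8 * y ^ 2 - 16 * y ^ 3) +
        Y₂ * (8 * y - 4 * y ^ 2 - 64 * y ^ 3 + 64 * y ^ 4) := by
  rw [trig5, hζ', hζ, symBase_eq hs]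
  simp [pow_two]
  grind

theorem re_symBase_sq_mul_trig5 {y s : ℝ} (hs : s ^ 2 = 4 * y * (1 - y)) {ζ : ℂ}
    (hζ : ζ = ⟨1 - 2 * y, s⟩) (hζ' : ζ⁻¹ = ⟨1 - 2 * y, -s⟩) (X₁ X₂ X₀ Y₁ Y₂ : ℝ) :
    (symBase ζ * (symBase ζ * trig5 ζ X₁ X₂ X₀ Y₁ Y₂)).re =
      X₁ * (-4 * y - 4 * y ^ 2 - 8 * y ^ 3) + X₂ * (-4 * y + 20 * y ^ 2) +
        X₀ * (-4 * y - 12 * y ^ 2 + 32 * y ^ 4) +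
        Y₁ * (-4 * y - 4 * y ^ 2 + 56 * y ^ 3 + 64 * y ^ 4 - 128 * y ^ 5) +
        Y₂ * (-4 * y + 20 * y ^ 2 + 128 * y ^ 3 - 128 * y ^ 4 - 512 * y ^ 5 + 512 * y ^ 6) := by
  rw [trig5, hζ', hζ, symBase_eq hs]
  simp [pow_two]
  grind

/-- The powers of the symbol base split off one factor. -/
theorem re_symBase_cpow_mul_nonpos {α : ℝ} (h1 : 1 < α) (h2 : α ≤ 2) {ζ W : ℂ}
    (hr : 0 ≤ (symBase ζ).re) (hW : (symBase ζ * W).re ≤ 0)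
    (h : (2 - α) * ((symBase ζ).re * (symBase ζ * W).re) +
      (α - 1) * (symBase ζ * (symBase ζ * W)).re ≤ 0) :
    (symBase ζ ^ (α : ℂ) * W).re ≤ 0 := by
  have e : symBase ζ ^ (α : ℂ) = symBase ζ ^ ((α - 1 : ℝ) : ℂ) * symBase ζ := by
    rcases eq_or_ne (symBase ζ) 0 with h0 | h0
    · rw [h0, mul_zero, Complex.zero_cpow (by exact_mod_cast (by linarith : α ≠ 0))]
    · have := Complex.cpow_add (((α - 1 : ℝ)) : ℂ) 1 h0
      rw [Complex.cpow_one] at this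
      rw [← this]; push_cast; ring_nf
  rw [e, mul_assoc]
  -- The sector criterion with `δ = α - 1`, `z = symBase ζ` and `w = symBase ζ * W`.
  refine re_cpow_mul_nonpos (by linarith) (by linarith) hr hW ?_
  rw [show 1 - (α - 1) = 2 - α by ring]
  exact h

/-- Dissipativity for the fourth order weights at the shifts `-2, …, 2`. -/
theorem re_symBase_cpow_mul_trig5_nonpos {α ν : ℝ} (h1 : 1 < α) (h2 : α ≤ 2)
    (hν : -(7 - 5 * (α - 1)) / 16 ≤ ν) (hν' : ν ≤ (α - 1) / 16) {ζ : ℂ} (hζ : ‖ζ‖ = 1) :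
    (symBase ζ ^ (α : ℂ) * trig5 ζ (α / 2 - 4 * ν) (-(5 * α / 48) + ν)
      ((24 - 13 * α) / 24 + 6 * ν) (-(4 * ν)) (7 * α / 48 + ν)).re ≤ 0 := by
  -- The weights are a particular solution of the moment conditions plus `ν` times the fourth
  -- difference `(1, -4, 6, -4, 1)`, which annihilates cubics.
  obtain ⟨y, s, hy0, hy1, hs, e1, e2⟩ := exists_circle_coords hζ
  have hu : 0 ≤ 1 - y := by linarith
  have hR : (symBase ζ).re = 4 * y ^ 2 := by rw [e1, symBase_eq hs]
  refine re_symBase_cpow_mul_nonpos h1 h2 (by rw [hR]; positivity) ?_ ?_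
  · rw [re_symBase_mul_trig5 hs e1 e2]
    have k1 : 0 ≤ y ^ 4 * ((α - 1) / 16 - ν) := mul_nonneg (by positivity) (by linarith)
    have k2 : 0 ≤ (α - 1) * y ^ 2 * (1 - y) * (1 + y) :=
      mul_nonneg (mul_nonneg (mul_nonneg (by linarith) (by positivity)) hu) (by linarith)
    have k3 : 0 ≤ α * y ^ 3 * (1 - y) := by positivity
    nlinarith
  · rw [hR, re_symBase_mul_trig5 hs e1 e2, re_symBase_sq_mul_trig5 hs e1 e2]
    obtain ⟨δ, rfl⟩ : ∃ δ, α = 1 + δ := ⟨α - 1, by ring⟩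
    have hδ : 0 ≤ δ := by linarith
    have hδ1 : δ ≤ 1 := by linarith
    -- The criterion is affine in `ν`, so it suffices to know it at the two ends: `k1` belongs to `ν
    -- = δ/16` and `k2` to `ν = -(7 - 5δ)/16`. Below, `m1` and `m2` are their interpolation weights
    -- and `(7 - 4δ)/16` is the length of the interval.
    have k1 := special_upper_bound hy0 hy1 hδ hδ1
    have k2 : (-112/3) * y ^ 4 + (-224/3) * y ^ 5 + (-4) * δ ^ 1 + (-20/3) * δ ^ 1 * y ^ 1 +
        (128/3) * δ ^ 1 * y ^ 2 + (64) * δ ^ 1 * y ^ 3 + (-224/3) * δ ^ 1 * y ^ 4 +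
        (128/3) * δ ^ 1 * y ^ 5 + (16/3) * δ ^ 2 * y ^ 1 + (-16/3) * δ ^ 2 * y ^ 2 +
        (-80) * δ ^ 2 * y ^ 3 + (-112/3) * δ ^ 2 * y ^ 4 + (352/3) * δ ^ 2 * y ^ 5 ≤ 0 := by
      rcases le_total y (2 / 5) with h | h
      · exact special_lower_bound_left hy0 h hδ hδ1
      · exact special_lower_bound_right h hy1 hδ hδ1
    have hw : 0 < 7 / 16 * (1 - δ) + 3 / 16 * δ := by nlinarith
    have m1 := mul_nonneg (mul_nonneg hy0 (by linarith : 0 ≤ ν + (7 - 5 * δ) / 16))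
      (neg_nonneg.2 k1)
    have m2 := mul_nonneg (mul_nonneg hy0 (by linarith : 0 ≤ δ / 16 - ν)) (neg_nonneg.2 k2)
    have hw : 0 < (7 - 4 * δ) / 16 := by linarith
    by_contra! hcon
    have m3 := mul_pos hw hcon
    linarith

end WSLD

namespace WSLD

/-! ### Dissipativity of the symbol: one positive and one negative far shift -/

/-- Consecutive remainders differ by `(z^m - 1)(z - 1)`, and `‖z^m - 1‖ ≤ |m| ‖z - 1‖`; summing over
`m` upwards and downwards gives the binomial coefficient, which is nonnegative at every integer. -/
theorem norm_zpow_taylor_two {z : ℂ} (hz : ‖z‖ = 1) (m : ℤ) :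
    ‖z ^ m - 1 - m * (z - 1)‖ ≤ m * (m - 1) / 2 * ‖z - 1‖ ^ 2 := by
  have hz0 : z ≠ 0 := fun h => by simp [h] at hz
  have hone : ∀ m : ℤ, ‖z ^ m - 1‖ ≤ |(m : ℝ)| * ‖z - 1‖ := by
    intro m
    induction m using Int.induction_on with
    | zero => simp
    | succ k ih =>
      have e : z ^ ((k : ℤ) + 1) - 1 = (z ^ (k : ℤ) - 1) + z ^ (k : ℤ) * (z - 1) := by
        rw [zpow_add_one₀ hz0]; ring
      rw [e]
      refine (norm_add_le _ _).trans ?_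
      rw [norm_mul, norm_zpow, hz, one_zpow]
      push_cast at ih ⊢
      rw [abs_of_nonneg (by positivity)] at ih ⊢
      linarith
    | pred k ih =>
      have e : z ^ (-(k : ℤ) - 1) - 1 = (z ^ (-(k : ℤ)) - 1) - z ^ (-(k : ℤ) - 1) * (z - 1) := by
        have : z ^ (-(k : ℤ)) = z ^ (-(k : ℤ) - 1) * z := by
          rw [← zpow_add_one₀ hz0]; congr 1; ring
        rw [this]; ring
      rw [e]
      refine (norm_sub_le _ _).trans ?_
      rw [norm_mul, norm_zpow, hz, one_zpow]
      push_cast at ih ⊢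
      rw [abs_of_nonpos (by linarith [k.cast_nonneg (α := ℝ)])] at ih ⊢
      linarith
  induction m using Int.induction_on with
  | zero => simp
  | succ k ih =>
    have e : z ^ ((k : ℤ) + 1) - 1 - ((k : ℤ) + 1 : ℤ) * (z - 1) =
        (z ^ (k : ℤ) - 1 - (k : ℤ) * (z - 1)) + (z ^ (k : ℤ) - 1) * (z - 1) := by
      rw [zpow_add_one₀ hz0]; push_cast; ring
    rw [e]
    refine (norm_add_le _ _).trans ?_
    rw [norm_mul]
    have h1 := mul_le_mul_of_nonneg_right (hone k) (norm_nonneg (z - 1))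
    push_cast at ih h1 ⊢
    rw [abs_of_nonneg (by positivity)] at h1
    linarith
  | pred k ih =>
    have e : z ^ (-(k : ℤ) - 1) - 1 - (-(k : ℤ) - 1 : ℤ) * (z - 1) =
        (z ^ (-(k : ℤ)) - 1 - (-(k : ℤ) : ℤ) * (z - 1)) -
          (z ^ (-(k : ℤ) - 1) - 1) * (z - 1) := by
      have : z ^ (-(k : ℤ)) = z ^ (-(k : ℤ) - 1) * z := by
        rw [← zpow_add_one₀ hz0]; congr 1; ring
      rw [this]; push_cast; ring
    rw [e]
    refine (norm_sub_le _ _).trans ?_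
    rw [norm_mul]
    have h1 := mul_le_mul_of_nonneg_right (hone (-(k : ℤ) - 1)) (norm_nonneg (z - 1))
    push_cast at ih h1 ⊢
    rw [abs_of_nonpos (by linarith [k.cast_nonneg (α := ℝ)])] at h1
    linarith

/-- Summation of `norm_zpow_taylor_two`. The subtracted quadratic in `m` interpolates `z^m` at `m =
0, 1, 2` and is annihilated by third divided differences. -/
theorem norm_zpow_taylor_three {z : ℂ} (hz : ‖z‖ = 1) (m : ℤ) :
    ‖z ^ m - 1 - m * (z - 1) - m * (m - 1) / 2 * (z - 1) ^ 2‖ ≤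
      |(m : ℝ) * (m - 1) * (m - 2)| / 6 * ‖z - 1‖ ^ 3 := by
  have hz0 : z ≠ 0 := fun h => by simp [h] at hz
  have hpos : ∀ k : ℕ, 0 ≤ (k : ℝ) * (k - 1) * (k - 2) := by
    intro k
    rcases k with _ | _ | k
    · simp
    · simp
    · push_cast
      have := k.cast_nonneg (α := ℝ)
      refine mul_nonneg (mul_nonneg ?_ ?_) ?_ <;> linarith
  have hneg : ∀ k : ℕ, -(k : ℝ) * (-k - 1) * (-k - 2) ≤ 0 := by
    intro k
    have : 0 ≤ (k : ℝ) * (k + 1) * (k + 2) := by positivity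
    linarith
  induction m using Int.induction_on with
  | zero => simp
  | succ k ih =>
    have e : z ^ ((k : ℤ) + 1) - 1 - ((k : ℤ) + 1 : ℤ) * (z - 1) -
        ((k : ℤ) + 1 : ℤ) * (((k : ℤ) + 1 : ℤ) - 1) / 2 * (z - 1) ^ 2 =
        (z ^ (k : ℤ) - 1 - (k : ℤ) * (z - 1) - (k : ℤ) * ((k : ℤ) - 1) / 2 * (z - 1) ^ 2) +
          (z ^ (k : ℤ) - 1 - (k : ℤ) * (z - 1)) * (z - 1) := by
      rw [zpow_add_one₀ hz0]; push_cast; ring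
    rw [e]
    refine (norm_add_le _ _).trans ?_
    rw [norm_mul]
    have h1 := mul_le_mul_of_nonneg_right (norm_zpow_taylor_two hz k) (norm_nonneg (z - 1))
    have h2 := hpos (k + 1)
    push_cast at ih h1 h2 ⊢
    rw [abs_of_nonneg (hpos k)] at ih
    rw [abs_of_nonneg h2]
    linarith
  | pred k ih =>
    have e : z ^ (-(k : ℤ) - 1) - 1 - (-(k : ℤ) - 1 : ℤ) * (z - 1) -
        (-(k : ℤ) - 1 : ℤ) * ((-(k : ℤ) - 1 : ℤ) - 1) / 2 * (z - 1) ^ 2 =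
        (z ^ (-(k : ℤ)) - 1 - (-(k : ℤ) : ℤ) * (z - 1) -
          (-(k : ℤ) : ℤ) * ((-(k : ℤ) : ℤ) - 1) / 2 * (z - 1) ^ 2) -
          (z ^ (-(k : ℤ) - 1) - 1 - (-(k : ℤ) - 1 : ℤ) * (z - 1)) * (z - 1) := by
      have : z ^ (-(k : ℤ)) = z ^ (-(k : ℤ) - 1) * z := by
        rw [← zpow_add_one₀ hz0]; congr 1; ring
      rw [this]; push_cast; ring
    rw [e]
    refine (norm_sub_le _ _).trans ?_
    rw [norm_mul]
    have h1 := mul_le_mul_of_nonneg_right (norm_zpow_taylor_two hz (-(k : ℤ) - 1))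
      (norm_nonneg (z - 1))
    have h2 := hneg (k + 1)
    push_cast at ih h1 h2 ⊢
    rw [abs_of_nonpos (hneg k)] at ih
    rw [abs_of_nonpos (by linarith)]
    linarith

/-- The difference `f[1,q,-n] - f[1,2,-n]` of divided differences. -/
noncomputable def ddOuter (q n : ℝ) (f₁ f₂ fq fs : ℂ) : ℂ :=
  ((q - 2) / ((q - 1) * (n + 1)) : ℝ) * f₁ - (1 / (n + 2) : ℝ) * f₂ +
    (1 / ((q - 1) * (q + n)) : ℝ) * fq - ((q - 2) / ((n + 1) * (n + 2) * (n + q)) : ℝ) * fs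

/-- The difference `f[1,2,-2] - f[1,2,-n]` of divided differences. -/
noncomputable def ddInner (n : ℝ) (f₁ f₂ fm fs : ℂ) : ℂ :=
  -((n - 2) / (3 * (n + 1)) : ℝ) * f₁ + ((n - 2) / (4 * (n + 2)) : ℝ) * f₂ +
    (1 / 12 : ℝ) * fm - (1 / ((n + 1) * (n + 2)) : ℝ) * fs

theorem norm_smul_sum_le {a b c d : ℝ} {x y z w : ℂ} {A B C D : ℝ} (hx : ‖x‖ ≤ A) (hy : ‖y‖ ≤ B)
    (hz : ‖z‖ ≤ C) (hw : ‖w‖ ≤ D) :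
    ‖(a : ℂ) * x + b * y + c * z + d * w‖ ≤ |a| * A + |b| * B + |c| * C + |d| * D := by
  have h : ∀ (r : ℝ) (v : ℂ) (R : ℝ), ‖v‖ ≤ R → ‖(r : ℂ) * v‖ ≤ |r| * R := fun r v R hv => by
    rw [norm_mul, Complex.norm_real, Real.norm_eq_abs]
    exact mul_le_mul_of_nonneg_left hv (abs_nonneg _)
  exact (norm_add_le _ _).trans (add_le_add ((norm_add_le _ _).trans (add_le_add
    ((norm_add_le _ _).trans (add_le_add (h _ _ _ hx) (h _ _ _ hy))) (h _ _ _ hz))) (h _ _ _ hw))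

/-- Up to the factor `q - 2` this is the divided difference at `1, 2, q, -n`. Each coefficient is
largest at `q = 3`, `n = 2`, and there `1/6 + 1/4 + 1/10 + 1/60 = 8/15`. -/
theorem norm_ddOuter_le {q n : ℝ} (hq : 3 ≤ q) (hn : 2 ≤ n) {f₁ f₂ fq fs : ℂ} (h₁ : ‖f₁‖ ≤ 1)
    (h₂ : ‖f₂‖ ≤ 1) (hfq : ‖fq‖ ≤ 1) (hfs : ‖fs‖ ≤ 1) :
    ‖ddOuter q n f₁ f₂ fq fs‖ ≤ (q - 2) * (8 / 15) := by
  have h := norm_smul_sum_le (a := (q - 2) / ((q - 1) * (n + 1))) (b := -(1 / (n + 2)))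
    (c := 1 / ((q - 1) * (q + n))) (d := -((q - 2) / ((n + 1) * (n + 2) * (n + q)))) h₁ h₂ hfq hfs
  have p1 : 0 < q - 1 := by linarith
  have p2 : 0 < q - 2 := by linarith
  rw [abs_neg, abs_neg, abs_of_nonneg (by positivity), abs_of_nonneg (by positivity),
    abs_of_nonneg (by positivity), abs_of_nonneg (by positivity)] at h
  have e : ddOuter q n f₁ f₂ fq fs = (((q - 2) / ((q - 1) * (n + 1)) : ℝ) : ℂ) * f₁ +
      ((-(1 / (n + 2)) : ℝ) : ℂ) * f₂ + ((1 / ((q - 1) * (q + n)) : ℝ) : ℂ) * fq +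
      ((-((q - 2) / ((n + 1) * (n + 2) * (n + q))) : ℝ) : ℂ) * fs := by
    rw [ddOuter]; push_cast; ring
  rw [e]
  refine h.trans ?_
  have i1 : (q - 2) / ((q - 1) * (n + 1)) ≤ (q - 2) * (1 / 6) := by
    rw [div_eq_mul_one_div]
    gcongr
    nlinarith
  have i2 : 1 / (n + 2) ≤ (q - 2) * (1 / 4) := by
    have : 1 / (n + 2) ≤ 1 / 4 := by gcongr; linarith
    linarith
  have i3 : 1 / ((q - 1) * (q + n)) ≤ (q - 2) * (1 / 10) := by
    have : 1 / ((q - 1) * (q + n)) ≤ 1 / 10 := by gcongr; nlinarith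
    linarith
  have i4 : (q - 2) / ((n + 1) * (n + 2) * (n + q)) ≤ (q - 2) * (1 / 60) := by
    rw [div_eq_mul_one_div]
    gcongr
    have : 12 ≤ (n + 1) * (n + 2) := by nlinarith
    nlinarith
  linarith

/-- The same count for the divided difference at `1, 2, -2, -n` yields `4/15`; the weaker `8/15` is
stated so that both differences share one bound. -/
theorem norm_ddInner_le {n : ℝ} (hn : 3 ≤ n) {f₁ f₂ fm fs : ℂ} (h₁ : ‖f₁‖ ≤ 1)
    (h₂ : ‖f₂‖ ≤ 1) (hfm : ‖fm‖ ≤ 1) (hfs : ‖fs‖ ≤ 1) :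
    ‖ddInner n f₁ f₂ fm fs‖ ≤ (n - 2) * (8 / 15) := by
  have h := norm_smul_sum_le (a := -((n - 2) / (3 * (n + 1)))) (b := (n - 2) / (4 * (n + 2)))
    (c := 1 / 12) (d := -(1 / ((n + 1) * (n + 2)))) h₁ h₂ hfm hfs
  have p2 : 0 < n - 2 := by linarith
  rw [abs_neg, abs_neg, abs_of_nonneg (by positivity), abs_of_nonneg (by positivity),
    abs_of_nonneg (by positivity), abs_of_nonneg (by positivity)] at h
  have e : ddInner n f₁ f₂ fm fs = ((-((n - 2) / (3 * (n + 1))) : ℝ) : ℂ) * f₁ +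
      (((n - 2) / (4 * (n + 2)) : ℝ) : ℂ) * f₂ + ((1 / 12 : ℝ) : ℂ) * fm +
      ((-(1 / ((n + 1) * (n + 2))) : ℝ) : ℂ) * fs := by
    rw [ddInner]; push_cast; ring
  rw [e]
  refine h.trans ?_
  have i1 : (n - 2) / (3 * (n + 1)) ≤ (n - 2) * (1 / 12) := by
    rw [div_eq_mul_one_div]
    gcongr
    linarith
  have i2 : (n - 2) / (4 * (n + 2)) ≤ (n - 2) * (1 / 20) := by
    rw [div_eq_mul_one_div]
    gcongr
    linarith
  have i4 : 1 / ((n + 1) * (n + 2)) ≤ (n - 2) * (1 / 20) := by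
    have : 1 / ((n + 1) * (n + 2)) ≤ 1 / 20 := by gcongr; nlinarith
    linarith
  linarith

/-- After a factor `z` is taken out, the nodes are `0, 1, q-1, -n-1`. The quadratic interpolant
drops out and the remainders at `0` and `1` vanish. The other two contribute in the proportion `(q -
3) : (n + 3)`, and add up exactly to `(q - 2)/6`. -/
theorem norm_ddOuter_le_cube {q n : ℤ} (hq : 2 ≤ q) (hn : 2 ≤ n) {z : ℂ} (hz : ‖z‖ = 1) :
    ‖ddOuter q n z (z ^ 2) (z ^ q) (z ^ (-n))‖ ≤ (q - 2) * (‖z - 1‖ ^ 3 / 6) := by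
  have hz0 : z ≠ 0 := fun h => by simp [h] at hz
  have hq' : (2 : ℝ) ≤ q := by exact_mod_cast hq
  have hn' : (2 : ℝ) ≤ n := by exact_mod_cast hn
  have p0 : (0 : ℝ) < q - 1 := by linarith
  have p1 : (0 : ℝ) ≤ q - 2 := by linarith
  have p3 : (0 : ℝ) ≤ (q - 1) * (q - 2) * (q - 3) := by
    rcases eq_or_lt_of_le hq with h | h
    · rw [← h]; norm_num
    · have : (3 : ℝ) ≤ q := by exact_mod_cast h
      exact mul_nonneg (mul_nonneg p0.le p1) (by linarith)
  have e1 := norm_zpow_taylor_three hz (q - 1)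
  have e2 := norm_zpow_taylor_three hz (-n - 1)
  set E1 := z ^ (q - 1) - 1 - ((q - 1 : ℤ) : ℂ) * (z - 1) -
    ((q - 1 : ℤ) : ℂ) * (((q - 1 : ℤ) : ℂ) - 1) / 2 * (z - 1) ^ 2 with hE1
  set E2 := z ^ (-n - 1) - 1 - ((-n - 1 : ℤ) : ℂ) * (z - 1) -
    ((-n - 1 : ℤ) : ℂ) * (((-n - 1 : ℤ) : ℂ) - 1) / 2 * (z - 1) ^ 2 with hE2
  have hq0 : z ^ q = z * z ^ (q - 1) := by
    rw [mul_comm, ← zpow_add_one₀ hz0]; congr 1; ring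
  have hn0 : z ^ (-n) = z * z ^ (-n - 1) := by
    rw [mul_comm, ← zpow_add_one₀ hz0]; congr 1; ring
  have key : ddOuter q n z (z ^ 2) (z ^ q) (z ^ (-n)) =
      z * (((0 : ℝ) : ℂ) * 0 + ((0 : ℝ) : ℂ) * 0 + ((1 / ((q - 1) * (q + n)) : ℝ) : ℂ) * E1 +
        ((-((q - 2) / ((n + 1) * (n + 2) * (n + q))) : ℝ) : ℂ) * E2) := by
    have d1 : ((q : ℂ) - 1) ≠ 0 := by exact_mod_cast p0.ne'
    have d2 : ((q : ℂ) + n) ≠ 0 := by exact_mod_cast (by linarith : (q : ℝ) + n ≠ 0)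
    have d2' : ((n : ℂ) + q) ≠ 0 := by exact_mod_cast (by linarith : (n : ℝ) + q ≠ 0)
    have d3 : ((n : ℂ) + 1) ≠ 0 := by exact_mod_cast (by linarith : (n : ℝ) + 1 ≠ 0)
    have d4 : ((n : ℂ) + 2) ≠ 0 := by exact_mod_cast (by linarith : (n : ℝ) + 2 ≠ 0)
    rw [ddOuter, hE1, hE2, hq0, hn0]
    generalize z ^ (q - 1) = u
    generalize z ^ (-n - 1) = v
    push_cast
    field_simp
    ring
  rw [key, norm_mul, hz, one_mul]
  refine (norm_smul_sum_le (A := 0) (B := 0) (by simp) (by simp) e1 e2).trans ?_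
  push_cast
  rw [abs_neg, abs_of_nonneg (by positivity : (0 : ℝ) ≤ 1 / ((q - 1) * (q + n))),
    abs_of_nonneg (by positivity : (0 : ℝ) ≤ (q - 2) / ((n + 1) * (n + 2) * (n + q))),
    abs_of_nonneg (by linarith : (0 : ℝ) ≤ (q - 1) * (q - 1 - 1) * (q - 1 - 2)),
    abs_of_nonpos (by nlinarith [mul_nonneg (mul_nonneg (by linarith : (0 : ℝ) ≤ n + 1)
      (by linarith : (0 : ℝ) ≤ n + 2)) (by linarith : (0 : ℝ) ≤ n + 3)] :
      ((-n - 1 : ℝ)) * (-n - 1 - 1) * (-n - 1 - 2) ≤ 0)]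
  apply le_of_eq
  have d2 : ((q : ℝ) + n) ≠ 0 := by linarith
  have d2' : ((n : ℝ) + q) ≠ 0 := by linarith
  have d3 : ((n : ℝ) + 1) ≠ 0 := by linarith
  have d4 : ((n : ℝ) + 2) ≠ 0 := by linarith
  field_simp
  ring

/-- After a factor `z⁻²` is taken out, the nodes are `3, 4, 0, 2-n`. With `t = z - 1` the remainders
at `3` and `4` are `t³` and `(3 + z) t³`. The negative coefficient at node `3` is absorbed into the
positive one at node `4` before the triangle inequality is applied, so that the total is exactly `(n
- 2)/6`. -/
theorem norm_ddInner_le_cube {n : ℤ} (hn : 2 ≤ n) {z : ℂ} (hz : ‖z‖ = 1) :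
    ‖ddInner n z (z ^ 2) (z⁻¹ ^ 2) (z ^ (-n))‖ ≤ (n - 2) * (‖z - 1‖ ^ 3 / 6) := by
  have hz0 : z ≠ 0 := fun h => by simp [h] at hz
  have hn' : (2 : ℝ) ≤ n := by exact_mod_cast hn
  have p1 : (0 : ℝ) ≤ n - 2 := by linarith
  have e0 := norm_zpow_taylor_three hz (-1)
  have e1 := norm_zpow_taylor_three hz 3
  have e2 := norm_zpow_taylor_three hz (-(n - 2))
  set E0 := z ^ (-1 : ℤ) - 1 - ((-1 : ℤ) : ℂ) * (z - 1) -
    ((-1 : ℤ) : ℂ) * (((-1 : ℤ) : ℂ) - 1) / 2 * (z - 1) ^ 2 with hE0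
  set E1 := z ^ (3 : ℤ) - 1 - ((3 : ℤ) : ℂ) * (z - 1) -
    ((3 : ℤ) : ℂ) * (((3 : ℤ) : ℂ) - 1) / 2 * (z - 1) ^ 2 with hE1
  set E2 := z ^ (-(n - 2)) - 1 - ((-(n - 2) : ℤ) : ℂ) * (z - 1) -
    ((-(n - 2) : ℤ) : ℂ) * (((-(n - 2) : ℤ) : ℂ) - 1) / 2 * (z - 1) ^ 2 with hE2
  have hn0 : z ^ (-n) = z⁻¹ ^ 2 * z ^ (-(n - 2)) := by
    rw [inv_pow, ← zpow_natCast, ← zpow_neg, ← zpow_add₀ hz0]; congr 1; push_cast; ring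
  have key : ddInner n z (z ^ 2) (z⁻¹ ^ 2) (z ^ (-n)) =
      z⁻¹ ^ 2 * (((-(n - 2) / (12 * (n + 2)) : ℝ) : ℂ) * (z * E0) +
        (((n - 2) / (4 * (n + 2)) : ℝ) : ℂ) * (z * E1) +
        ((n * (n - 2) / (3 * (n + 1) * (n + 2)) : ℝ) : ℂ) * E1 +
        ((-(1 / ((n + 1) * (n + 2))) : ℝ) : ℂ) * E2) := by
    have d3 : ((n : ℂ) + 1) ≠ 0 := by exact_mod_cast (by linarith : (n : ℝ) + 1 ≠ 0)
    have d4 : ((n : ℂ) + 2) ≠ 0 := by exact_mod_cast (by linarith : (n : ℝ) + 2 ≠ 0)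
    rw [ddInner, hE0, hE1, hE2, hn0]
    generalize z ^ (-(n - 2)) = v
    rw [zpow_neg_one, zpow_ofNat]
    push_cast
    field_simp
    ring
  rw [key, norm_mul, norm_pow, norm_inv, hz, inv_one, one_pow, one_mul]
  have e0' := (show ‖z * E0‖ = ‖E0‖ by rw [norm_mul, hz, one_mul]).trans_le e0
  have e1' := (show ‖z * E1‖ = ‖E1‖ by rw [norm_mul, hz, one_mul]).trans_le e1
  refine (norm_smul_sum_le e0' e1' e1 e2).trans ?_
  push_cast
  rw [abs_neg, neg_div, abs_neg, abs_of_nonneg (by positivity : (0 : ℝ) ≤ (n - 2) / (12 * (n + 2))),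
    abs_of_nonneg (by positivity : (0 : ℝ) ≤ (n - 2) / (4 * (n + 2))),
    abs_of_nonneg (by positivity : (0 : ℝ) ≤ n * (n - 2) / (3 * (n + 1) * (n + 2))),
    abs_of_nonneg (by positivity : (0 : ℝ) ≤ 1 / ((n + 1) * (n + 2))),
    abs_of_nonpos (by nlinarith [mul_nonneg (mul_nonneg (by linarith : (0 : ℝ) ≤ n)
      (by linarith : (0 : ℝ) ≤ n - 1)) p1] : (-(n - 2) : ℝ) * (-(n - 2) - 1) * (-(n - 2) - 2) ≤ 0)]
  apply le_of_eq
  have d3 : ((n : ℝ) + 1) ≠ 0 := by linarith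
  have d4 : ((n : ℝ) + 2) ≠ 0 := by linarith
  norm_num
  field_simp
  ring

end WSLD

/-! ### Third order weights corrected by a bounded third difference. -/

namespace WSLD

/-- Here `m` stands for `‖P‖ ‖D‖`, where `‖P‖ = 2 √y κ`. For fixed `m` the claim is affine in `α`,
so `α = 1` and `α = 2` suffice; the values `11/6` and `1/3` are those of `|13α - 24|/6` there. At `α
= 1` the cubic bound `b1` works up to `y = 11/20` and the absolute bound `b2` beyond. -/
theorem family_first_power_bound {y κ m α : ℝ} (hy0 : 0 ≤ y) (hy1 : y ≤ 1) (hκ0 : 0 ≤ κ)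
    (hκ : κ ^ 2 = 1 + 3 * y) (b1 : m ≤ 8 / 3 * y ^ 2 * κ) (b2 : m ≤ 4 / 15 * (1 + 7 * y))
    (hβ : 0 ≤ 2 - α) (hδ : 0 ≤ α - 1) :
    (2 - α) * (-44 / 9 * y ^ 2 - 128 / 9 * y ^ 3 + 128 / 9 * y ^ 4) +
      (α - 1) * (-28 / 9 * y ^ 2 - 160 / 9 * y ^ 3 + 160 / 9 * y ^ 4) +
      (11 / 6 * (2 - α) + 1 / 3 * (α - 1)) * m ≤ 0 := by
  have p1 : -44 / 9 * y ^ 2 - 128 / 9 * y ^ 3 + 128 / 9 * y ^ 4 + 11 / 6 * m ≤ 0 := by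
    rcases le_total y (11 / 20) with h | h
    · have k := family_sq_bound hy0 h
      have k2 : 11 * κ ≤ 11 + 32 * y - 32 * y ^ 2 := by
        have k3 : 0 ≤ 11 + 32 * y - 32 * y ^ 2 := by nlinarith
        rw [← sq_le_sq₀ (by positivity) k3, mul_pow, hκ]
        have := mul_nonneg hy0 (neg_nonneg.2 k)
        linarith
      have := mul_nonneg (sq_nonneg y) (sub_nonneg.2 k2)
      linarith
    · have k := family_right_bound h hy1
      linarith
  have p2 : -28 / 9 * y ^ 2 - 160 / 9 * y ^ 3 + 160 / 9 * y ^ 4 + 1 / 3 * m ≤ 0 := by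
    have hκ2 : κ ≤ 2 := by nlinarith
    have k1 : y ^ 2 * κ ≤ y ^ 2 * 2 := by gcongr
    have k2 : 0 ≤ y ^ 3 * (1 - y) := mul_nonneg (by positivity) (by linarith)
    have k3 : 0 ≤ y ^ 2 := by positivity
    linarith
  have i1 := mul_nonneg hβ (neg_nonneg.2 p1)
  have i2 := mul_nonneg hδ (neg_nonneg.2 p2)
  linarith

/-- The same argument with `m` standing for `‖P‖² ‖D‖`; at `α = 2` the absolute bound `b4` is enough
for all `y`. -/
theorem family_second_power_bound {y ρ m α : ℝ} (hy0 : 0 ≤ y) (hy1 : y ≤ 1)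
    (hρ : ρ ^ 2 = y) (b3 : m ≤ 16 / 3 * y * (1 + 3 * y) * (y * ρ))
    (b4 : m ≤ 32 / 15 * y * (1 + 3 * y)) (hβ : 0 ≤ 2 - α) (hδ : 0 ≤ α - 1) :
    (2 - α) * (-4 * y - 20 / 3 * y ^ 2 + 176 / 9 * y ^ 3 - 256 / 9 * y ^ 4 - 1024 / 9 * y ^ 5 +
        1024 / 9 * y ^ 6) +
      (α - 1) * (-4 * y - 4 / 3 * y ^ 2 + 256 / 9 * y ^ 3 - 320 / 9 * y ^ 4 - 1280 / 9 * y ^ 5 +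
        1280 / 9 * y ^ 6) + (11 / 6 * (2 - α) + 1 / 3 * (α - 1)) * m ≤ 0 := by
  have p1 : -4 * y - 20 / 3 * y ^ 2 + 176 / 9 * y ^ 3 - 256 / 9 * y ^ 4 - 1024 / 9 * y ^ 5 +
      1024 / 9 * y ^ 6 + 11 / 6 * m ≤ 0 := by
    rcases le_total y (11 / 20) with h | h
    · have k := mul_nonneg hy0 (neg_nonneg.2 (family_square_left_bound hy0 h))
      -- The tangent to `√y` at `y = 49/100`.
      have k2 : ρ ≤ (y + 49 / 100) * (10 / 14) := by nlinarith [sq_nonneg (ρ - 7 / 10)]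
      have k3 : y * (1 + 3 * y) * (y * ρ) ≤
          y * (1 + 3 * y) * (y * ((y + 49 / 100) * (10 / 14))) := by gcongr
      linarith
    · have k := mul_nonneg hy0 (neg_nonneg.2 (family_square_right_bound h hy1))
      linarith
  have p2 : -4 * y - 4 / 3 * y ^ 2 + 256 / 9 * y ^ 3 - 320 / 9 * y ^ 4 - 1280 / 9 * y ^ 5 +
      1280 / 9 * y ^ 6 + 1 / 3 * m ≤ 0 := by
    have k := mul_nonneg hy0 (neg_nonneg.2 (family_square_two_bound hy0 hy1))
    linarith
  have i1 := mul_nonneg hβ (neg_nonneg.2 p1)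
  have i2 := mul_nonneg hδ (neg_nonneg.2 p2)
  linarith

/-- Dissipativity of the third order weights at `1, 2, -2`, corrected to fourth order by a third
difference `D`. -/
theorem re_symBase_cpow_mul_corrected_nonpos {α : ℝ} (h1 : 1 < α) (h2 : α ≤ 2) {ζ D : ℂ}
    (hζ : ‖ζ‖ = 1) (hD : ‖D‖ ≤ ‖ζ⁻¹ - 1‖ ^ 3 / 6) (hD' : ‖D‖ ≤ 8 / 15) :
    (symBase ζ ^ (α : ℂ) * (trig5 ζ ((12 - 2 * α) / 9) (-(3 - α) / 6) 0 0 ((3 + α) / 18) -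
      ((13 * α - 24) / 6 : ℝ) * D)).re ≤ 0 := by
  obtain ⟨y, s, hy0, hy1, hs, e1, e2⟩ := exists_circle_coords hζ
  have hu : 0 ≤ 1 - y := by linarith
  have hR : (symBase ζ).re = 4 * y ^ 2 := by rw [e1, symBase_eq hs]
  have hβ : 0 ≤ 2 - α := by linarith
  have hδ : 0 ≤ α - 1 := by linarith
  -- norms
  obtain ⟨ρ, hρ0, hρ⟩ : ∃ ρ : ℝ, 0 ≤ ρ ∧ ρ ^ 2 = y := ⟨√y, Real.sqrt_nonneg _, Real.sq_sqrt hy0⟩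
  obtain ⟨κ, hκ0, hκ⟩ : ∃ κ : ℝ, 0 ≤ κ ∧ κ ^ 2 = 1 + 3 * y :=
    ⟨√(1 + 3 * y), Real.sqrt_nonneg _, Real.sq_sqrt (by linarith)⟩
  have nP : ‖symBase ζ‖ = 2 * ρ * κ := by
    rw [← sq_eq_sq₀ (norm_nonneg _) (by positivity), Complex.sq_norm, Complex.normSq_apply, e1,
      symBase_eq hs, mul_pow, mul_pow, hρ, hκ]
    linear_combination (1 + 2 * y) ^ 2 * hs
  have nt : ‖ζ⁻¹ - 1‖ = 2 * ρ := by
    rw [← sq_eq_sq₀ (norm_nonneg _) (by positivity), Complex.sq_norm, Complex.normSq_apply, e2,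
      mul_pow, hρ]
    simp
    linear_combination hs
  rw [nt] at hD
  have hD3 : ‖D‖ ≤ 4 / 3 * (y * ρ) := by
    rw [← hρ]; linarith
  -- A linear majorant of `√(y (1 + 3y))`, tangent at `y = 1`; the difference of squares is `(1 -
  -- y)²/16`.
  have hρκ : ρ * κ ≤ (1 + 7 * y) / 4 := by
    rw [← sq_le_sq₀ (by positivity) (by positivity), mul_pow, hρ, hκ]
    nlinarith [sq_nonneg (1 - y)]
  have b1 : ‖symBase ζ‖ * ‖D‖ ≤ 8 / 3 * y ^ 2 * κ := by
    rw [nP]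
    calc 2 * ρ * κ * ‖D‖ ≤ 2 * ρ * κ * (4 / 3 * (y * ρ)) := by gcongr
      _ = 8 / 3 * (ρ ^ 2) * y * κ := by ring
      _ = _ := by rw [hρ]; ring
  have b2 : ‖symBase ζ‖ * ‖D‖ ≤ 4 / 15 * (1 + 7 * y) := by
    rw [nP]
    calc 2 * ρ * κ * ‖D‖ ≤ 2 * ρ * κ * (8 / 15) := by gcongr
      _ ≤ _ := by linarith
  have nP2 : ‖symBase ζ‖ ^ 2 = 4 * y * (1 + 3 * y) := by
    rw [nP, mul_pow, mul_pow, hρ, hκ]; ring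
  have b3 : ‖symBase ζ‖ ^ 2 * ‖D‖ ≤ 16 / 3 * y * (1 + 3 * y) * (y * ρ) := by
    rw [nP2]
    calc 4 * y * (1 + 3 * y) * ‖D‖ ≤ 4 * y * (1 + 3 * y) * (4 / 3 * (y * ρ)) := by gcongr
      _ = _ := by ring
  have b4 : ‖symBase ζ‖ ^ 2 * ‖D‖ ≤ 32 / 15 * y * (1 + 3 * y) := by
    rw [nP2]
    calc 4 * y * (1 + 3 * y) * ‖D‖ ≤ 4 * y * (1 + 3 * y) * (8 / 15) := by gcongr
      _ = _ := by ring
  set T := trig5 ζ ((12 - 2 * α) / 9) (-(3 - α) / 6) 0 0 ((3 + α) / 18) with hT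
  -- `|13α - 24|/6` is convex in `α`, hence at most its chord on `[1, 2]`.
  have corr : ∀ Q : ℂ, ∀ m : ℝ, ‖Q‖ * ‖D‖ ≤ m →
      (Q * (T - ((13 * α - 24) / 6 : ℝ) * D)).re ≤
        (Q * T).re + (11 / 6 * (2 - α) + 1 / 3 * (α - 1)) * m := by
    intro Q m hm
    have e : Q * (T - ((13 * α - 24) / 6 : ℝ) * D) =
        Q * T - ((13 * α - 24) / 6 : ℝ) * (Q * D) := by ring
    rw [e, Complex.sub_re, Complex.re_ofReal_mul]
    have i1 : |(Q * D).re| ≤ m := (Complex.abs_re_le_norm _).trans (by rwa [norm_mul])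
    have i2 := abs_le.1 i1
    nlinarith [mul_nonneg hβ (by linarith [i2.1] : 0 ≤ m + (Q * D).re),
      mul_nonneg hβ (by linarith [i2.2] : 0 ≤ m - (Q * D).re),
      mul_nonneg hδ (by linarith [i2.1] : 0 ≤ m + (Q * D).re),
      mul_nonneg hδ (by linarith [i2.2] : 0 ≤ m - (Q * D).re)]
  have c1 : (symBase ζ * (T - ((13 * α - 24) / 6 : ℝ) * D)).re ≤ 0 := by
    have h := corr (symBase ζ) _ le_rfl
    rw [hT, re_symBase_mul_trig5 hs e1 e2] at h
    have := family_first_power_bound hy0 hy1 hκ0 hκ b1 b2 hβ hδ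
    linarith
  have c2 : (symBase ζ * (symBase ζ * (T - ((13 * α - 24) / 6 : ℝ) * D))).re ≤ 0 := by
    have h := corr (symBase ζ * symBase ζ) _ (by rw [norm_mul, ← sq])
    rw [mul_assoc, mul_assoc, hT, re_symBase_sq_mul_trig5 hs e1 e2] at h
    have := family_second_power_bound hy0 hy1 hρ b3 b4 hβ hδ
    linarith
  have hR0 : 0 ≤ (symBase ζ).re := by rw [hR]; positivity
  refine re_symBase_cpow_mul_nonpos h1 h2 hR0 c1 ?_
  have := mul_nonneg hβ (mul_nonneg hR0 (neg_nonneg.2 c1))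
  have := mul_nonneg hδ (neg_nonneg.2 c2)
  linarith

/-- Dissipativity for the weights at the shifts `1, 2, -2, q, -n`. -/
theorem re_symBase_cpow_mul_family_nonpos {α : ℝ} (h1 : 1 < α) (h2 : α < 2) {q n : ℤ}
    (hq : 2 ≤ q) (hn : 2 ≤ n) (hqn : 4 < q + n) {ζ : ℂ} (hζ : ‖ζ‖ = 1) :
    (symBase ζ ^ (α : ℂ) * (trig5 ζ ((12 - 2 * α) / 9) (-(3 - α) / 6) 0 0 ((3 + α) / 18) -
      ((13 * α - 24) / 6 : ℝ) *
        ((((n - 2) * (2 * α / 3 + 2) + (q - 2) * (n - 2 * α / 3))⁻¹ : ℝ) *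
          (((2 * α / 3 + 2 : ℝ) : ℂ) * ddInner n ζ⁻¹ (ζ⁻¹ ^ 2) (ζ ^ 2) (ζ⁻¹ ^ (-n)) +
            ((n - 2 * α / 3 : ℝ) : ℂ) *
              ddOuter q n ζ⁻¹ (ζ⁻¹ ^ 2) (ζ⁻¹ ^ q) (ζ⁻¹ ^ (-n)))))).re ≤ 0 := by
  have hz : ‖ζ⁻¹‖ = 1 := by rw [norm_inv, hζ, inv_one]
  have hq' : (2 : ℝ) ≤ q := by exact_mod_cast hq
  have hn' : (2 : ℝ) ≤ n := by exact_mod_cast hn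
  have hD0 : 0 < ((n : ℝ) - 2) * (2 * α / 3 + 2) + (q - 2) * (n - 2 * α / 3) := by
    have a1 : 0 ≤ ((n : ℝ) - 2) * (2 * α / 3 + 2) := mul_nonneg (by linarith) (by linarith)
    have a2 : 0 ≤ ((q : ℝ) - 2) * (n - 2 * α / 3) := mul_nonneg (by linarith) (by linarith)
    rcases eq_or_lt_of_le hn with h | h
    · have : (3 : ℝ) ≤ q := by exact_mod_cast (by omega : 3 ≤ q)
      have : 0 < ((q : ℝ) - 2) * (n - 2 * α / 3) := mul_pos (by linarith) (by linarith)
      linarith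
    · have : (3 : ℝ) ≤ n := by exact_mod_cast h
      have : 0 < ((n : ℝ) - 2) * (2 * α / 3 + 2) := mul_pos (by linarith) (by linarith)
      linarith
  set Δ := ((n : ℝ) - 2) * (2 * α / 3 + 2) + (q - 2) * (n - 2 * α / 3) with hΔ
  -- `ddInner/(n-2)` and `ddOuter/(q-2)` are third divided differences, and `Δ` is the sum of their
  -- nonnegative weights. The bracket is thus a convex combination and inherits every common bound.
  -- Stating it with the factors `n - 2` and `q - 2` keeps the degenerate cases `n = 2`, `q = 2`
  -- inside.
  have comb : ∀ b : ℝ, ‖ddInner n ζ⁻¹ (ζ⁻¹ ^ 2) (ζ ^ 2) (ζ⁻¹ ^ (-n))‖ ≤ (n - 2) * b →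
      ‖ddOuter q n ζ⁻¹ (ζ⁻¹ ^ 2) (ζ⁻¹ ^ q) (ζ⁻¹ ^ (-n))‖ ≤ (q - 2) * b →
      ‖((Δ⁻¹ : ℝ) : ℂ) *
          (((2 * α / 3 + 2 : ℝ) : ℂ) * ddInner n ζ⁻¹ (ζ⁻¹ ^ 2) (ζ ^ 2) (ζ⁻¹ ^ (-n)) +
            ((n - 2 * α / 3 : ℝ) : ℂ) *
              ddOuter q n ζ⁻¹ (ζ⁻¹ ^ 2) (ζ⁻¹ ^ q) (ζ⁻¹ ^ (-n)))‖ ≤ b := by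
    intro b hb1 hb2
    rw [norm_mul, Complex.norm_real, Real.norm_of_nonneg (by positivity)]
    have i : ‖((2 * α / 3 + 2 : ℝ) : ℂ) * ddInner n ζ⁻¹ (ζ⁻¹ ^ 2) (ζ ^ 2) (ζ⁻¹ ^ (-n)) +
        ((n - 2 * α / 3 : ℝ) : ℂ) * ddOuter q n ζ⁻¹ (ζ⁻¹ ^ 2) (ζ⁻¹ ^ q) (ζ⁻¹ ^ (-n))‖ ≤ Δ * b := by
      refine (norm_add_le _ _).trans ?_
      rw [norm_mul, norm_mul, Complex.norm_real, Complex.norm_real,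
        Real.norm_of_nonneg (by linarith), Real.norm_of_nonneg (by linarith)]
      have j1 := mul_le_mul_of_nonneg_left hb1 (by linarith : 0 ≤ 2 * α / 3 + 2)
      have j2 := mul_le_mul_of_nonneg_left hb2 (by linarith : 0 ≤ (n : ℝ) - 2 * α / 3)
      rw [hΔ]
      linarith
    calc Δ⁻¹ * _ ≤ Δ⁻¹ * (Δ * b) := by gcongr
      _ = b := by field_simp
  have z1 : ‖ζ⁻¹ ^ 2‖ ≤ 1 := by rw [norm_pow, hz, one_pow]
  have z2 : ‖ζ ^ 2‖ ≤ 1 := by rw [norm_pow, hζ, one_pow]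
  have z3 : ∀ m : ℤ, ‖ζ⁻¹ ^ m‖ ≤ 1 := fun m => by rw [norm_zpow, hz, one_zpow]
  refine re_symBase_cpow_mul_corrected_nonpos h1 h2.le hζ (comb _ ?_ ?_) (comb _ ?_ ?_)
  · simpa using norm_ddInner_le_cube hn hz
  · exact norm_ddOuter_le_cube hq hn hz
  -- At `n = 2` the cubic bound says that the inner difference is zero; the coefficient count needs
  -- `n ≥ 3`.
  · rcases eq_or_lt_of_le hn with h | h
    · have := norm_ddInner_le_cube hn hz
      rw [inv_inv] at this
      rw [← h] at this ⊢
      norm_num at this ⊢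
      exact this
    · exact norm_ddInner_le (by exact_mod_cast h) hz.le z1 z2 (z3 _)
  · rcases eq_or_lt_of_le hq with h | h
    · have := norm_ddOuter_le_cube hq hn hz
      rw [← h] at this ⊢
      norm_num at this ⊢
      exact this
    · exact norm_ddOuter_le (by exact_mod_cast h) hn' hz.le z1 (z3 _) (z3 _)

end WSLD

namespace WSLD

/-! ### The weights and shifts of the fourth order matrices -/

/-- The eight shifts as a family. -/
def Shifts.shift (P : Shifts) : Fin 8 → ℤ := ![P.p, P.q, P.r, P.s, P.pb, P.qb, P.rb, P.sb]

/-- The weight of `A_p` in `A_{p,q}`. -/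
noncomputable def weight₂ (p q : ℤ) : ℝ := (q : ℝ) / (q - p)

/-- The weight of `A_{p,q}` in `A_{p,q,r,s}`. -/
noncomputable def weight₃ (α : ℝ) (p q r s : ℤ) : ℝ :=
  (3 * r * s + 2 * α) / (3 * (r * s - p * q))

/-- The weight of `A_{p,q,r,s}` in the fourth order matrix. -/
noncomputable def Shifts.weight₄ (α : ℝ) (P : Shifts) : ℝ :=
  aCoeff P.p P.q P.r P.s * bCoeff α P.pb P.qb P.rb P.sb /
    (aCoeff P.p P.q P.r P.s * bCoeff α P.pb P.qb P.rb P.sb -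
      aCoeff P.pb P.qb P.rb P.sb * bCoeff α P.p P.q P.r P.s)

/-- The weight of `A_{p̄,q̄,r̄,s̄}` in the fourth order matrix. -/
noncomputable def Shifts.weight₄' (α : ℝ) (P : Shifts) : ℝ :=
  aCoeff P.pb P.qb P.rb P.sb * bCoeff α P.p P.q P.r P.s /
    (aCoeff P.pb P.qb P.rb P.sb * bCoeff α P.p P.q P.r P.s -
      aCoeff P.p P.q P.r P.s * bCoeff α P.pb P.qb P.rb P.sb)

/-- The eight weights. -/
noncomputable def Shifts.weight (α : ℝ) (P : Shifts) : Fin 8 → ℝ :=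
  ![P.weight₄ α * weight₃ α P.p P.q P.r P.s * weight₂ P.p P.q,
    P.weight₄ α * weight₃ α P.p P.q P.r P.s * weight₂ P.q P.p,
    P.weight₄ α * weight₃ α P.r P.s P.p P.q * weight₂ P.r P.s,
    P.weight₄ α * weight₃ α P.r P.s P.p P.q * weight₂ P.s P.r,
    P.weight₄' α * weight₃ α P.pb P.qb P.rb P.sb * weight₂ P.pb P.qb,
    P.weight₄' α * weight₃ α P.pb P.qb P.rb P.sb * weight₂ P.qb P.pb,
    P.weight₄' α * weight₃ α P.rb P.sb P.pb P.qb * weight₂ P.rb P.sb,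
    P.weight₄' α * weight₃ α P.rb P.sb P.pb P.qb * weight₂ P.sb P.rb]

theorem A4_eq_sum (α : ℝ) (P : Shifts) (n : ℕ) :
    A4 α P n = ∑ i, P.weight α i • A1 α n (P.shift i) := by
  rw [Fin.sum_univ_eight]
  simp only [A4, A3, A2, Shifts.weight, Shifts.shift, Shifts.weight₄, Shifts.weight₄', weight₃,
    weight₂, Matrix.cons_val]
  module

/-- Moment conditions of fourth order and dissipativity for weights `w` at shifts `sh`. -/
structure IsStableFourthOrder (α : ℝ) {ι : Type*} [Fintype ι] (w : ι → ℝ) (sh : ι → ℤ) :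
    Prop where
  sum_eq : ∑ i, w i = 1
  sum_mul : ∑ i, w i * (sh i : ℝ) = 0
  sum_mul_sq : ∑ i, w i * (sh i : ℝ) ^ 2 = 2 * α / 3
  sum_mul_cube : ∑ i, w i * (sh i : ℝ) ^ 3 = -(3 * α / 2)
  re_symbol_nonpos : ∀ ζ : ℂ, ‖ζ‖ = 1 →
    (symBase ζ ^ (α : ℂ) * ∑ i, (w i : ℂ) * ζ⁻¹ ^ sh i).re ≤ 0

theorem weight₂_moments {p q : ℤ} (h : p ≠ q) :
    weight₂ p q + weight₂ q p = 1 ∧ weight₂ p q * p + weight₂ q p * q = 0 ∧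
    weight₂ p q * (p : ℝ) ^ 2 + weight₂ q p * (q : ℝ) ^ 2 = -(p * q) ∧
    weight₂ p q * (p : ℝ) ^ 3 + weight₂ q p * (q : ℝ) ^ 3 = -(p * q * (p + q)) := by
  have h1 : (q : ℝ) - p ≠ 0 := by
    rw [sub_ne_zero]; exact_mod_cast h.symm
  have e : weight₂ q p = -(p / (q - p)) := by
    rw [weight₂, ← neg_sub (q : ℝ) p, div_neg]
  rw [e, weight₂]
  refine ⟨?_, ?_, ?_, ?_⟩ <;> field_simp <;> ring

/-- The third moment misses its target `-3α/2` by `b/(6a)`. The last layer of weights is chosen to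
cancel this defect between two quadruples. -/
theorem weight₃_moments {α : ℝ} {p q r s : ℤ} (h : aCoeff p q r s ≠ 0) :
    weight₃ α p q r s + weight₃ α r s p q = 1 ∧
    weight₃ α p q r s * -(p * q) + weight₃ α r s p q * -(r * s) = 2 * α / 3 ∧
    weight₃ α p q r s * -(p * q * (p + q)) + weight₃ α r s p q * -(r * s * (r + s)) =
      bCoeff α p q r s / (6 * aCoeff p q r s) - 3 * α / 2 := by
  have e : weight₃ α r s p q = -((3 * p * q + 2 * α) / (3 * (r * s - p * q))) := by
    rw [weight₃, ← neg_sub ((r : ℝ) * s), mul_neg, div_neg]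
  rw [e, weight₃, bCoeff]
  rw [aCoeff] at h ⊢
  refine ⟨?_, ?_, ?_⟩ <;> field_simp <;> ring

/-- The three layers settle the moments of order 0 and 1, then 2, then 3. At each layer the weights
sum to one, so the moments already fixed survive. -/
theorem Shifts.weight_moments {α : ℝ} {P : Shifts} (h1 : P.p ≠ P.q) (h2 : P.r ≠ P.s)
    (h3 : P.pb ≠ P.qb) (h4 : P.rb ≠ P.sb) (ha : aCoeff P.p P.q P.r P.s ≠ 0)
    (hab : aCoeff P.pb P.qb P.rb P.sb ≠ 0) (hP : P.Nondegenerate α) :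
    ∑ i, P.weight α i = 1 ∧ ∑ i, P.weight α i * (P.shift i : ℝ) = 0 ∧
    ∑ i, P.weight α i * (P.shift i : ℝ) ^ 2 = 2 * α / 3 ∧
    ∑ i, P.weight α i * (P.shift i : ℝ) ^ 3 = -(3 * α / 2) := by
  obtain ⟨a0, a1, a2, a3⟩ := weight₂_moments h1
  obtain ⟨b0, b1, b2, b3⟩ := weight₂_moments h2
  obtain ⟨c0, c1, c2, c3⟩ := weight₂_moments h3
  obtain ⟨d0, d1, d2, d3⟩ := weight₂_moments h4
  obtain ⟨u0, u2, u3⟩ := weight₃_moments (α := α) ha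
  obtain ⟨v0, v2, v3⟩ := weight₃_moments (α := α) hab
  have hd : aCoeff P.p P.q P.r P.s * bCoeff α P.pb P.qb P.rb P.sb -
      aCoeff P.pb P.qb P.rb P.sb * bCoeff α P.p P.q P.r P.s ≠ 0 := sub_ne_zero.2 hP
  have e : P.weight₄' α = -(aCoeff P.pb P.qb P.rb P.sb * bCoeff α P.p P.q P.r P.s /
      (aCoeff P.p P.q P.r P.s * bCoeff α P.pb P.qb P.rb P.sb -
      aCoeff P.pb P.qb P.rb P.sb * bCoeff α P.p P.q P.r P.s)) := by
    rw [Shifts.weight₄', ← neg_sub, div_neg]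
  have w0 : P.weight₄ α + P.weight₄' α = 1 := by
    rw [e, Shifts.weight₄]; field_simp; ring
  have w3 : P.weight₄ α * (bCoeff α P.p P.q P.r P.s / (6 * aCoeff P.p P.q P.r P.s)) +
      P.weight₄' α * (bCoeff α P.pb P.qb P.rb P.sb / (6 * aCoeff P.pb P.qb P.rb P.sb)) = 0 := by
    rw [e, Shifts.weight₄]; field_simp; ring
  simp only [Fin.sum_univ_eight, Shifts.weight, Shifts.shift, Matrix.cons_val]
  set A := P.weight₄ α
  set B := P.weight₄' α
  set A₁ := weight₃ α P.p P.q P.r P.s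
  set A₂ := weight₃ α P.r P.s P.p P.q
  set B₁ := weight₃ α P.pb P.qb P.rb P.sb
  set B₂ := weight₃ α P.rb P.sb P.pb P.qb
  refine ⟨?_, ?_, ?_, ?_⟩
  · linear_combination A * A₁ * a0 + A * A₂ * b0 + B * B₁ * c0 + B * B₂ * d0 + A * u0 + B * v0 + w0
  · linear_combination A * A₁ * a1 + A * A₂ * b1 + B * B₁ * c1 + B * B₂ * d1
  · linear_combination A * A₁ * a2 + A * A₂ * b2 + B * B₁ * c2 + B * B₂ * d2 + A * u2 + B * v2 +
      2 * α / 3 * w0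
  · linear_combination A * A₁ * a3 + A * A₂ * b3 + B * B₁ * c3 + B * B₂ * d3 + A * u3 + B * v3 +
      w3 - 3 * α / 2 * w0

/-- Dissipativity of fourth order weights supported on the shifts `-2, …, 2`. -/
theorem re_symbol_nonpos_of_trig5 {α : ℝ} (h1 : 1 < α) (h2 : α < 2) {X₁ X₂ X₀ Y₁ Y₂ : ℝ}
    (m0 : X₁ + X₂ + X₀ + Y₁ + Y₂ = 1) (m1 : X₁ + 2 * X₂ - Y₁ - 2 * Y₂ = 0)
    (m2 : X₁ + 4 * X₂ + Y₁ + 4 * Y₂ = 2 * α / 3)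
    (m3 : X₁ + 8 * X₂ - Y₁ - 8 * Y₂ = -(3 * α / 2))
    (hl : 4 * Y₁ ≤ 7 - 5 * (α - 1)) (hu : -(4 * Y₁) ≤ α - 1) {ζ : ℂ} (hζ : ‖ζ‖ = 1) :
    (symBase ζ ^ (α : ℂ) * trig5 ζ X₁ X₂ X₀ Y₁ Y₂).re ≤ 0 := by
  have h := re_symBase_cpow_mul_trig5_nonpos (ν := -(Y₁ / 4)) h1 h2.le (by linarith)
    (by linarith) hζ
  have e1 : X₁ = α / 2 - 4 * -(Y₁ / 4) := by linarith
  have e2 : X₂ = -(5 * α / 48) + -(Y₁ / 4) := by linarith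
  have e3 : X₀ = (24 - 13 * α) / 24 + 6 * -(Y₁ / 4) := by linarith
  have e4 : Y₁ = -(4 * -(Y₁ / 4)) := by linarith
  have e5 : Y₂ = 7 * α / 48 + -(Y₁ / 4) := by linarith
  rwa [← e1, ← e2, ← e3, ← e4, ← e5] at h

end WSLD

/-! ### Stability of the admissible shifts. -/

namespace WSLD

theorem sum_mul_comp_of_abs_le_two {ι R : Type*} [Fintype ι] [CommRing R] {sh : ι → ℤ}
    (hsh : ∀ i, |sh i| ≤ 2) (w : ι → R) (f : ℤ → R) :
    ∑ i, w i * f (sh i) = (∑ i, if sh i = 1 then w i else 0) * f 1 +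
      (∑ i, if sh i = 2 then w i else 0) * f 2 + (∑ i, if sh i = 0 then w i else 0) * f 0 +
      (∑ i, if sh i = -1 then w i else 0) * f (-1) +
      (∑ i, if sh i = -2 then w i else 0) * f (-2) := by
  simp only [Finset.sum_mul, ← Finset.sum_add_distrib]
  refine Finset.sum_congr rfl fun i _ => ?_
  have h := abs_le.1 (hsh i)
  have h' : sh i = -2 ∨ sh i = -1 ∨ sh i = 0 ∨ sh i = 1 ∨ sh i = 2 := by omega
  rcases h' with h | h | h | h | h <;> rw [h] <;> simp

/-- Weights on the shifts `-2, …, 2` are stable if the weight at `-1` is small. -/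
theorem isStableFourthOrder_of_abs_le_two {α : ℝ} (h1 : 1 < α) (h2 : α < 2) {ι : Type*}
    [Fintype ι] {w : ι → ℝ} {sh : ι → ℤ} (hsh : ∀ i, |sh i| ≤ 2)
    (m0 : ∑ i, w i = 1) (m1 : ∑ i, w i * (sh i : ℝ) = 0)
    (m2 : ∑ i, w i * (sh i : ℝ) ^ 2 = 2 * α / 3)
    (m3 : ∑ i, w i * (sh i : ℝ) ^ 3 = -(3 * α / 2))
    (hl : 4 * (∑ i, if sh i = -1 then w i else 0) ≤ 7 - 5 * (α - 1))
    (hu : -(4 * ∑ i, if sh i = -1 then w i else 0) ≤ α - 1) : IsStableFourthOrder α w sh := by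
  refine ⟨m0, m1, m2, m3, fun ζ hζ => ?_⟩
  have e0 := sum_mul_comp_of_abs_le_two hsh w (fun _ => 1)
  have e1 := sum_mul_comp_of_abs_le_two hsh w (fun k => (k : ℝ))
  have e2 := sum_mul_comp_of_abs_le_two hsh w (fun k => (k : ℝ) ^ 2)
  have e3 := sum_mul_comp_of_abs_le_two hsh w (fun k => (k : ℝ) ^ 3)
  have eC := sum_mul_comp_of_abs_le_two hsh (fun i => (w i : ℂ)) (fun k => ζ⁻¹ ^ k)
  simp only [mul_one, m0, m1, m2, m3] at e0 e1 e2 e3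
  push_cast at e1 e2 e3
  have hc : ∀ k : ℤ, (∑ i, if sh i = k then (w i : ℂ) else 0) =
      ((∑ i, if sh i = k then w i else 0 : ℝ) : ℂ) := by
    intro k; rw [Complex.ofReal_sum]; refine Finset.sum_congr rfl fun i _ => ?_; split_ifs <;> simp
  rw [eC]
  simp only [hc]
  have h := re_symbol_nonpos_of_trig5 h1 h2 (X₁ := ∑ i, if sh i = 1 then w i else 0)
    (X₂ := ∑ i, if sh i = 2 then w i else 0) (X₀ := ∑ i, if sh i = 0 then w i else 0)
    (Y₁ := ∑ i, if sh i = -1 then w i else 0) (Y₂ := ∑ i, if sh i = -2 then w i else 0)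
    (by linarith) (by linarith) (by linarith) (by linarith) hl hu hζ
  convert h using 3
  rw [trig5]
  simp [zpow_ofNat]

/-- Weights on the shifts `-2, -1, 1, 2` are stable. -/
theorem isStableFourthOrder_of_ne_zero {α : ℝ} (h1 : 1 < α) (h2 : α < 2) {ι : Type*}
    [Fintype ι] {w : ι → ℝ} {sh : ι → ℤ} (hsh : ∀ i, |sh i| ≤ 2) (h0 : ∀ i, sh i ≠ 0)
    (m0 : ∑ i, w i = 1) (m1 : ∑ i, w i * (sh i : ℝ) = 0)
    (m2 : ∑ i, w i * (sh i : ℝ) ^ 2 = 2 * α / 3)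
    (m3 : ∑ i, w i * (sh i : ℝ) ^ 3 = -(3 * α / 2)) : IsStableFourthOrder α w sh := by
  have e0 := sum_mul_comp_of_abs_le_two hsh w (fun _ => 1)
  have e1 := sum_mul_comp_of_abs_le_two hsh w (fun k => (k : ℝ))
  have e2 := sum_mul_comp_of_abs_le_two hsh w (fun k => (k : ℝ) ^ 2)
  have e3 := sum_mul_comp_of_abs_le_two hsh w (fun k => (k : ℝ) ^ 3)
  simp only [mul_one, m0, m1, m2, m3, h0, if_false, Finset.sum_const_zero] at e0 e1 e2 e3
  push_cast at e1 e2 e3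
  -- With no weight at `0` the moments force the weight at `-1` to be `(24 - 13α)/36`, which lies in
  -- the admissible range.
  refine isStableFourthOrder_of_abs_le_two h1 h2 hsh m0 m1 m2 m3 ?_ ?_ <;> linarith

theorem Shifts.isStableFourthOrder_of_special {α : ℝ} (h1 : 1 < α) (h2 : α < 2) {P : Shifts}
    (hP : P = ⟨1, 2, 1, 0, 1, 2, 1, -2⟩ ∨ P = ⟨1, 2, 1, 0, 1, -1, 1, -2⟩ ∨
      P = ⟨1, 2, 1, -1, 1, 2, 1, -2⟩ ∨ P = ⟨1, 2, 1, -1, 1, -1, 1, -2⟩ ∨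
      P = ⟨1, 0, 1, -1, 1, 2, 1, -2⟩ ∨ P = ⟨1, 0, 1, -2, 1, 2, 1, -2⟩ ∨
      P = ⟨1, -1, 1, -2, 1, 2, 1, -2⟩) (hn : P.Nondegenerate α) :
    IsStableFourthOrder α (P.weight α) P.shift := by
  have hsh : ∀ i, |P.shift i| ≤ 2 := by
    rcases hP with rfl | rfl | rfl | rfl | rfl | rfl | rfl <;> decide
  obtain ⟨m0, m1, m2, m3⟩ := Shifts.weight_moments (α := α) (P := P)
    (by rcases hP with rfl | rfl | rfl | rfl | rfl | rfl | rfl <;> decide)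
    (by rcases hP with rfl | rfl | rfl | rfl | rfl | rfl | rfl <;> decide)
    (by rcases hP with rfl | rfl | rfl | rfl | rfl | rfl | rfl <;> decide)
    (by rcases hP with rfl | rfl | rfl | rfl | rfl | rfl | rfl <;> decide)
    (by rcases hP with rfl | rfl | rfl | rfl | rfl | rfl | rfl <;> norm_num [aCoeff])
    (by rcases hP with rfl | rfl | rfl | rfl | rfl | rfl | rfl <;> norm_num [aCoeff]) hn
  by_cases h0 : ∀ i, P.shift i ≠ 0
  · exact isStableFourthOrder_of_ne_zero h1 h2 hsh h0 m0 m1 m2 m3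
  -- Among the tuples containing the shift `0`, two do not contain `-1`; in the other two it occurs
  -- exactly once and its weight has a closed form.
  have hY : (∑ i, if P.shift i = -1 then P.weight α i else 0) = 0 ∨
      (∑ i, if P.shift i = -1 then P.weight α i else 0) = 7 * α * (3 - α) / (4 * (5 * α - 3)) ∨
      (∑ i, if P.shift i = -1 then P.weight α i else 0) =
        α * (24 - 13 * α) / (12 * (6 - α)) := by
    have d1 : (5 * α - 3) ≠ 0 := by linarith
    have d2 : (6 - α) ≠ 0 := by linarith
    rcases hP with rfl | rfl | rfl | rfl | rfl | rfl | rfl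
    · left
      simp [Fin.sum_univ_eight, Shifts.shift]
    · right; left
      have e : Shifts.weight₄' α ⟨1, 2, 1, 0, 1, -1, 1, -2⟩ = 21 * α / (4 * (5 * α - 3)) := by
        rw [Shifts.Nondegenerate] at hn
        rw [Shifts.weight₄', div_eq_div_iff (sub_ne_zero.2 hn.symm) (by simpa using d1)]
        simp only [aCoeff, bCoeff]
        push_cast
        ring
      simp [Fin.sum_univ_eight, Shifts.shift, Shifts.weight, e, weight₂, weight₃]
      field_simp
      ring
    · exact absurd (by decide) h0
    · exact absurd (by decide) h0
    · right; right
      have e : Shifts.weight₄ α ⟨1, 0, 1, -1, 1, 2, 1, -2⟩ = (24 - 13 * α) / (4 * (6 - α)) := by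
        rw [Shifts.Nondegenerate] at hn
        rw [Shifts.weight₄, div_eq_div_iff (sub_ne_zero.2 hn) (by simpa using d2)]
        simp only [aCoeff, bCoeff]
        push_cast
        ring
      simp [Fin.sum_univ_eight, Shifts.shift, Shifts.weight, e, weight₂, weight₃]
      field_simp
      ring
    · left
      simp [Fin.sum_univ_eight, Shifts.shift]
    · exact absurd (by decide) h0
  have p1 : 0 < 5 * α - 3 := by linarith
  have p2 : 0 < 6 - α := by linarith
  refine isStableFourthOrder_of_abs_le_two h1 h2 hsh m0 m1 m2 m3 ?_ ?_ <;>
    rcases hY with h | h | h <;> rw [h]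
  · linarith
  · rw [mul_div_assoc', div_le_iff₀ (by positivity)]
    nlinarith
  · rw [mul_div_assoc', div_le_iff₀ (by positivity)]
    nlinarith
  · linarith
  · rw [mul_div_assoc', neg_le, le_div_iff₀ (by positivity)]
    nlinarith
  · rw [mul_div_assoc', neg_le, le_div_iff₀ (by positivity)]
    nlinarith

/-- Given `W₄` and `W₅`, the moments of order 0, 1, 2 determine the other three weights. They turn
out to be the third order weights at `1, 2, -2` minus `(13α - 24)/6` times a normalized third
difference, whose third moment is one. -/
theorem re_symbol_nonpos_of_family {α : ℝ} (h1 : 1 < α) (h2 : α < 2) {q n : ℤ}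
    (hq : 2 ≤ q) (hn : 2 ≤ n) (hqn : 4 < q + n) {W₁ W₂ W₃ W₄ W₅ : ℝ}
    (m0 : W₁ + W₂ + W₃ + W₄ + W₅ = 1) (m1 : W₁ + 2 * W₂ - 2 * W₃ + q * W₄ - n * W₅ = 0)
    (m2 : W₁ + 4 * W₂ + 4 * W₃ + q ^ 2 * W₄ + n ^ 2 * W₅ = 2 * α / 3)
    {Δ : ℝ} (hΔ : Δ = ((n : ℝ) - 2) * (2 * α / 3 + 2) + (q - 2) * (n - 2 * α / 3)) (hΔ0 : Δ ≠ 0)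
    (h4 : W₄ = -((13 * α - 24) / (6 * Δ) * ((n - 2 * α / 3) / ((n + q) * (q - 1)))))
    (h5 : W₅ = (13 * α - 24) / (6 * Δ) * ((q + 2 * α / 3) / ((n + q) * (n + 1))))
    {ζ : ℂ} (hζ : ‖ζ‖ = 1) :
    (symBase ζ ^ (α : ℂ) * (W₁ * ζ⁻¹ + W₂ * ζ⁻¹ ^ 2 + W₃ * ζ ^ 2 + W₄ * ζ⁻¹ ^ q +
      W₅ * ζ⁻¹ ^ (-n))).re ≤ 0 := by
  have h := re_symBase_cpow_mul_family_nonpos h1 h2 hq hn hqn hζ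
  rw [← hΔ] at h
  convert h using 3
  have hq' : (2 : ℝ) ≤ q := by exact_mod_cast hq
  have hn' : (2 : ℝ) ≤ n := by exact_mod_cast hn
  have q1 : (q : ℝ) - 1 ≠ 0 := by linarith
  have n1 : (n : ℝ) + 1 ≠ 0 := by linarith
  have n2 : (n : ℝ) + 2 ≠ 0 := by linarith
  have nq : (n : ℝ) + q ≠ 0 := by linarith
  have qn : (q : ℝ) + n ≠ 0 := by linarith
  have e5 : W₅ = (13 * α - 24) / 6 * Δ⁻¹ * ((2 * α / 3 + 2) * (1 / ((n + 1) * (n + 2))) +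
      (n - 2 * α / 3) * ((q - 2) / ((n + 1) * (n + 2) * (n + q)))) := by
    rw [h5]; field_simp; ring
  have e4 : W₄ = -((13 * α - 24) / 6 * Δ⁻¹ * ((n - 2 * α / 3) * (1 / ((q - 1) * (q + n))))) := by
    rw [h4]; field_simp; ring
  have e3 : W₃ = (3 + α) / 18 - (13 * α - 24) / 6 * Δ⁻¹ * ((2 * α / 3 + 2) * (1 / 12)) := by
    -- The moments are tested against `(k - 1)(k - 2)`, which removes `W₁` and `W₂`; the formula for
    -- `W₂` below tests against `k - 1`.
    have : W₃ = (2 * α / 3 + 2 - (q - 1) * (q - 2) * W₄ - (n + 1) * (n + 2) * W₅) / 12 := by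
      linarith
    rw [this, e4, e5]; field_simp; ring
  have e2 : W₂ = -(3 - α) / 6 - (13 * α - 24) / 6 * Δ⁻¹ *
      ((2 * α / 3 + 2) * ((n - 2) / (4 * (n + 2))) + (n - 2 * α / 3) * -(1 / (n + 2))) := by
    have : W₂ = -1 + 3 * W₃ - (q - 1) * W₄ + (n + 1) * W₅ := by linarith
    rw [this, e3, e4, e5]; field_simp; ring
  have e1 : W₁ = (12 - 2 * α) / 9 - (13 * α - 24) / 6 * Δ⁻¹ *
      ((2 * α / 3 + 2) * -((n - 2) / (3 * (n + 1))) +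
        (n - 2 * α / 3) * ((q - 2) / ((q - 1) * (n + 1)))) := by
    have : W₁ = 1 - W₂ - W₃ - W₄ - W₅ := by linarith
    rw [this, e2, e3, e4, e5]; field_simp; ring
  rw [e1, e2, e3, e4, e5, trig5, ddOuter, ddInner]
  push_cast
  ring

theorem Shifts.isStableFourthOrder {α : ℝ} (h1 : 1 < α) (h2 : α < 2) {P : Shifts}
    (hP : P.Effective) (hn : P.Nondegenerate α) :
    IsStableFourthOrder α (P.weight α) P.shift := by
  rcases hP with ⟨q, s, hq, hs, hne, hqs, rfl⟩ | hP
  swap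
  · exact Shifts.isStableFourthOrder_of_special h1 h2 hP hn
  have hqs' : q ≠ s := by
    rintro rfl
    nlinarith
  have hqR : (q : ℝ) ≠ s := by exact_mod_cast hqs'
  obtain ⟨m0, m1, m2, m3⟩ := Shifts.weight_moments (α := α) (P := ⟨1, 2, 1, -2, 1, q, 1, s⟩)
    (by simp) (by simp) (by rintro h; simp only at h; subst h; simp at hq)
    (by rintro h; simp only at h; subst h; simp at hs) (by norm_num [aCoeff])
    (by simpa [aCoeff, sub_eq_zero] using hqR.symm) hn
  refine ⟨m0, m1, m2, m3, fun ζ hζ => ?_⟩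
  have hsq : (s : ℝ) - q ≠ 0 := sub_ne_zero.2 hqR.symm
  rw [Shifts.Nondegenerate] at hn
  simp only [aCoeff, bCoeff] at hn
  push_cast at hn
  -- The determinant `a b̄ - ā b` factors as `4 (s - q)` times this expression, which is six times
  -- the `Δ` of the family.
  have hden : -24 - 6 * q * s - 4 * α * (s + q) ≠ 0 := by
    intro h
    apply hn
    linear_combination (4 * (s - q)) * h
  have e : Shifts.weight₄' α ⟨1, 2, 1, -2, 1, q, 1, s⟩ =
      (13 * α - 24) / (-24 - 6 * q * s - 4 * α * (s + q)) := by
    rw [Shifts.weight₄']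
    simp only [aCoeff, bCoeff]
    push_cast
    rw [div_eq_div_iff (sub_ne_zero.2 hn.symm) hden]
    ring
  set w := Shifts.weight α ⟨1, 2, 1, -2, 1, q, 1, s⟩ with hw
  have w5 : w 5 = (13 * α - 24) / (-24 - 6 * q * s - 4 * α * (s + q)) *
      ((3 * s + 2 * α) / (3 * (s - q)) * (1 / (1 - q))) := by
    simp [hw, Shifts.weight, e, weight₂, weight₃, mul_assoc]
  have w7 : w 7 = (13 * α - 24) / (-24 - 6 * q * s - 4 * α * (s + q)) *
      ((3 * q + 2 * α) / (3 * (q - s)) * (1 / (1 - s))) := by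
    simp [hw, Shifts.weight, e, weight₂, weight₃, mul_assoc]
  simp only [Fin.sum_univ_eight, Shifts.shift, Matrix.cons_val] at m0 m1 m2 ⊢
  push_cast at m0 m1 m2
  rcases le_or_gt 0 q with h | h
  · have hq2 : 2 ≤ q := by rwa [abs_of_nonneg h] at hq
    have hs0 : s < 0 := by nlinarith
    have hs2 : 2 ≤ -s := by rwa [abs_of_neg hs0] at hs
    have h4 : 4 < q + -s := by
      by_contra hc
      exact hne (by ext <;> simp <;> omega)
    have hq' : (2 : ℝ) ≤ q := by exact_mod_cast hq2
    have hs' : (2 : ℝ) ≤ -s := by exact_mod_cast hs2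
    have key := re_symbol_nonpos_of_family h1 h2 hq2 hs2 h4
      (W₁ := w 0 + w 2 + w 4 + w 6) (W₂ := w 1) (W₃ := w 3) (W₄ := w 5) (W₅ := w 7)
      (Δ := (-24 - 6 * q * s - 4 * α * (s + q)) / 6)
      (by linarith) (by push_cast; linarith) (by push_cast; linarith) (by push_cast; ring)
      (by simpa using hden) ?_ ?_ hζ
    · convert key using 3
      push_cast
      simp [zpow_ofNat]
      ring
    · rw [w5]
      push_cast
      rw [mul_div_cancel₀ _ (by norm_num : (6 : ℝ) ≠ 0), ← mul_neg]
      congr 1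
      have : (1 : ℝ) - q ≠ 0 := by linarith
      have : (q : ℝ) - 1 ≠ 0 := by linarith
      have : -(s : ℝ) + q ≠ 0 := by linarith
      field_simp
      ring
    · rw [w7]
      push_cast
      rw [mul_div_cancel₀ _ (by norm_num : (6 : ℝ) ≠ 0)]
      congr 1
      have : (1 : ℝ) - s ≠ 0 := by linarith
      have : -(s : ℝ) + 1 ≠ 0 := by linarith
      have : -(s : ℝ) + q ≠ 0 := by linarith
      have : (q : ℝ) - s ≠ 0 := by linarith
      field_simp
      ring
  · have hs2 : 2 ≤ -q := by rwa [abs_of_neg h] at hq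
    have hs0 : 0 < s := by nlinarith
    have hq2 : 2 ≤ s := by rwa [abs_of_pos hs0] at hs
    have h4 : 4 < s + -q := by
      by_contra hc
      -- The pair `(q, s) = (-2, 2)` is admitted by the list of shifts; only nondegeneracy excludes
      -- it, since the denominator vanishes there.
      obtain rfl : s = 2 := by omega
      obtain rfl : q = -2 := by omega
      apply hden
      norm_num
    have hq' : (2 : ℝ) ≤ s := by exact_mod_cast hq2
    have hs' : (2 : ℝ) ≤ -q := by exact_mod_cast hs2
    have key := re_symbol_nonpos_of_family h1 h2 hq2 hs2 h4
      (W₁ := w 0 + w 2 + w 4 + w 6) (W₂ := w 1) (W₃ := w 3) (W₄ := w 7) (W₅ := w 5)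
      (Δ := (-24 - 6 * q * s - 4 * α * (s + q)) / 6)
      (by linarith) (by push_cast; linarith) (by push_cast; linarith) (by push_cast; ring)
      (by simpa using hden) ?_ ?_ hζ
    · convert key using 3
      push_cast
      simp [zpow_ofNat]
      ring
    · rw [w7]
      push_cast
      rw [mul_div_cancel₀ _ (by norm_num : (6 : ℝ) ≠ 0), ← mul_neg]
      congr 1
      have : (1 : ℝ) - s ≠ 0 := by linarith
      have : (s : ℝ) - 1 ≠ 0 := by linarith
      have : -(q : ℝ) + s ≠ 0 := by linarith
      have : (q : ℝ) - s ≠ 0 := by linarith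
      field_simp
      ring
    · rw [w5]
      push_cast
      rw [mul_div_cancel₀ _ (by norm_num : (6 : ℝ) ≠ 0)]
      congr 1
      have : (1 : ℝ) - q ≠ 0 := by linarith
      have : -(q : ℝ) + 1 ≠ 0 := by linarith
      have : -(q : ℝ) + s ≠ 0 := by linarith
      field_simp
      ring

end WSLD

namespace WSLD

/-! ### The quadratic form of the difference matrices -/

theorem norm_exp_ofReal_mul_I_zpow (θ : ℝ) (n : ℤ) : ‖Complex.exp (θ * Complex.I) ^ n‖ = 1 := by
  rw [norm_zpow, Complex.norm_exp_ofReal_mul_I, one_zpow]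

theorem integral_exp_zpow (n : ℤ) :
    ∫ θ in (0 : ℝ)..2 * Real.pi, Complex.exp (θ * Complex.I) ^ n =
      if n = 0 then 2 * (Real.pi : ℂ) else 0 := by
  split_ifs with h
  · subst h
    simp
  · have hc : (n : ℂ) * Complex.I ≠ 0 := mul_ne_zero (by exact_mod_cast h) Complex.I_ne_zero
    have e : ∀ θ : ℝ, Complex.exp (θ * Complex.I) ^ n = Complex.exp ((n * Complex.I) * θ) := by
      intro θ
      rw [← Complex.exp_int_mul]
      congr 1
      ring
    simp only [e]
    rw [integral_exp_mul_complex hc]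
    have : (n : ℂ) * Complex.I * ((2 * Real.pi : ℝ) : ℂ) = n * (2 * Real.pi * Complex.I) := by
      push_cast; ring
    rw [this, Complex.exp_int_mul_two_pi_mul_I]
    simp

theorem continuous_exp_zpow (n : ℤ) :
    Continuous fun θ : ℝ => Complex.exp (θ * Complex.I) ^ n := by
  refine Continuous.zpow₀ (by fun_prop) n fun _ => Or.inl (Complex.exp_ne_zero _)

theorem symBase_cpow_eq_tsum {α : ℝ} (h1 : 1 < α) (h2 : α < 2) (θ : ℝ) :
    symBase (Complex.exp (θ * Complex.I)) ^ (α : ℂ) =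
      ∑' k : ℕ, (lubich α k : ℂ) * Complex.exp (θ * Complex.I) ^ (k : ℤ) := by
  have h := (hasSum_lubich h1 h2 (Complex.norm_exp_ofReal_mul_I θ).le).tsum_eq
  simpa using h.symm

theorem norm_lubich_mul_exp (α θ : ℝ) (k : ℕ) :
    ‖(lubich α k : ℂ) * Complex.exp (θ * Complex.I) ^ (k : ℤ)‖ = |lubich α k| := by
  rw [norm_mul, norm_exp_ofReal_mul_I_zpow, mul_one, Complex.norm_real, Real.norm_eq_abs]

theorem continuous_symBase_cpow {α : ℝ} (h1 : 1 < α) (h2 : α < 2) :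
    Continuous fun θ : ℝ => symBase (Complex.exp (θ * Complex.I)) ^ (α : ℂ) := by
  simp only [symBase_cpow_eq_tsum h1 h2]
  exact continuous_tsum (fun k => continuous_const.mul (continuous_exp_zpow _))
    (summable_lubich h1 h2) fun k θ => (norm_lubich_mul_exp α θ k).le

theorem integral_symBase_cpow_mul {α : ℝ} (h1 : 1 < α) (h2 : α < 2) (n : ℤ) :
    ∫ θ in (0 : ℝ)..2 * Real.pi, symBase (Complex.exp (θ * Complex.I)) ^ (α : ℂ) *
      Complex.exp (θ * Complex.I) ^ (-n) = 2 * Real.pi * lubichZ α n := by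
  have hp : (0 : ℝ) ≤ 2 * Real.pi := by positivity
  set F : ℕ → ℝ → ℂ := fun k θ => (lubich α k : ℂ) * Complex.exp (θ * Complex.I) ^ ((k : ℤ) - n)
    with hF
  have hFc : ∀ k, Continuous (F k) := fun k => continuous_const.mul (continuous_exp_zpow _)
  have hFn : ∀ k θ, ‖F k θ‖ = |lubich α k| := by
    intro k θ
    rw [hF, norm_mul, norm_exp_ofReal_mul_I_zpow, mul_one, Complex.norm_real, Real.norm_eq_abs]
  have hs := hasSum_integral_of_summable_integral_norm (F := F)
    (μ := volume.restrict (Ioc 0 (2 * Real.pi))) (fun k => (hFc k).integrableOn_Ioc) (by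
      simp only [hFn]
      simpa using (summable_lubich h1 h2).mul_left (max (2 * Real.pi) 0))
  rw [intervalIntegral.integral_of_le hp]
  have e : ∀ θ : ℝ, symBase (Complex.exp (θ * Complex.I)) ^ (α : ℂ) *
      Complex.exp (θ * Complex.I) ^ (-n) = ∑' k, F k θ := by
    intro θ
    rw [symBase_cpow_eq_tsum h1 h2, ← tsum_mul_right]
    refine tsum_congr fun k => ?_
    rw [mul_assoc, ← zpow_add₀ (Complex.exp_ne_zero _), ← sub_eq_add_neg]
  simp only [e]
  rw [← hs.tsum_eq]
  have e2 : ∀ k, ∫ θ in Ioc 0 (2 * Real.pi), F k θ =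
      if (k : ℤ) = n then (lubich α k : ℂ) * (2 * Real.pi) else 0 := by
    intro k
    rw [← intervalIntegral.integral_of_le hp, hF]
    simp only
    rw [intervalIntegral.integral_const_mul, integral_exp_zpow]
    simp only [sub_eq_zero]
    split_ifs <;> simp
  simp only [e2]
  rw [lubichZ]
  split_ifs with hn
  · have : ∀ k : ℕ, (k : ℤ) ≠ n := fun k => by omega
    simp [this]
  · rw [tsum_eq_single n.toNat]
    · rw [if_pos (by omega)]
      ring
    · intro k hk
      rw [if_neg (by omega)]

/-- The numerical range of a stable Toeplitz matrix lies in the left half line. -/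
theorem IsStableFourthOrder.sum_mul_lubichZ_nonpos {α : ℝ} (h1 : 1 < α) (h2 : α < 2) {ι : Type*}
    [Fintype ι] {w : ι → ℝ} {sh : ι → ℤ} (h : IsStableFourthOrder α w sh) {n : ℕ}
    (v : Fin n → ℝ) :
    ∑ i : Fin n, ∑ j : Fin n, v i * v j * ∑ l, w l * lubichZ α (sh l + (i : ℤ) - (j : ℤ)) ≤ 0 := by
  set Z : ℝ → ℂ := fun θ => Complex.exp (θ * Complex.I) with hZ
  have hZ0 : ∀ θ, Z θ ≠ 0 := fun θ => Complex.exp_ne_zero _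
  set G : ℝ → ℂ := fun θ => ∑ i : Fin n, ∑ j : Fin n, ∑ l, ((v i * v j * w l : ℝ) : ℂ) *
    (symBase (Z θ) ^ (α : ℂ) * Z θ ^ (-(sh l + (i : ℤ) - (j : ℤ)))) with hG
  have hc : ∀ m : ℤ, Continuous fun θ => symBase (Z θ) ^ (α : ℂ) * Z θ ^ (-m) := fun m =>
    (continuous_symBase_cpow h1 h2).mul (continuous_exp_zpow _)
  have hGc : Continuous G := by
    refine continuous_finsetSum _ fun i _ => continuous_finsetSum _ fun j _ =>
      continuous_finsetSum _ fun l _ => continuous_const.mul (hc _)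
  have hint : ∫ θ in (0 : ℝ)..2 * Real.pi, G θ = ((2 * Real.pi * (∑ i : Fin n, ∑ j : Fin n,
      v i * v j * ∑ l, w l * lubichZ α (sh l + (i : ℤ) - (j : ℤ))) : ℝ) : ℂ) := by
    rw [hG]
    rw [intervalIntegral.integral_finsetSum]
    swap
    · intro i _
      exact (continuous_finsetSum _ fun j _ => continuous_finsetSum _ fun l _ =>
        continuous_const.mul (hc _)).intervalIntegrable _ _
    push_cast
    rw [Finset.mul_sum]
    refine Finset.sum_congr rfl fun i _ => ?_
    rw [intervalIntegral.integral_finsetSum]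
    swap
    · intro j _
      exact (continuous_finsetSum _ fun l _ =>
        continuous_const.mul (hc _)).intervalIntegrable _ _
    rw [Finset.mul_sum]
    refine Finset.sum_congr rfl fun j _ => ?_
    rw [intervalIntegral.integral_finsetSum]
    swap
    · intro l _
      exact (continuous_const.mul (hc _)).intervalIntegrable _ _
    rw [Finset.mul_sum, Finset.mul_sum]
    refine Finset.sum_congr rfl fun l _ => ?_
    rw [intervalIntegral.integral_const_mul, integral_symBase_cpow_mul h1 h2]
    ring
  have hre : ∀ θ, (G θ).re ≤ 0 := by
    intro θ
    have hn : ‖Z θ‖ = 1 := Complex.norm_exp_ofReal_mul_I θ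
    -- The Toeplitz structure makes the double sum the symbol times `|∑ v_j e^{ijθ}|²`.
    have e : G θ = (symBase (Z θ) ^ (α : ℂ) * ∑ l, (w l : ℂ) * (Z θ)⁻¹ ^ sh l) *
        ((‖∑ j : Fin n, (v j : ℂ) * Z θ ^ (j : ℕ)‖ ^ 2 : ℝ) : ℂ) := by
      have e1 : ((‖∑ j : Fin n, (v j : ℂ) * Z θ ^ (j : ℕ)‖ ^ 2 : ℝ) : ℂ) =
          (∑ i : Fin n, (v i : ℂ) * (Z θ)⁻¹ ^ (i : ℕ)) *
            (∑ j : Fin n, (v j : ℂ) * Z θ ^ (j : ℕ)) := by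
        rw [Complex.ofReal_pow, ← Complex.conj_mul', map_sum]
        congr 1
        refine Finset.sum_congr rfl fun i _ => ?_
        rw [map_mul, map_pow, Complex.conj_ofReal, Complex.inv_def, Complex.normSq_eq_norm_sq, hn]
        simp
      rw [e1, hG, Finset.sum_mul_sum, Finset.mul_sum]
      refine Finset.sum_congr rfl fun i _ => ?_
      rw [Finset.mul_sum]
      refine Finset.sum_congr rfl fun j _ => ?_
      rw [Finset.mul_sum, Finset.sum_mul]
      refine Finset.sum_congr rfl fun l _ => ?_
      rw [show -(sh l + (i : ℤ) - (j : ℤ)) = -sh l + -(i : ℤ) + (j : ℤ) by ring,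
        zpow_add₀ (hZ0 θ), zpow_add₀ (hZ0 θ), inv_zpow', inv_pow, zpow_neg, zpow_neg, zpow_natCast,
        zpow_natCast]
      push_cast
      ring
    rw [e, Complex.re_mul_ofReal]
    exact mul_nonpos_of_nonpos_of_nonneg (h.re_symbol_nonpos _ hn) (by positivity)
  have hI : (∫ θ in (0 : ℝ)..2 * Real.pi, G θ).re ≤ 0 := by
    rw [intervalIntegral.integral_of_le (by positivity), ← RCLike.re_eq_complex_re, ← integral_re]
    · exact integral_nonpos fun θ => hre θ
    · exact hGc.integrableOn_Ioc
  rw [hint, Complex.ofReal_re] at hI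
  have : (0 : ℝ) < 2 * Real.pi := by positivity
  by_contra hcon
  push Not at hcon
  have := mul_pos this hcon
  linarith

theorem dotProduct_A4_mulVec_nonpos {α : ℝ} (h1 : 1 < α) (h2 : α < 2) {P : Shifts}
    (h : IsStableFourthOrder α (P.weight α) P.shift) {n : ℕ} (v : Fin n → ℝ) :
    v ⬝ᵥ (A4 α P n *ᵥ v) ≤ 0 := by
  refine le_of_eq_of_le ?_ (h.sum_mul_lubichZ_nonpos h1 h2 v)
  rw [dotProduct]
  refine Finset.sum_congr rfl fun i _ => ?_
  rw [Matrix.mulVec, dotProduct, Finset.mul_sum]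
  refine Finset.sum_congr rfl fun j _ => ?_
  rw [A4_eq_sum, Matrix.sum_apply]
  simp only [Matrix.smul_apply, A1, Matrix.of_apply, smul_eq_mul]
  ring

/-- A matrix and its transpose have the same real quadratic form, so this one is `1 + κ` times that
of `A4`. -/
theorem dotProduct_A4_add_transpose_nonpos {α κ : ℝ} (h1 : 1 < α) (h2 : α < 2) (hκ : 0 ≤ κ)
    {P : Shifts} (h : IsStableFourthOrder α (P.weight α) P.shift) {n : ℕ} (v : Fin n → ℝ) :
    v ⬝ᵥ ((A4 α P n + κ • (A4 α P n)ᵀ) *ᵥ v) ≤ 0 := by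
  have k := dotProduct_A4_mulVec_nonpos h1 h2 h v
  rw [Matrix.add_mulVec, Matrix.smul_mulVec, dotProduct_add, dotProduct_smul,
    Matrix.mulVec_transpose, dotProduct_comm v (v ᵥ* _), ← Matrix.dotProduct_mulVec, smul_eq_mul]
  nlinarith

/-! ### Kronecker products with the identity, acting in one index. -/

theorem one_kronecker_mulVec {m n : Type*} [Fintype m] [Fintype n] [DecidableEq m]
    (A : Matrix n n ℝ) (v : m × n → ℝ) (k : m × n) :
    (((1 : Matrix m m ℝ) ⊗ₖ A) *ᵥ v) k = (A *ᵥ fun i => v (k.1, i)) k.2 := by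
  simp only [Matrix.mulVec, dotProduct, Fintype.sum_prod_type, Matrix.kroneckerMap_apply]
  rw [Finset.sum_eq_single k.1]
  · simp
  · intro b _ hb
    simp [Matrix.one_apply_ne hb.symm]
  · simp

theorem kronecker_one_mulVec {m n : Type*} [Fintype m] [Fintype n] [DecidableEq n]
    (A : Matrix m m ℝ) (v : m × n → ℝ) (k : m × n) :
    ((A ⊗ₖ (1 : Matrix n n ℝ)) *ᵥ v) k = (A *ᵥ fun j => v (j, k.2)) k.1 := by
  simp only [Matrix.mulVec, dotProduct, Fintype.sum_prod_type, Matrix.kroneckerMap_apply]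
  refine Finset.sum_congr rfl fun j _ => ?_
  rw [Finset.sum_eq_single k.2]
  · simp
  · intro b _ hb
    simp [Matrix.one_apply_ne hb.symm]
  · simp

theorem dotProduct_one_kronecker_nonpos {m n : Type*} [Fintype m] [Fintype n] [DecidableEq m]
    {A : Matrix n n ℝ} (hA : ∀ v, v ⬝ᵥ (A *ᵥ v) ≤ 0) (v : m × n → ℝ) :
    v ⬝ᵥ (((1 : Matrix m m ℝ) ⊗ₖ A) *ᵥ v) ≤ 0 := by
  rw [dotProduct, Fintype.sum_prod_type]
  refine Finset.sum_nonpos fun j _ => ?_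
  simp only [one_kronecker_mulVec]
  exact hA fun i => v (j, i)

theorem dotProduct_kronecker_one_nonpos {m n : Type*} [Fintype m] [Fintype n] [DecidableEq n]
    {A : Matrix m m ℝ} (hA : ∀ v, v ⬝ᵥ (A *ᵥ v) ≤ 0) (v : m × n → ℝ) :
    v ⬝ᵥ ((A ⊗ₖ (1 : Matrix n n ℝ)) *ᵥ v) ≤ 0 := by
  rw [dotProduct, Fintype.sum_prod_type_right]
  refine Finset.sum_nonpos fun i _ => ?_
  simp only [kronecker_one_mulVec]
  exact hA fun j => v (j, i)

end WSLD

namespace WSLD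

open Asymptotics Topology

/-! ### The symbol of the fourth order difference operator -/

/-- The symbol `∑ l, w l * exp (-i sh l θ) * P(exp (i θ))^α`. -/
noncomputable def symbol {ι : Type*} [Fintype ι] (α : ℝ) (w : ι → ℝ) (sh : ι → ℤ) (θ : ℝ) : ℂ :=
  symBase (Complex.exp (θ * Complex.I)) ^ (α : ℂ) *
    ∑ l, (w l : ℂ) * Complex.exp (θ * Complex.I) ^ (-sh l)

theorem isBigO_exp_taylor (c : ℂ) (n : ℕ) :
    (fun z : ℂ => Complex.exp (c * z) - ∑ m ∈ Finset.range n, (c * z) ^ m / m.factorial)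
      =O[𝓝 0] fun z => z ^ n := by
  refine IsBigO.of_bound (‖c‖ ^ n * Real.exp ‖c‖) ?_
  filter_upwards [Metric.ball_mem_nhds (0 : ℂ) one_pos] with z hz
  rw [mem_ball_zero_iff] at hz
  refine (Complex.norm_exp_sub_sum_le_norm_mul_exp _ _).trans ?_
  have h : ‖c * z‖ ≤ ‖c‖ := by
    rw [norm_mul]; nlinarith [norm_nonneg c]
  rw [norm_mul, mul_pow, norm_pow]
  rw [norm_mul] at h
  calc ‖c‖ ^ n * ‖z‖ ^ n * Real.exp (‖c‖ * ‖z‖) ≤ ‖c‖ ^ n * ‖z‖ ^ n * Real.exp ‖c‖ := by gcongr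
    _ = _ := by ring

/-- The slope of an analytic function is again analytic at the base point, so its increment supplies
a second factor `w`. -/
theorem isBigO_one_add_cpow (α : ℂ) :
    (fun w : ℂ => (1 + w) ^ α - (1 + α * w)) =O[𝓝 0] fun w => w ^ 2 := by
  set f : ℂ → ℂ := fun w => (1 + w) ^ α with hf
  have hfa : AnalyticAt ℂ f 0 := by
    refine AnalyticAt.cpow (by fun_prop) (by fun_prop) (by simp)
  have hd : HasDerivAt f α 0 := by
    have := ((hasDerivAt_id (0 : ℂ)).const_add 1).cpow_const (c := α) (by simp)
    simpa using this
  obtain ⟨p, hp⟩ := hfa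
  have hg : DifferentiableAt ℂ (dslope f 0) 0 :=
    hp.has_fpower_series_dslope_fslope.analyticAt.differentiableAt
  have key := (isBigO_refl (fun w : ℂ => w) (𝓝 0)).mul hg.isBigO_sub
  refine key.congr (fun w => ?_) (fun w => by ring)
  have h1 := sub_smul_dslope f 0 w
  rw [dslope_same, hd.deriv]
  have h0 : f 0 = 1 := by simp [hf]
  rw [h0, smul_eq_mul, sub_zero] at h1
  rw [mul_sub, h1]
  ring

/-- The witness is the quotient `P(e^{-z})/z`. Division by zero returns zero, so the formula gives
`m 0 = 1` and needs no case distinction. -/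
theorem exists_symBase_factor : ∃ m : ℂ → ℂ, (∀ z, symBase (Complex.exp (-z)) = z * m z) ∧
    (fun z => m z - (1 - z ^ 2 / 3 + z ^ 3 / 4)) =O[𝓝 0] fun z => z ^ 4 := by
  set r : ℂ → ℂ := fun z => symBase (Complex.exp (-z)) - z * (1 - z ^ 2 / 3 + z ^ 3 / 4) with hr
  have hrO : r =O[𝓝 0] fun z => z ^ 5 := by
    have h1 := (isBigO_exp_taylor (-1) 5).const_mul_left (-2)
    have h2 := (isBigO_exp_taylor (-2) 5).const_mul_left (1 / 2)
    refine (h1.add h2).congr_left fun z => ?_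
    have : Complex.exp (-2 * z) = Complex.exp (-z) ^ 2 := by
      rw [← Complex.exp_nat_mul]; congr 1; push_cast; ring
    simp only [this, hr, symBase, Finset.sum_range_succ, Finset.sum_range_zero, Nat.factorial]
    push_cast
    rw [neg_one_mul]
    ring
  refine ⟨fun z => 1 - z ^ 2 / 3 + z ^ 3 / 4 + r z / z, fun z => ?_, ?_⟩
  · by_cases hz : z = 0
    · simp [hz, symBase]
    · rw [hr]; field_simp; ring
  · refine ((hrO.mul (isBigO_refl (fun z : ℂ => z⁻¹) (𝓝 0)))).congr (fun z => ?_) (fun z => ?_)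
    · ring
    · by_cases hz : z = 0
      · simp [hz]
      · field_simp

/-- The exponential sum times the power of the factor is `1 + O(z⁴)`. -/
theorem IsStableFourthOrder.isBigO_factor {α : ℝ} {ι : Type*}
    [Fintype ι] {w : ι → ℝ} {sh : ι → ℤ} (h : IsStableFourthOrder α w sh) {m : ℂ → ℂ}
    (hm : (fun z => m z - (1 - z ^ 2 / 3 + z ^ 3 / 4)) =O[𝓝 0] fun z => z ^ 4) :
    (fun z => m z ^ (α : ℂ) * ∑ l, (w l : ℂ) * Complex.exp (sh l * z) - 1)
      =O[𝓝 0] fun z => z ^ 4 := by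
  have hpow : ∀ {i j : ℕ}, i ≤ j → (fun z : ℂ => z ^ j) =O[𝓝 0] fun z => z ^ i := by
    intro i j hij
    obtain ⟨k, rfl⟩ := Nat.exists_eq_add_of_le hij
    have h1 : (fun z : ℂ => z ^ k) =O[𝓝 0] fun _ => (1 : ℂ) :=
      ((continuous_pow k).tendsto 0).isBigO_one ℂ
    exact ((isBigO_refl (fun z : ℂ => z ^ i) _).mul h1).congr (fun z => (pow_add _ _ _).symm)
      (fun z => mul_one _)
  have hw : (fun z => m z - 1) =O[𝓝 0] fun z => z ^ 2 := by
    have h1 : (fun z : ℂ => z ^ 2 * (-1 / 3) + z ^ 3 * (1 / 4)) =O[𝓝 0] fun z => z ^ 2 :=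
      (((isBigO_refl _ _).const_mul_left (-1 / 3)).congr_left fun z => mul_comm _ _).add
        (((hpow (by norm_num)).const_mul_left (1 / 4)).congr_left fun z => mul_comm _ _)
    refine ((hm.trans (hpow (by norm_num))).add h1).congr_left fun z => by ring
  have hw0 : Filter.Tendsto (fun z => m z - 1) (𝓝 0) (𝓝 0) :=
    hw.trans_tendsto (by simpa using (continuous_pow 2).tendsto (0 : ℂ))
  have hp : (fun z => m z ^ (α : ℂ) - (1 + α * (-z ^ 2 / 3 + z ^ 3 / 4))) =O[𝓝 0]
      fun z => z ^ 4 := by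
    have h1 := ((isBigO_one_add_cpow (α : ℂ)).comp_tendsto hw0).trans
      ((hw.pow 2).congr_right fun z => by rw [← pow_mul])
    have h2 := hm.const_mul_left (α : ℂ)
    refine (h1.add h2).congr_left fun z => ?_
    simp only [Function.comp]
    rw [add_sub_cancel]
    ring
  -- The moments are designed for this expansion: the terms of order 2 and 3 are opposite to those
  -- of `m z ^ α`.
  have hs : (fun z => (∑ l, (w l : ℂ) * Complex.exp (sh l * z)) -
      (1 + α * (z ^ 2 / 3 - z ^ 3 / 4))) =O[𝓝 0] fun z => z ^ 4 := by
    have h1 : (fun z => ∑ l, (w l : ℂ) * (Complex.exp (sh l * z) -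
        ∑ n ∈ Finset.range 4, (sh l * z) ^ n / n.factorial)) =O[𝓝 0] fun z : ℂ => z ^ 4 :=
      IsBigO.fun_sum fun l _ => (isBigO_exp_taylor _ 4).const_mul_left _
    refine h1.congr_left fun z => ?_
    have m0 : ∑ l, (w l : ℂ) = 1 := by exact_mod_cast congrArg (Complex.ofReal) h.sum_eq
    have m1 : ∑ l, (w l : ℂ) * (sh l : ℂ) = 0 := by
      exact_mod_cast congrArg (Complex.ofReal) h.sum_mul
    have m2 : ∑ l, (w l : ℂ) * (sh l : ℂ) ^ 2 = 2 * α / 3 := by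
      exact_mod_cast congrArg (Complex.ofReal) h.sum_mul_sq
    have m3 : ∑ l, (w l : ℂ) * (sh l : ℂ) ^ 3 = -(3 * α / 2) := by
      exact_mod_cast congrArg (Complex.ofReal) h.sum_mul_cube
    have e : ∑ l, (w l : ℂ) * (∑ n ∈ Finset.range 4, (sh l * z) ^ n / n.factorial) =
        (∑ l, (w l : ℂ)) + (∑ l, (w l : ℂ) * (sh l : ℂ)) * z +
        (∑ l, (w l : ℂ) * (sh l : ℂ) ^ 2) * (z ^ 2 / 2) +
        (∑ l, (w l : ℂ) * (sh l : ℂ) ^ 3) * (z ^ 3 / 6) := by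
      simp only [Finset.sum_mul, ← Finset.sum_add_distrib, Finset.sum_range_succ,
        Finset.sum_range_zero, Nat.factorial]
      refine Finset.sum_congr rfl fun l _ => ?_
      push_cast
      ring
    simp only [mul_sub, Finset.sum_sub_distrib]
    rw [e, m0, m1, m2, m3]
    ring
  have hp1 : (fun z : ℂ => 1 + (α : ℂ) * (-z ^ 2 / 3 + z ^ 3 / 4)) =O[𝓝 0] fun _ => (1 : ℂ) :=
    (Continuous.tendsto (by fun_prop) 0).isBigO_one ℂ
  have hsc : (fun z => ∑ l, (w l : ℂ) * Complex.exp (sh l * z)) =O[𝓝 0] fun _ => (1 : ℂ) :=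
    (Continuous.tendsto (by fun_prop) 0).isBigO_one ℂ
  have t1 := (hp.mul hsc).congr_right fun z => mul_one _
  have t2 := (hp1.mul hs).congr_right fun z => one_mul _
  -- With `a = α (z²/3 - z³/4)`, the leading parts multiply to `(1 - a)(1 + a) = 1 - a²`, and `a²`
  -- is already `O(z⁴)`.
  have t3 : (fun z : ℂ => z ^ 4 * (-(α : ℂ) ^ 2 * (1 / 3 - z / 4) ^ 2)) =O[𝓝 0]
      fun z => z ^ 4 := by
    have : (fun z : ℂ => (-(α : ℂ) ^ 2 * (1 / 3 - z / 4) ^ 2)) =O[𝓝 0] fun _ => (1 : ℂ) :=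
      (Continuous.tendsto (by fun_prop) 0).isBigO_one ℂ
    exact ((isBigO_refl (fun z : ℂ => z ^ 4) _).mul this).congr_right fun z => mul_one _
  refine ((t1.add t2).add t3).congr_left fun z => ?_
  ring

theorem norm_symbol_le {α : ℝ} (hα : 0 ≤ α) {ι : Type*} [Fintype ι] (w : ι → ℝ) (sh : ι → ℤ)
    (θ : ℝ) : ‖symbol α w sh θ‖ ≤ 4 ^ α * ∑ l, |w l| := by
  rw [symbol, norm_mul, Complex.norm_cpow_real]
  have hb : ‖symBase (Complex.exp (θ * Complex.I))‖ ≤ 4 := by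
    have hn := Complex.norm_exp_ofReal_mul_I θ
    rw [symBase, norm_div, norm_mul]
    have a1 : ‖1 - Complex.exp (θ * Complex.I)‖ ≤ 2 := by
      refine (norm_sub_le _ _).trans ?_
      rw [hn, norm_one]; norm_num
    have a2 : ‖3 - Complex.exp (θ * Complex.I)‖ ≤ 4 := by
      refine (norm_sub_le _ _).trans ?_
      rw [hn]; norm_num
    have : ‖(2 : ℂ)‖ = 2 := by norm_num
    rw [this, div_le_iff₀ (by norm_num)]
    nlinarith [norm_nonneg (1 - Complex.exp (θ * Complex.I)),
      norm_nonneg (3 - Complex.exp (θ * Complex.I))]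
  have hsum : ‖∑ l, (w l : ℂ) * Complex.exp (θ * Complex.I) ^ (-sh l)‖ ≤ ∑ l, |w l| := by
    refine (norm_sum_le _ _).trans (Finset.sum_le_sum fun l _ => ?_)
    rw [norm_mul, norm_exp_ofReal_mul_I_zpow, mul_one, Complex.norm_real, Real.norm_eq_abs]
  exact mul_le_mul (Real.rpow_le_rpow (norm_nonneg _) hb hα) hsum (norm_nonneg _)
    (by positivity)

/-- Fourth order consistency of the symbol. -/
theorem IsStableFourthOrder.exists_norm_symbol_sub_le {α : ℝ} (h1 : 1 < α) {ι : Type*}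
    [Fintype ι] {w : ι → ℝ} {sh : ι → ℤ} (h : IsStableFourthOrder α w sh) :
    ∃ C : ℝ, 0 ≤ C ∧ ∀ θ : ℝ, ‖symbol α w sh θ‖ ≤ C * |θ| ^ α ∧
      ‖symbol α w sh θ - (-(θ * Complex.I)) ^ (α : ℂ)‖ ≤ C * |θ| ^ (α + 4) := by
  have hα : 0 < α := by linarith
  obtain ⟨m, hm, hmO⟩ := exists_symBase_factor
  have hG := h.isBigO_factor hmO
  have hm1 : Filter.Tendsto m (𝓝 0) (𝓝 1) := by
    have : Filter.Tendsto (fun z => m z - (1 - z ^ 2 / 3 + z ^ 3 / 4)) (𝓝 0) (𝓝 0) :=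
      hmO.trans_tendsto (by simpa using (continuous_pow 4).tendsto (0 : ℂ))
    have h2 : Filter.Tendsto (fun z : ℂ => 1 - z ^ 2 / 3 + z ^ 3 / 4) (𝓝 0) (𝓝 1) := by
      have : Continuous fun z : ℂ => 1 - z ^ 2 / 3 + z ^ 3 / 4 := by fun_prop
      simpa using this.tendsto 0
    simpa using this.add h2
  have hre : ∀ᶠ z in 𝓝 (0 : ℂ), 0 < (m z).re := by
    have := (Complex.continuous_re.tendsto 1).comp hm1
    exact this.eventually (lt_mem_nhds (by simp))
  obtain ⟨C₀, hC₀⟩ := hG.bound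
  obtain ⟨δ, hδ, hball⟩ := Metric.eventually_nhds_iff.1 (hre.and hC₀)
  -- Near zero, `z = -iθ` is on the imaginary axis and `m z` in the right half plane, so `(z m)^α =
  -- z^α m^α` on the principal branch.
  have hnear : ∀ θ : ℝ, |θ| < δ →
      ‖symbol α w sh θ - (-(θ * Complex.I)) ^ (α : ℂ)‖ ≤ C₀ * |θ| ^ (α + 4) := by
    intro θ hθ
    set z : ℂ := -(θ * Complex.I) with hz
    have hzn : ‖z‖ = |θ| := by simp [hz]
    obtain ⟨k1, k2⟩ := hball (y := z) (by simpa [hzn] using hθ)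
    have e : symbol α w sh θ =
        z ^ (α : ℂ) * (m z ^ (α : ℂ) * ∑ l, (w l : ℂ) * Complex.exp (sh l * z)) := by
      have es : ∑ l, (w l : ℂ) * Complex.exp (-z) ^ (-sh l) =
          ∑ l, (w l : ℂ) * Complex.exp (sh l * z) := by
        refine Finset.sum_congr rfl fun l _ => ?_
        rw [← Complex.exp_int_mul]
        push_cast
        rw [neg_mul_neg]
      rw [symbol, show (θ * Complex.I : ℂ) = -z by rw [hz]; ring, es, hm,
        mul_cpow_of_re (by simp [hz]) k1, mul_assoc]
    rw [e]
    have : z ^ (α : ℂ) * (m z ^ (α : ℂ) * ∑ l, (w l : ℂ) * Complex.exp (sh l * z)) -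
        z ^ (α : ℂ) =
        z ^ (α : ℂ) * (m z ^ (α : ℂ) * (∑ l, (w l : ℂ) * Complex.exp (sh l * z)) - 1) := by ring
    rw [this, norm_mul, Complex.norm_cpow_real, hzn]
    rcases eq_or_ne θ 0 with h0 | h0
    · simp [h0, Real.zero_rpow hα.ne', Real.zero_rpow (by linarith : α + 4 ≠ 0)]
    rw [Real.rpow_add (abs_pos.2 h0)]
    rw [norm_pow, hzn] at k2
    have e4 : |θ| ^ (4 : ℝ) = |θ| ^ 4 := by exact_mod_cast Real.rpow_natCast |θ| 4
    rw [e4]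
    calc _ ≤ |θ| ^ α * (C₀ * |θ| ^ 4) := by gcongr
      _ = _ := by ring
  set M : ℝ := 4 ^ α * ∑ l, |w l| with hM
  have hM0 : 0 ≤ M := by positivity
  have hbd : ∀ θ : ℝ, ‖symbol α w sh θ‖ ≤ M := norm_symbol_le hα.le w sh
  -- Away from zero no cancellation is needed: the symbol is bounded, and constants are traded for
  -- powers of `|θ|/δ`.
  have hfar : ∀ θ : ℝ, δ ≤ |θ| → ‖symbol α w sh θ‖ ≤ M * (δ ^ α)⁻¹ * |θ| ^ α ∧
      |θ| ^ α ≤ (δ ^ 4)⁻¹ * |θ| ^ (α + 4) := by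
    intro θ hθ
    have h0 : 0 < |θ| := hδ.trans_le hθ
    constructor
    · refine (hbd θ).trans ?_
      rw [mul_assoc]
      refine le_mul_of_one_le_right hM0 ?_
      rw [inv_mul_eq_div, one_le_div (by positivity)]
      gcongr
    · have e4 : |θ| ^ (4 : ℝ) = |θ| ^ 4 := by exact_mod_cast Real.rpow_natCast |θ| 4
      rw [Real.rpow_add h0, e4, mul_left_comm]
      refine le_mul_of_one_le_right (by positivity) ?_
      rw [inv_mul_eq_div, one_le_div (by positivity)]
      gcongr
  have hnorm : ∀ θ : ℝ, ‖(-(θ * Complex.I)) ^ (α : ℂ)‖ = |θ| ^ α := by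
    intro θ
    rw [Complex.norm_cpow_real]
    simp
  set A := M * (δ ^ α)⁻¹ with hA
  have hA0 : 0 ≤ A := by positivity
  refine ⟨(|C₀| * δ ^ 4 + 1 + A) + (|C₀| + (A + 1) * (δ ^ 4)⁻¹), by positivity, fun θ => ?_⟩
  have p1 : 0 ≤ |C₀| * δ ^ 4 := by positivity
  have p2 : 0 ≤ (A + 1) * (δ ^ 4)⁻¹ := by positivity
  have p3 : 0 ≤ |C₀| := abs_nonneg _
  have q1 : 0 ≤ |θ| ^ α := by positivity
  have q2 : 0 ≤ |θ| ^ (α + 4) := by positivity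
  rcases lt_or_ge |θ| δ with hθ | hθ
  · have n1 : ‖symbol α w sh θ - (-(θ * Complex.I)) ^ (α : ℂ)‖ ≤ |C₀| * |θ| ^ (α + 4) :=
      (hnear θ hθ).trans (by gcongr; exact le_abs_self _)
    have n2 : |θ| ^ (α + 4) ≤ |θ| ^ α * δ ^ 4 := by
      rcases eq_or_ne θ 0 with h0 | h0
      · simp [h0, Real.zero_rpow hα.ne', Real.zero_rpow (by linarith : α + 4 ≠ 0)]
      have e4 : |θ| ^ (4 : ℝ) = |θ| ^ 4 := by exact_mod_cast Real.rpow_natCast |θ| 4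
      rw [Real.rpow_add (abs_pos.2 h0), e4]
      gcongr
    constructor
    · have := norm_le_norm_add_norm_sub' (symbol α w sh θ) ((-(θ * Complex.I)) ^ (α : ℂ))
      rw [hnorm] at this
      have n3 : |C₀| * |θ| ^ (α + 4) ≤ |C₀| * (|θ| ^ α * δ ^ 4) := by gcongr
      nlinarith [mul_nonneg hA0 q1, mul_nonneg p2 q1, mul_nonneg p3 q1]
    · nlinarith [mul_nonneg hA0 q2, mul_nonneg p2 q2, mul_nonneg p1 q2]
  · obtain ⟨f1, f2⟩ := hfar θ hθ
    constructor
    · nlinarith [mul_nonneg p1 q1, mul_nonneg p2 q1, mul_nonneg p3 q1]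
    · have := norm_sub_le (symbol α w sh θ) ((-(θ * Complex.I)) ^ (α : ℂ))
      rw [hnorm] at this
      have : (A + 1) * |θ| ^ α ≤ (A + 1) * ((δ ^ 4)⁻¹ * |θ| ^ (α + 4)) := by gcongr
      nlinarith [mul_nonneg p1 q2, mul_nonneg hA0 q2, mul_nonneg p3 q2]

end WSLD

namespace WSLD

open Filter Topology

/-! ### Riemann-Liouville derivatives of Fourier integrals -/

theorem integrable_rpow_mul_exp_neg {c r : ℝ} (hc : 0 < c) (hr : 0 < r) :
    IntegrableOn (fun s : ℝ => s ^ (c - 1) * Real.exp (-(r * s))) (Ioi 0) := by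
  have h := Real.GammaIntegral_convergent hc
  have h2 := (integrableOn_Ioi_comp_mul_left_iff
    (fun s : ℝ => Real.exp (-s) * s ^ (c - 1)) 0 hr).2 (by simpa using h)
  have h3 : IntegrableOn _ _ _ := h2.const_mul ((r ^ (c - 1))⁻¹)
  refine (h3.congr_fun (fun s hs => ?_) measurableSet_Ioi)
  have hs' : (0 : ℝ) < s := hs
  simp only
  rw [Real.mul_rpow hr.le hs'.le]
  have : r ^ (c - 1) ≠ 0 := (Real.rpow_pos_of_pos hr _).ne'
  field_simp

/-- The Gamma integral with a complex rate. -/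
theorem integral_rpow_mul_cexp_neg {c : ℝ} (hc : 0 < c) {z : ℂ} (hz : 0 < z.re) :
    ∫ s in Ioi (0 : ℝ), ((s ^ (c - 1) : ℝ) : ℂ) * Complex.exp (-(z * s)) =
      Real.Gamma c * z ^ (-(c : ℂ)) := by
  set F : ℂ → ℂ := fun z => ∫ s in Ioi (0 : ℝ), ((s ^ (c - 1) : ℝ) : ℂ) * Complex.exp (-(z * s))
    with hF
  set U : Set ℂ := {z | 0 < z.re} with hU
  have hUo : IsOpen U := isOpen_lt continuous_const Complex.continuous_re
  have hmeas : ∀ z : ℂ, AEStronglyMeasurable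
      (fun s : ℝ => ((s ^ (c - 1) : ℝ) : ℂ) * Complex.exp (-(z * s)))
      (volume.restrict (Ioi 0)) := by
    intro z
    refine Measurable.aestronglyMeasurable ?_
    fun_prop
  have hnorm : ∀ (z : ℂ) (s : ℝ), s ∈ Ioi (0 : ℝ) →
      ‖((s ^ (c - 1) : ℝ) : ℂ) * Complex.exp (-(z * s))‖ =
        s ^ (c - 1) * Real.exp (-(z.re * s)) := by
    intro z s hs
    rw [norm_mul, Complex.norm_real, Complex.norm_exp, Real.norm_of_nonneg
      (Real.rpow_nonneg (le_of_lt hs) _)]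
    simp
  have hint : ∀ z : ℂ, 0 < z.re → IntegrableOn
      (fun s : ℝ => ((s ^ (c - 1) : ℝ) : ℂ) * Complex.exp (-(z * s))) (Ioi 0) := by
    intro z hz
    refine (integrable_rpow_mul_exp_neg hc hz).mono' (hmeas z) ?_
    filter_upwards [ae_restrict_mem measurableSet_Ioi] with s hs
    exact (hnorm z s hs).le
  have hFd : DifferentiableOn ℂ F U := by
    intro z hz
    have hz' : 0 < z.re := hz
    refine DifferentiableAt.differentiableWithinAt ?_
    have := hasDerivAt_integral_of_dominated_loc_of_deriv_le (μ := volume.restrict (Ioi (0 : ℝ)))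
      (F := fun (z : ℂ) (s : ℝ) => ((s ^ (c - 1) : ℝ) : ℂ) * Complex.exp (-(z * s)))
      (F' := fun (z : ℂ) (s : ℝ) => ((s ^ (c - 1) : ℝ) : ℂ) * (Complex.exp (-(z * s)) * -(1 * s)))
      (x₀ := z) (s := {w : ℂ | z.re / 2 < w.re})
      (bound := fun s : ℝ => s ^ (c + 1 - 1) * Real.exp (-(z.re / 2 * s)))
      ((isOpen_lt continuous_const Complex.continuous_re).mem_nhds (by simp; linarith))
      (Eventually.of_forall hmeas) (hint z hz') ?_ ?_
      (integrable_rpow_mul_exp_neg (by linarith) (by linarith)) ?_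
    · exact this.2.differentiableAt
    · refine Measurable.aestronglyMeasurable ?_
      fun_prop
    · filter_upwards [ae_restrict_mem measurableSet_Ioi] with s hs w hw
      have hs' : (0 : ℝ) < s := hs
      have hw' : z.re / 2 < w.re := hw
      rw [← mul_assoc, norm_mul, hnorm w s hs, norm_neg, one_mul, Complex.norm_real,
        Real.norm_of_nonneg hs'.le]
      have e : s ^ (c + 1 - 1) = s ^ (c - 1) * s := by
        rw [← Real.rpow_add_one hs'.ne']; congr 1; ring
      rw [e]
      have : Real.exp (-(w.re * s)) ≤ Real.exp (-(z.re / 2 * s)) := by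
        apply Real.exp_le_exp.2
        nlinarith
      have h0 : 0 ≤ s ^ (c - 1) := Real.rpow_nonneg hs'.le _
      calc s ^ (c - 1) * Real.exp (-(w.re * s)) * s
          ≤ s ^ (c - 1) * Real.exp (-(z.re / 2 * s)) * s := by gcongr
        _ = _ := by ring
    · filter_upwards with s w _
      have h1 : HasDerivAt (fun w : ℂ => -(w * s)) (-(1 * s)) w :=
        ((hasDerivAt_id w).mul_const (s : ℂ)).neg
      exact h1.cexp.const_mul _
  have hGd : DifferentiableOn ℂ (fun z : ℂ => Real.Gamma c * z ^ (-(c : ℂ))) U := by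
    intro z hz
    refine DifferentiableAt.differentiableWithinAt ?_
    refine DifferentiableAt.const_mul (DifferentiableAt.cpow_const differentiableAt_id
      (Or.inl hz)) _
  have hconn : IsPreconnected U := (convex_halfSpace_re_gt 0).isPreconnected
  have hreal : ∀ r : ℝ, 0 < r → F r = Real.Gamma c * (r : ℂ) ^ (-(c : ℂ)) := by
    intro r hr
    have h := Real.integral_rpow_mul_exp_neg_mul_Ioi hc hr
    have e : F r = ((∫ s in Ioi (0 : ℝ), s ^ (c - 1) * Real.exp (-(r * s)) : ℝ) : ℂ) := by
      rw [← integral_complex_ofReal]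
      refine setIntegral_congr_fun measurableSet_Ioi fun s _ => ?_
      push_cast
      rfl
    rw [e, h, one_div, Real.inv_rpow hr.le, ← Real.rpow_neg hr.le]
    push_cast
    rw [Complex.ofReal_cpow hr.le]
    push_cast
    ring
  -- The identity theorem on the right half plane: both sides agree at the real points `1 +
  -- 1/(n+1)`, which accumulate at `1`.
  refine (hFd.analyticOnNhd hUo).eqOn_of_preconnected_of_frequently_eq
    (hGd.analyticOnNhd hUo) hconn (z₀ := 1) (by simp [hU]) ?_ hz
  have ht : Tendsto (fun n : ℕ => ((1 + 1 / ((n : ℝ) + 1) : ℝ) : ℂ)) atTop (𝓝[≠] 1) := by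
    refine tendsto_nhdsWithin_iff.2 ⟨?_, ?_⟩
    · have h1 : Tendsto (fun n : ℕ => (1 + 1 / ((n : ℝ) + 1) : ℝ)) atTop (𝓝 (1 + 0)) :=
        tendsto_const_nhds.add tendsto_one_div_add_atTop_nhds_zero_nat
      rw [add_zero] at h1
      exact (Complex.continuous_ofReal.tendsto 1).comp h1
    · refine Eventually.of_forall fun n => ?_
      have : (0 : ℝ) < 1 / ((n : ℝ) + 1) := by positivity
      simp only [mem_compl_iff, mem_singleton_iff]
      intro h
      have h' : (1 + 1 / ((n : ℝ) + 1) : ℝ) = 1 := by exact_mod_cast h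
      linarith
  exact ht.frequently (Frequently.of_forall fun n => hreal _ (by positivity))

/-- `v x = ∫ φ(ω) exp(-i k(ω) x) dμ(ω)` for all `x`. -/
structure FourierRep {Ω : Type*} [MeasurableSpace Ω] (μ : Measure Ω) (k : Ω → ℝ) (φ : Ω → ℂ)
    (v : ℝ → ℝ) : Prop where
  measurable : Measurable k
  integrable : Integrable φ μ
  eq : ∀ x, (v x : ℂ) = ∫ ω, φ ω * Complex.exp (-((k ω * x : ℝ) : ℂ) * Complex.I) ∂μ

variable {Ω : Type*} [MeasurableSpace Ω] {μ : Measure Ω} {k : Ω → ℝ} {φ : Ω → ℂ} {v : ℝ → ℝ}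

theorem norm_exp_neg_ofReal_mul_I (x : ℝ) : ‖Complex.exp (-(x : ℂ) * Complex.I)‖ = 1 := by
  have := Complex.norm_exp_ofReal_mul_I (-x)
  simpa using this

theorem integrable_mul_phase (hk : Measurable k) (hφ : Integrable φ μ) (x : ℝ) :
    Integrable (fun ω => φ ω * Complex.exp (-((k ω * x : ℝ) : ℂ) * Complex.I)) μ := by
  refine hφ.mul_bdd (c := 1) ?_ ?_
  · refine Measurable.aestronglyMeasurable ?_
    fun_prop
  · exact Eventually.of_forall fun ω => (norm_exp_neg_ofReal_mul_I _).le

theorem FourierRep.abs_le (h : FourierRep μ k φ v) (x : ℝ) : |v x| ≤ ∫ ω, ‖φ ω‖ ∂μ := by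
  have : |v x| = ‖(v x : ℂ)‖ := by rw [Complex.norm_real, Real.norm_eq_abs]
  rw [this, h.eq]
  refine (norm_integral_le_integral_norm _).trans (le_of_eq ?_)
  simp_rw [norm_mul, norm_exp_neg_ofReal_mul_I, mul_one]

theorem FourierRep.exists_hasDerivAt (h : FourierRep μ k φ v)
    (hkφ : Integrable (fun ω => (-(k ω * Complex.I)) * φ ω) μ) :
    ∃ v' : ℝ → ℝ, (∀ x, HasDerivAt v (v' x) x) ∧
      FourierRep μ k (fun ω => (-(k ω * Complex.I)) * φ ω) v' := by
  have hk := h.measurable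
  set V : ℝ → ℂ := fun x => ∫ ω, φ ω * Complex.exp (-((k ω * x : ℝ) : ℂ) * Complex.I) ∂μ with hV
  have hd : ∀ x, HasDerivAt V (∫ ω, (-(k ω * Complex.I)) * φ ω *
      Complex.exp (-((k ω * x : ℝ) : ℂ) * Complex.I) ∂μ) x := by
    intro x
    refine (hasDerivAt_integral_of_dominated_loc_of_deriv_le (s := univ)
      (F' := fun x ω => (-(k ω * Complex.I)) * φ ω *
        Complex.exp (-((k ω * x : ℝ) : ℂ) * Complex.I))
      (bound := fun ω => ‖(-(k ω * Complex.I)) * φ ω‖) univ_mem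
      (Eventually.of_forall fun y => (integrable_mul_phase hk h.integrable y).aestronglyMeasurable)
      (integrable_mul_phase hk h.integrable x)
      (integrable_mul_phase hk hkφ x).aestronglyMeasurable ?_ hkφ.norm ?_).2
    · refine Eventually.of_forall fun ω y _ => ?_
      rw [norm_mul, norm_exp_neg_ofReal_mul_I, mul_one]
    · refine Eventually.of_forall fun ω y _ => ?_
      have h1 : HasDerivAt (fun y : ℝ => -((k ω * y : ℝ) : ℂ) * Complex.I)
          (-(k ω * Complex.I)) y := by
        have := (((hasDerivAt_id y).const_mul (k ω)).ofReal_comp.neg).mul_const Complex.I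
        simpa using this
      have := (h1.cexp).const_mul (φ ω)
      refine this.congr_deriv ?_
      ring
  have hVv : V = fun x => (v x : ℂ) := funext fun x => (h.eq x).symm
  have hv : ∀ x, HasDerivAt v (deriv V x).re x := by
    intro x
    have h1 := Complex.reCLM.hasFDerivAt.comp_hasDerivAt x (hd x)
    rw [(hd x).deriv]
    refine h1.congr_of_eventuallyEq (Eventually.of_forall fun y => ?_)
    simp [hVv]
  refine ⟨fun x => (deriv V x).re, hv, hk, hkφ, fun x => ?_⟩
  rw [← (hd x).deriv]
  have h2 : HasDerivAt V ((deriv V x).re : ℂ) x := by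
    rw [hVv]
    simpa [hVv] using (hv x).ofReal_comp
  exact h2.unique ((hd x).differentiableAt.hasDerivAt)

theorem FourierRep.continuous (h : FourierRep μ k φ v) : Continuous v := by
  have hV : Continuous fun x : ℝ =>
      ∫ ω, φ ω * Complex.exp (-((k ω * x : ℝ) : ℂ) * Complex.I) ∂μ := by
    refine continuous_of_dominated (fun x =>
      (integrable_mul_phase h.measurable h.integrable x).aestronglyMeasurable)
      (bound := fun ω => ‖φ ω‖) (fun x => Eventually.of_forall fun ω => ?_) h.integrable.norm
      (Eventually.of_forall fun ω => by fun_prop)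
    rw [norm_mul, norm_exp_neg_ofReal_mul_I, mul_one]
  have : v = fun x => (∫ ω, φ ω * Complex.exp (-((k ω * x : ℝ) : ℂ) * Complex.I) ∂μ).re := by
    funext x
    rw [← h.eq, Complex.ofReal_re]
  rw [this]
  exact Complex.continuous_re.comp hV

/-- Differentiation of a convolution with an integrable kernel on a fixed interval. -/
theorem hasDerivAt_integral_kernel {K : ℝ → ℝ} {L : ℝ} (hK : IntervalIntegrable K volume 0 L)
    {v v' : ℝ → ℝ} (hv : ∀ x, HasDerivAt v (v' x) x) (hv' : Continuous v') {M : ℝ}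
    (hM : ∀ x, |v' x| ≤ M) (z : ℝ) :
    HasDerivAt (fun z => ∫ s in (0 : ℝ)..L, K s * v (z - s)) (∫ s in (0 : ℝ)..L, K s * v' (z - s))
      z := by
  have hvc : Continuous v := continuous_iff_continuousAt.2 fun x => (hv x).continuousAt
  refine (intervalIntegral.hasDerivAt_integral_of_dominated_loc_of_deriv_le (s := univ)
    (F' := fun z s => K s * v' (z - s)) (bound := fun s => ‖K s‖ * M) univ_mem ?_ ?_ ?_ ?_ ?_ ?_).2
  · refine Eventually.of_forall fun x => ?_
    have : IntervalIntegrable (fun s => K s * v (x - s)) volume 0 L :=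
      hK.mul_continuousOn (by fun_prop)
    exact this.def'.aestronglyMeasurable
  · exact hK.mul_continuousOn (by fun_prop)
  · have : IntervalIntegrable (fun s => K s * v' (z - s)) volume 0 L :=
      hK.mul_continuousOn (by fun_prop)
    exact this.def'.aestronglyMeasurable
  · refine Eventually.of_forall fun s _ x _ => ?_
    rw [norm_mul, Real.norm_eq_abs (v' _)]
    gcongr
    exact hM _
  · exact hK.norm.mul_const M
  · refine Eventually.of_forall fun s _ x _ => ?_
    have := (hv (x - s)).comp x ((hasDerivAt_id x).sub_const s)
    simpa using this.const_mul (K s)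

/-- For functions vanishing on the left of `a`, the two derivatives in the Riemann-Liouville
derivative may be moved under the integral. -/
theorem leftRL_eq_integral {α a : ℝ} (h1 : 1 < α) (h2 : α < 2) {v v' v'' : ℝ → ℝ}
    (hv : ∀ x, HasDerivAt v (v' x) x) (hv' : ∀ x, HasDerivAt v' (v'' x) x)
    (hc : Continuous v'') {M : ℝ} (hM' : ∀ x, |v' x| ≤ M) (hM'' : ∀ x, |v'' x| ≤ M)
    (h0 : ∀ x ≤ a, v x = 0) {x : ℝ} (hx : a < x) :
    leftRL α a v x = 1 / Real.Gamma (2 - α) *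
      ∫ s in Ioi (0 : ℝ), s ^ (1 - α) * v'' (x - s) := by
  set L : ℝ := x + 1 - a with hL
  have hK : IntervalIntegrable (fun s : ℝ => s ^ (1 - α)) volume 0 L :=
    intervalIntegral.intervalIntegrable_rpow' (by linarith)
  have hc' : Continuous v' := continuous_iff_continuousAt.2 fun x => (hv' x).continuousAt
  have hvc : Continuous v := continuous_iff_continuousAt.2 fun x => (hv x).continuousAt
  -- Substituting `s = z - ξ` and using `v (z - s) = 0` for `s ≥ z - a` gives a fixed interval of
  -- integration. Both derivatives then fall on `v`, not on the singular kernel or the endpoint.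
  have e1 : ∀ z ∈ Ioo a (x + 1), ∫ ξ in a..z, (z - ξ) ^ (1 - α) * v ξ =
      ∫ s in (0 : ℝ)..L, s ^ (1 - α) * v (z - s) := by
    intro z hz
    have i1 := intervalIntegral.integral_comp_sub_left
      (fun s : ℝ => s ^ (1 - α) * v (z - s)) (a := a) (b := z) z
    simp only [sub_sub_cancel, sub_self] at i1
    rw [i1]
    have hza : 0 ≤ z - a := by linarith [hz.1]
    have hzL : z - a ≤ L := by linarith [hz.2]
    have hi : ∀ p q : ℝ, IntervalIntegrable (fun s : ℝ => s ^ (1 - α) * v (z - s)) volume p q :=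
      fun p q => (intervalIntegral.intervalIntegrable_rpow' (by linarith)).mul_continuousOn
        (by fun_prop)
    rw [← intervalIntegral.integral_add_adjacent_intervals (hi 0 (z - a)) (hi (z - a) L)]
    rw [intervalIntegral.integral_congr (g := fun _ => (0 : ℝ)) (a := z - a)]
    · simp
    · intro s hs
      rw [uIcc_of_le hzL] at hs
      simp only
      rw [h0 _ (by linarith [hs.1]), mul_zero]
  have d1 := fun z => hasDerivAt_integral_kernel hK hv hc' hM' z
  have d2 := fun z => hasDerivAt_integral_kernel hK hv' hc hM'' z
  have hmem : Ioo a (x + 1) ∈ 𝓝 x := Ioo_mem_nhds hx (by linarith)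
  have e2 : deriv (fun z => ∫ ξ in a..z, (z - ξ) ^ (1 - α) * v ξ) =ᶠ[𝓝 x]
      fun z => ∫ s in (0 : ℝ)..L, s ^ (1 - α) * v' (z - s) := by
    have e1' : (fun z => ∫ ξ in a..z, (z - ξ) ^ (1 - α) * v ξ) =ᶠ[𝓝 x]
        fun z => ∫ s in (0 : ℝ)..L, s ^ (1 - α) * v (z - s) := by
      filter_upwards [hmem] with z hz using e1 z hz
    exact e1'.deriv.trans (Eventually.of_forall fun z => (d1 z).deriv)
  rw [leftRL, e2.deriv_eq, (d2 x).deriv]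
  congr 1
  have z1 : ∀ y < a, v' y = 0 := by
    intro y hy
    have : v =ᶠ[𝓝 y] fun _ => 0 := by
      filter_upwards [Iio_mem_nhds hy] with w hw using h0 w (le_of_lt hw)
    rw [← (hv y).deriv, this.deriv_eq, deriv_const]
  have z2 : ∀ y < a, v'' y = 0 := by
    intro y hy
    have : v' =ᶠ[𝓝 y] fun _ => 0 := by
      filter_upwards [Iio_mem_nhds hy] with w hw using z1 w hw
    rw [← (hv' y).deriv, this.deriv_eq, deriv_const]
  rw [intervalIntegral.integral_of_le (by rw [hL]; linarith)]
  refine (setIntegral_eq_of_subset_of_forall_sdiff_eq_zero measurableSet_Ioi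
    Ioc_subset_Ioi_self fun s hs => ?_).symm
  have : L < s := by
    by_contra hcon
    exact hs.2 ⟨hs.1, not_lt.1 hcon⟩
  rw [z2 _ (by linarith), mul_zero]

/-- Off `κ = 0` the exponents add up to `2 - (2 - α) = α`, and `-iκ` avoids the branch cut; at `κ =
0` both sides vanish. -/
theorem tendsto_damped {α κ : ℝ} (h1 : 1 < α) :
    Tendsto (fun ε : ℝ => (-(κ * Complex.I)) ^ 2 * ((ε : ℂ) - κ * Complex.I) ^ (-((2 - α : ℝ) : ℂ)))
      (𝓝[>] 0) (𝓝 ((-(κ * Complex.I)) ^ (α : ℂ))) := by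
  rcases eq_or_ne κ 0 with hk | hk
  · subst hk
    have : (α : ℂ) ≠ 0 := by exact_mod_cast (by linarith : α ≠ 0)
    simp [Complex.zero_cpow this]
  have hne : (-(κ * Complex.I) : ℂ) ≠ 0 := by
    simpa using hk
  have e : (-(κ * Complex.I) : ℂ) ^ (α : ℂ) = (-(κ * Complex.I)) ^ 2 *
      (((0 : ℝ) : ℂ) - κ * Complex.I) ^ (-((2 - α : ℝ) : ℂ)) := by
    rw [Complex.ofReal_zero, zero_sub, ← Complex.cpow_natCast, ← Complex.cpow_add _ _ hne]
    congr 1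
    push_cast
    ring
  rw [e]
  refine Tendsto.const_mul _ (Tendsto.mono_left ?_ nhdsWithin_le_nhds)
  have hc : ContinuousAt (fun ε : ℝ => ((ε : ℂ) - κ * Complex.I) ^ (-((2 - α : ℝ) : ℂ))) 0 := by
    refine ContinuousAt.cpow (by fun_prop) continuousAt_const ?_
    refine Or.inr ?_
    simpa using hk
  exact hc.tendsto

/-- `|ε - iκ| ≥ |κ|` and the exponent is negative, so the product is at most `|κ|^α`, uniformly in
`ε`. -/
theorem norm_damped_le {α κ ε : ℝ} (h1 : 1 < α) (h2 : α < 2) :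
    ‖(-(κ * Complex.I)) ^ 2 * ((ε : ℂ) - κ * Complex.I) ^ (-((2 - α : ℝ) : ℂ))‖ ≤
      (1 + |κ|) ^ 2 := by
  rcases eq_or_ne κ 0 with hk | hk
  · subst hk
    simp
  have hk' : 0 < |κ| := abs_pos.2 hk
  have hle : |κ| ≤ ‖(ε : ℂ) - κ * Complex.I‖ := by
    have := Complex.abs_im_le_norm ((ε : ℂ) - κ * Complex.I)
    simpa using this
  rw [norm_mul, ← Complex.ofReal_neg, Complex.norm_cpow_real, norm_pow]
  have e1 : ‖(-(κ * Complex.I) : ℂ)‖ = |κ| := by simp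
  rw [e1]
  have e2 : ‖(ε : ℂ) - κ * Complex.I‖ ^ (-(2 - α)) ≤ |κ| ^ (-(2 - α)) :=
    Real.rpow_le_rpow_of_nonpos hk' hle (by linarith)
  calc |κ| ^ 2 * ‖(ε : ℂ) - κ * Complex.I‖ ^ (-(2 - α)) ≤ |κ| ^ 2 * |κ| ^ (-(2 - α)) := by gcongr
    _ = |κ| ^ α := by
      rw [← Real.rpow_natCast, ← Real.rpow_add hk']
      congr 1
      push_cast
      ring
    _ ≤ (1 + |κ|) ^ α := by gcongr; linarith
    _ ≤ (1 + |κ|) ^ (2 : ℝ) := Real.rpow_le_rpow_of_exponent_le (by linarith) h2.le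
    _ = _ := by norm_cast

/-- The Riemann-Liouville derivative of a Fourier integral. -/
theorem FourierRep.leftRL_eq [SigmaFinite μ] {α a : ℝ} (h1 : 1 < α) (h2 : α < 2)
    (h : FourierRep μ k φ v) (hk2 : Integrable (fun ω => (1 + |k ω|) ^ 2 * ‖φ ω‖) μ)
    (h0 : ∀ x ≤ a, v x = 0) {x : ℝ} (hx : a < x) :
    (leftRL α a v x : ℂ) = ∫ ω, (-(k ω * Complex.I)) ^ (α : ℂ) * φ ω *
      Complex.exp (-((k ω * x : ℝ) : ℂ) * Complex.I) ∂μ := by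
  have hk := h.measurable
  have hφ1 : Integrable (fun ω => (-(k ω * Complex.I)) * φ ω) μ := by
    refine hk2.mono' ?_ (Eventually.of_forall fun ω => ?_)
    · exact (Measurable.aestronglyMeasurable (by fun_prop)).mul h.integrable.aestronglyMeasurable
    · rw [norm_mul]
      have : ‖(-(k ω * Complex.I) : ℂ)‖ = |k ω| := by simp
      rw [this]
      gcongr
      nlinarith [abs_nonneg (k ω)]
  have hφ2 : Integrable (fun ω => (-(k ω * Complex.I)) * ((-(k ω * Complex.I)) * φ ω)) μ := by
    refine hk2.mono' ?_ (Eventually.of_forall fun ω => ?_)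
    · exact (Measurable.aestronglyMeasurable (by fun_prop)).mul hφ1.aestronglyMeasurable
    · rw [norm_mul, norm_mul]
      have : ‖(-(k ω * Complex.I) : ℂ)‖ = |k ω| := by simp
      rw [this, ← mul_assoc]
      gcongr
      nlinarith [abs_nonneg (k ω)]
  obtain ⟨v', hv, hr1⟩ := h.exists_hasDerivAt hφ1
  obtain ⟨v'', hv', hr2⟩ := hr1.exists_hasDerivAt hφ2
  set ψ : Ω → ℂ := fun ω => (-(k ω * Complex.I)) * ((-(k ω * Complex.I)) * φ ω) with hψ
  have hc := hr2.continuous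
  set M := max (∫ ω, ‖(-(k ω * Complex.I)) * φ ω‖ ∂μ) (∫ ω, ‖ψ ω‖ ∂μ) with hM
  have hM' : ∀ x, |v' x| ≤ M := fun x => (hr1.abs_le x).trans (le_max_left _ _)
  have hM'' : ∀ x, |v'' x| ≤ M := fun x => (hr2.abs_le x).trans (le_max_right _ _)
  rw [leftRL_eq_integral h1 h2 hv hv' hc hM' hM'' h0 hx]
  have z2 : ∀ y < a, v'' y = 0 := by
    have z1 : ∀ y < a, v' y = 0 := by
      intro y hy
      have : v =ᶠ[𝓝 y] fun _ => 0 := by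
        filter_upwards [Iio_mem_nhds hy] with w hw using h0 w (le_of_lt hw)
      rw [← (hv y).deriv, this.deriv_eq, deriv_const]
    intro y hy
    have : v' =ᶠ[𝓝 y] fun _ => 0 := by
      filter_upwards [Iio_mem_nhds hy] with w hw using z1 w hw
    rw [← (hv' y).deriv, this.deriv_eq, deriv_const]
  have hΓ : Real.Gamma (2 - α) ≠ 0 := (Real.Gamma_pos_of_pos (by linarith)).ne'
  -- The kernel `s^{1-α}` is not integrable at infinity, so Fubini with the Fourier integral needs
  -- the damping `e^{-ε s}`. The inner integral is then a Gamma integral at the rate `ε - ik`. The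
  -- limit `ε → 0+` is legitimate on both sides: `v'' (x - s)` vanishes for `s > x - a`, and the
  -- multipliers are dominated.
  set J : ℝ → ℂ := fun ε => ∫ s in Ioi (0 : ℝ),
    ((s ^ (1 - α) * Real.exp (-(ε * s)) * v'' (x - s) : ℝ) : ℂ) with hJ
  have hJ0 : ((∫ s in Ioi (0 : ℝ), s ^ (1 - α) * v'' (x - s) : ℝ) : ℂ) = J 0 := by
    rw [hJ]
    simp only
    rw [integral_complex_ofReal]
    simp
  have hdom : IntegrableOn (fun s : ℝ => s ^ (1 - α) * |v'' (x - s)|) (Ioi 0) := by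
    have hi : IntervalIntegrable (fun s : ℝ => s ^ (1 - α) * |v'' (x - s)|) volume 0 (x - a) :=
      (intervalIntegral.intervalIntegrable_rpow' (by linarith)).mul_continuousOn (by fun_prop)
    have hi' := (intervalIntegrable_iff_integrableOn_Ioc_of_le (by linarith)).1 hi
    refine hi'.of_forall_sdiff_eq_zero measurableSet_Ioi fun s hs => ?_
    have : x - a < s := by
      by_contra hcon
      exact hs.2 ⟨hs.1, not_lt.1 hcon⟩
    rw [z2 _ (by linarith), abs_zero, mul_zero]
  have hlim1 : Tendsto J (𝓝[>] 0) (𝓝 (J 0)) := by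
    refine tendsto_integral_filter_of_dominated_convergence
      (fun s : ℝ => s ^ (1 - α) * |v'' (x - s)|) ?_ ?_ hdom ?_
    · refine Eventually.of_forall fun ε => Measurable.aestronglyMeasurable ?_
      have := hc.measurable
      fun_prop
    · filter_upwards [self_mem_nhdsWithin] with ε hε
      filter_upwards [ae_restrict_mem measurableSet_Ioi] with s hs
      have hs' : (0 : ℝ) < s := hs
      have hε' : (0 : ℝ) < ε := hε
      have hp : 0 ≤ s ^ (1 - α) := Real.rpow_nonneg hs'.le _
      rw [Complex.norm_real, norm_mul, norm_mul, Real.norm_of_nonneg hp, Real.norm_eq_abs (v'' _),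
        Real.norm_of_nonneg (Real.exp_pos _).le]
      have : Real.exp (-(ε * s)) ≤ 1 := Real.exp_le_one_iff.2 (by nlinarith)
      gcongr
      exact mul_le_of_le_one_right hp this
    · refine Eventually.of_forall fun s => Tendsto.mono_left ?_ nhdsWithin_le_nhds
      exact Continuous.tendsto (f := fun ε : ℝ =>
        ((s ^ (1 - α) * Real.exp (-(ε * s)) * v'' (x - s) : ℝ) : ℂ)) (by fun_prop) 0
  have hJε : ∀ ε : ℝ, 0 < ε → J ε = Real.Gamma (2 - α) * ∫ ω, ((-(k ω * Complex.I)) ^ 2 *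
      ((ε : ℂ) - k ω * Complex.I) ^ (-((2 - α : ℝ) : ℂ))) *
        (φ ω * Complex.exp (-((k ω * x : ℝ) : ℂ) * Complex.I)) ∂μ := by
    intro ε hε
    set F : ℝ → Ω → ℂ := fun s ω => (((s ^ (1 - α) * Real.exp (-(ε * s)) : ℝ) : ℂ) * ψ ω) *
      Complex.exp (-((k ω * (x - s) : ℝ) : ℂ) * Complex.I) with hF
    have e1 : J ε = ∫ s in Ioi (0 : ℝ), ∫ ω, F s ω ∂μ := by
      refine setIntegral_congr_fun measurableSet_Ioi fun s _ => ?_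
      simp only [hF]
      rw [Complex.ofReal_mul, hr2.eq, ← integral_const_mul]
      refine integral_congr_ae (Eventually.of_forall fun ω => ?_)
      simp only
      ring
    have hprod : Integrable (Function.uncurry F) ((volume.restrict (Ioi (0 : ℝ))).prod μ) := by
      have k1 : Integrable (fun s : ℝ => ((s ^ (1 - α) * Real.exp (-(ε * s)) : ℝ) : ℂ))
          (volume.restrict (Ioi (0 : ℝ))) := by
        have := integrable_rpow_mul_exp_neg (c := 2 - α) (r := ε) (by linarith) hε
        rw [show 2 - α - 1 = 1 - α by ring] at this
        exact Integrable.ofReal this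
      refine (k1.mul_prod hφ2).mul_bdd (c := 1) ?_ ?_
      · refine Measurable.aestronglyMeasurable ?_
        fun_prop
      · exact Eventually.of_forall fun p => (norm_exp_neg_ofReal_mul_I _).le
    rw [e1, integral_integral_swap hprod, ← integral_const_mul]
    refine integral_congr_ae (Eventually.of_forall fun ω => ?_)
    simp only [hF]
    have g := integral_rpow_mul_cexp_neg (c := 2 - α) (z := (ε : ℂ) - k ω * Complex.I)
      (by linarith) (by simpa using hε)
    have e2 : ∀ s : ℝ, (((s ^ (1 - α) * Real.exp (-(ε * s)) : ℝ) : ℂ) * ψ ω) *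
        Complex.exp (-((k ω * (x - s) : ℝ) : ℂ) * Complex.I) =
        (ψ ω * Complex.exp (-((k ω * x : ℝ) : ℂ) * Complex.I)) *
          (((s ^ (2 - α - 1) : ℝ) : ℂ) * Complex.exp (-(((ε : ℂ) - k ω * Complex.I) * s))) := by
      intro s
      rw [show 2 - α - 1 = 1 - α by ring]
      have e3 : Complex.exp (-((k ω * (x - s) : ℝ) : ℂ) * Complex.I) =
          Complex.exp (-((k ω * x : ℝ) : ℂ) * Complex.I) * Complex.exp (k ω * s * Complex.I) := by
        rw [← Complex.exp_add]; congr 1; push_cast; ring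
      have e4 : Complex.exp (-(((ε : ℂ) - k ω * Complex.I) * s)) =
          Complex.exp (-(ε * s)) * Complex.exp (k ω * s * Complex.I) := by
        rw [← Complex.exp_add]; congr 1; ring
      rw [e3, e4]
      push_cast
      ring
    simp only [e2]
    rw [integral_const_mul, g, hψ]
    ring
  have hlim2 : Tendsto (fun ε : ℝ => Real.Gamma (2 - α) * ∫ ω, ((-(k ω * Complex.I)) ^ 2 *
      ((ε : ℂ) - k ω * Complex.I) ^ (-((2 - α : ℝ) : ℂ))) *
        (φ ω * Complex.exp (-((k ω * x : ℝ) : ℂ) * Complex.I)) ∂μ) (𝓝[>] 0)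
      (𝓝 (Real.Gamma (2 - α) * ∫ ω, (-(k ω * Complex.I)) ^ (α : ℂ) *
        (φ ω * Complex.exp (-((k ω * x : ℝ) : ℂ) * Complex.I)) ∂μ)) := by
    refine Tendsto.const_mul _ ?_
    refine tendsto_integral_filter_of_dominated_convergence
      (fun ω => (1 + |k ω|) ^ 2 * ‖φ ω‖) ?_ ?_ hk2 ?_
    · refine Eventually.of_forall fun ε => AEStronglyMeasurable.mul ?_
        (integrable_mul_phase hk h.integrable x).aestronglyMeasurable
      refine Measurable.aestronglyMeasurable ?_
      fun_prop
    · filter_upwards [self_mem_nhdsWithin] with ε hε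
      refine Eventually.of_forall fun ω => ?_
      rw [norm_mul, norm_mul (φ ω), norm_exp_neg_ofReal_mul_I, mul_one]
      gcongr
      exact norm_damped_le h1 h2
    · exact Eventually.of_forall fun ω => (tendsto_damped h1).mul_const _
  have hlim := tendsto_nhds_unique hlim1 (hlim2.congr' (by
    filter_upwards [self_mem_nhdsWithin] with ε hε using (hJε ε hε).symm))
  rw [Complex.ofReal_mul, hJ0, hlim, ← mul_assoc]
  have hΓ' : ((1 / Real.Gamma (2 - α) : ℝ) : ℂ) * (Real.Gamma (2 - α) : ℂ) = 1 := by
    rw [← Complex.ofReal_mul, one_div, inv_mul_cancel₀ hΓ, Complex.ofReal_one]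
  rw [hΓ', one_mul]
  simp only [mul_assoc]

theorem FourierRep.comp_neg (h : FourierRep μ k φ v) :
    FourierRep μ (fun ω => -k ω) φ (fun x => v (-x)) := by
  refine ⟨h.measurable.neg, h.integrable, fun x => ?_⟩
  rw [h.eq]
  simp only [neg_mul_comm]

/-- Reflection `x ↦ -x`; the signs from the two derivatives cancel. -/
theorem rightRL_eq_leftRL {α b x : ℝ} (v : ℝ → ℝ) :
    rightRL α b v x = leftRL α (-b) (fun y => v (-y)) (-x) := by
  rw [rightRL, leftRL]
  congr 1
  have e : (fun z => ∫ ξ in z..b, (ξ - z) ^ (1 - α) * v ξ) =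
      fun z => (fun w => ∫ ξ in (-b)..w, (w - ξ) ^ (1 - α) * v (-ξ)) (-z) := by
    funext z
    simp only
    rw [← intervalIntegral.integral_comp_neg]
    refine intervalIntegral.integral_congr fun ξ _ => ?_
    simp only [neg_neg]
    congr 2
    ring
  rw [e]
  set G := fun w => ∫ ξ in (-b)..w, (w - ξ) ^ (1 - α) * v (-ξ)
  have e2 : deriv (fun z => G (-z)) = fun z => -deriv G (-z) := funext fun z => deriv_comp_neg _ _
  rw [e2]
  have e3 : deriv (fun z => -deriv G (-z)) x = -deriv (fun z => deriv G (-z)) x := deriv.fun_neg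
  rw [e3, deriv_comp_neg, neg_neg]

theorem FourierRep.rightRL_eq [SigmaFinite μ] {α b : ℝ} (h1 : 1 < α) (h2 : α < 2)
    (h : FourierRep μ k φ v) (hk2 : Integrable (fun ω => (1 + |k ω|) ^ 2 * ‖φ ω‖) μ)
    (h0 : ∀ x, b ≤ x → v x = 0) {x : ℝ} (hx : x < b) :
    (rightRL α b v x : ℂ) = ∫ ω, (k ω * Complex.I) ^ (α : ℂ) * φ ω *
      Complex.exp (-((k ω * x : ℝ) : ℂ) * Complex.I) ∂μ := by
  rw [rightRL_eq_leftRL, h.comp_neg.leftRL_eq h1 h2 (by simpa using hk2)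
    (fun y hy => h0 _ (by linarith)) (by linarith)]
  refine integral_congr_ae (Eventually.of_forall fun ω => ?_)
  simp only
  congr 3
  · push_cast; ring
  · push_cast; ring

end WSLD

namespace WSLD

open Filter Topology FourierTransform

/-! ### Fourier inversion in the plane -/

theorem norm_exp_I_mul_ofReal' (x : ℝ) : ‖Complex.exp (Complex.I * (x : ℂ))‖ = 1 := by
  rw [mul_comm, Complex.norm_exp_ofReal_mul_I]

theorem continuous_fourier2 {v : ℝ × ℝ → ℝ} (hv : Integrable v) : Continuous (fourier2 v) := by
  have hv' : Integrable (fun p => (v p : ℂ)) := hv.ofReal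
  refine continuous_of_dominated (bound := fun p => ‖(v p : ℂ)‖) (fun ω => ?_)
    (fun ω => Eventually.of_forall fun p => ?_) hv'.norm
    (Eventually.of_forall fun p => by fun_prop)
  · refine AEStronglyMeasurable.mul (Measurable.aestronglyMeasurable ?_) hv'.aestronglyMeasurable
    fun_prop
  · rw [norm_mul, norm_exp_I_mul_ofReal', one_mul]

/-- Fourier inversion with the normalization of `fourier2`. -/
theorem eq_integral_fourier2 {v : ℝ × ℝ → ℝ} (hc : Continuous v) (hv : Integrable v)
    (hF : Integrable (fourier2 v)) (p : ℝ × ℝ) :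
    (v p : ℂ) = ∫ ω : ℝ × ℝ, (((2 * Real.pi) ^ 2)⁻¹ : ℝ) * fourier2 v ω *
      Complex.exp (-((ω.1 * p.1 + ω.2 * p.2 : ℝ) : ℂ) * Complex.I) := by
  -- Inversion is applied in the Euclidean plane, whose volume is the product one. Rescaling
  -- frequencies by `-2π` produces the factor `(2π)⁻²`.
  set f : WithLp 2 (ℝ × ℝ) → ℂ := fun q => (v (WithLp.ofLp q) : ℂ) with hf
  have hmp := WithLp.volume_preserving_ofLp (U := ℝ) (V := ℝ)
  have hme : MeasurableEmbedding (@WithLp.ofLp 2 (ℝ × ℝ)) :=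
    (MeasurableEquiv.toLp 2 (ℝ × ℝ)).symm.measurableEmbedding
  have hfc : Continuous f := by
    refine Complex.continuous_ofReal.comp (hc.comp ?_)
    exact WithLp.prod_continuous_ofLp 2 ℝ ℝ
  have hfi : Integrable f := (hmp.integrable_comp_emb hme).2 hv.ofReal
  have hFe : ∀ w : WithLp 2 (ℝ × ℝ), 𝓕 f w = fourier2 v ((-(2 * Real.pi)) • WithLp.ofLp w) := by
    intro w
    rw [Real.fourier_eq', fourier2, ← hmp.integral_comp hme]
    refine integral_congr_ae (Eventually.of_forall fun q => ?_)
    simp only [hf, smul_eq_mul, WithLp.prod_inner_apply, Prod.smul_fst, Prod.smul_snd]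
    congr 2
    simp
    ring
  have hpi : (-(2 * Real.pi)) ≠ 0 := by
    have := Real.pi_pos
    linarith
  have hFi : Integrable (𝓕 f) := by
    rw [show 𝓕 f = (fun ω : ℝ × ℝ => fourier2 v ((-(2 * Real.pi)) • ω)) ∘ WithLp.ofLp from
      funext hFe]
    exact (hmp.integrable_comp_emb hme).2 (hF.comp_smul hpi)
  have hinv := congrFun (hfc.fourierInv_fourier_eq hfi hFi) (WithLp.toLp 2 p)
  rw [Real.fourierInv_eq'] at hinv
  simp only [hFe] at hinv
  simp only [hf] at hinv
  rw [← hinv]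
  have e1 := hmp.integral_comp hme (fun w : ℝ × ℝ =>
    Complex.exp (2 * Real.pi * (w.1 * p.1 + w.2 * p.2 : ℝ) * Complex.I) *
      fourier2 v ((-(2 * Real.pi)) • w))
  have e2 := Measure.integral_comp_smul (volume : Measure (ℝ × ℝ)) (fun ω : ℝ × ℝ =>
    Complex.exp (-((ω.1 * p.1 + ω.2 * p.2 : ℝ) : ℂ) * Complex.I) * fourier2 v ω)
      (-(2 * Real.pi))
  have e3 : ∀ w : ℝ × ℝ, Complex.exp (2 * Real.pi * (w.1 * p.1 + w.2 * p.2 : ℝ) * Complex.I) *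
      fourier2 v ((-(2 * Real.pi)) • w) = Complex.exp (-((((-(2 * Real.pi)) • w).1 * p.1 +
        ((-(2 * Real.pi)) • w).2 * p.2 : ℝ) : ℂ) * Complex.I) *
          fourier2 v ((-(2 * Real.pi)) • w) := by
    intro w
    congr 2
    simp
    ring
  calc _ = ∫ q : WithLp 2 (ℝ × ℝ), (fun w : ℝ × ℝ =>
        Complex.exp (2 * Real.pi * (w.1 * p.1 + w.2 * p.2 : ℝ) * Complex.I) *
          fourier2 v ((-(2 * Real.pi)) • w)) (WithLp.ofLp q) := by
        refine integral_congr_ae (Eventually.of_forall fun q => ?_)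
        simp only [smul_eq_mul, WithLp.prod_inner_apply]
        congr 2
        simp
        ring
    _ = _ := by
        rw [e1]
        simp only [e3]
        rw [e2, ← integral_smul]
        refine integral_congr_ae (Eventually.of_forall fun ω => ?_)
        have : |((-(2 * Real.pi)) ^ Module.finrank ℝ (ℝ × ℝ))⁻¹| = ((2 * Real.pi) ^ 2)⁻¹ := by
          rw [Module.finrank_prod, Module.finrank_self, one_add_one_eq_two, neg_sq,
            abs_of_nonneg (by positivity)]
        simp only [this, Complex.real_smul]
        ring

/-- The weight `(1+|ω₁|)^a (1+|ω₂|)^b`. -/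
noncomputable def fourierWeight (a b : ℝ) (ω : ℝ × ℝ) : ℝ := (1 + |ω.1|) ^ a * (1 + |ω.2|) ^ b

theorem one_le_fourierWeight {a b : ℝ} (ha : 0 ≤ a) (hb : 0 ≤ b) (ω : ℝ × ℝ) :
    1 ≤ fourierWeight a b ω := by
  have h1 := Real.one_le_rpow (by linarith [abs_nonneg ω.1] : 1 ≤ 1 + |ω.1|) ha
  have h2 := Real.one_le_rpow (by linarith [abs_nonneg ω.2] : 1 ≤ 1 + |ω.2|) hb
  exact one_le_mul_of_one_le_of_one_le h1 h2

theorem FourierBound.integrable_fourier2 {a b K : ℝ} (ha : 0 ≤ a) (hb : 0 ≤ b) {v : ℝ × ℝ → ℝ}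
    (h : FourierBound a b K v) : Integrable (fourier2 v) := by
  refine h.integrable_fourier.mono' (continuous_fourier2 h.integrable).aestronglyMeasurable
    (Eventually.of_forall fun ω => ?_)
  exact le_mul_of_one_le_left (norm_nonneg _) (one_le_fourierWeight ha hb ω)

end WSLD

namespace WSLD

open Filter Topology

/-! ### Difference matrices acting on Fourier integrals -/

variable {Ω : Type*} [MeasurableSpace Ω] {μ : Measure Ω} {k : Ω → ℝ} {φ : Ω → ℂ} {v : ℝ → ℝ}

theorem mul_phase_mul_exp (θ : ℝ) (y h : ℝ) (m : ℕ) (c : ℂ) :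
    c * Complex.exp (-((θ * (y - m * h) : ℝ) : ℂ) * Complex.I) =
      c * Complex.exp (-((θ * y : ℝ) : ℂ) * Complex.I) *
        Complex.exp (((θ * h : ℝ) : ℂ) * Complex.I) ^ m := by
  rw [mul_assoc, ← Complex.exp_nat_mul, ← Complex.exp_add]
  congr 2
  push_cast
  ring

/-- The Lubich series acting on a Fourier integral. -/
theorem FourierRep.tsum_lubich_mul {α : ℝ} (h1 : 1 < α) (h2 : α < 2) (hv : FourierRep μ k φ v)
    (y h : ℝ) :
    ((∑' m : ℕ, lubich α m * v (y - m * h) : ℝ) : ℂ) =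
      ∫ ω, φ ω * symBase (Complex.exp (((k ω * h : ℝ) : ℂ) * Complex.I)) ^ (α : ℂ) *
        Complex.exp (-((k ω * y : ℝ) : ℂ) * Complex.I) ∂μ := by
  set F : ℕ → Ω → ℂ := fun m ω => (lubich α m : ℂ) *
    (φ ω * Complex.exp (-((k ω * (y - m * h) : ℝ) : ℂ) * Complex.I)) with hF
  have hFi : ∀ m, Integrable (F m) μ := fun m =>
    (integrable_mul_phase hv.measurable hv.integrable _).const_mul _
  have hFn : ∀ m, ∫ ω, ‖F m ω‖ ∂μ = |lubich α m| * ∫ ω, ‖φ ω‖ ∂μ := by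
    intro m
    rw [← integral_const_mul]
    refine integral_congr_ae (Eventually.of_forall fun ω => ?_)
    simp only [hF]
    rw [norm_mul, norm_mul, norm_exp_neg_ofReal_mul_I, mul_one, Complex.norm_real, Real.norm_eq_abs]
  have hs := hasSum_integral_of_summable_integral_norm hFi (by
    simp only [hFn]
    exact (summable_lubich h1 h2).mul_right _)
  rw [Complex.ofReal_tsum]
  have e1 : ∀ m : ℕ, ((lubich α m * v (y - m * h) : ℝ) : ℂ) = ∫ ω, F m ω ∂μ := by
    intro m
    rw [Complex.ofReal_mul, hv.eq, ← integral_const_mul]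
  simp only [e1]
  rw [hs.tsum_eq]
  refine integral_congr_ae (Eventually.of_forall fun ω => ?_)
  simp only [hF]
  have hsum := hasSum_lubich h1 h2 (Complex.norm_exp_ofReal_mul_I (k ω * h)).le
  rw [mul_right_comm, ← hsum.tsum_eq, ← tsum_mul_left]
  refine tsum_congr fun m => ?_
  rw [mul_phase_mul_exp]
  ring

/-- A row of a shifted Lubich matrix acts on a function vanishing outside the interval like the
full Lubich series. -/
theorem sum_lubichZ_mul_node {α a b : ℝ} {N : ℕ} (hN : 0 < N) (hab : a < b)
    (h0 : ∀ x, x ≤ a ∨ b ≤ x → v x = 0) (c : ℤ) :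
    ∑ j : Fin (N - 1), lubichZ α (c - (j : ℤ)) * v (node a b N j) =
      ∑' m : ℕ, lubich α m * v (a + (c + 1) * step a b N - m * step a b N) := by
  have hN' : (0 : ℝ) < N := by exact_mod_cast hN
  have hs : 0 < step a b N := div_pos (by linarith) hN'
  have hsN : N * step a b N = b - a := by rw [step]; field_simp
  -- Index `j` belongs to the mesh point number `j + 1`. Outside `0 ≤ j < N - 1` that point is off
  -- the open interval and `v` vanishes, so the row sum extends to all integers, and the zero
  -- convention of `lubichZ` cuts it to a one-sided series.
  set F : ℤ → ℝ := fun j => lubichZ α (c - j) * v (a + (j + 1) * step a b N) with hF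
  have hzero : ∀ j : ℤ, (j < 0 ∨ (N : ℤ) - 1 ≤ j) → F j = 0 := by
    intro j hj
    rw [hF]
    simp only
    rw [h0, mul_zero]
    rcases hj with hj | hj
    · left
      have : (j : ℝ) + 1 ≤ 0 := by exact_mod_cast hj
      nlinarith
    · right
      have : (N : ℝ) ≤ j + 1 := by
        have : (N : ℤ) ≤ j + 1 := by omega
        exact_mod_cast this
      nlinarith
  have e1 : ∑ j : Fin (N - 1), lubichZ α (c - (j : ℤ)) * v (node a b N j) = ∑' j : ℤ, F j := by
    have hinj : Function.Injective (fun j : Fin (N - 1) => ((j : ℕ) : ℤ)) := by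
      intro i j hij
      exact Fin.ext (by simpa using hij)
    have hsupp : Function.support F ⊆ range (fun j : Fin (N - 1) => ((j : ℕ) : ℤ)) := by
      intro j hj
      by_contra hcon
      refine hj (hzero j ?_)
      by_contra hc
      push Not at hc
      exact hcon ⟨⟨j.toNat, by omega⟩, by simp; omega⟩
    rw [← hinj.tsum_eq hsupp, tsum_fintype]
    refine Finset.sum_congr rfl fun j _ => ?_
    simp [hF, node]
  have e2 : ∑' j : ℤ, F j = ∑' m : ℤ, F (c - m) := ((Equiv.subLeft c).tsum_eq F).symm
  have e3 : ∑' m : ℤ, F (c - m) = ∑' m : ℕ, F (c - (m : ℤ)) := by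
    refine (Nat.cast_injective (R := ℤ)).tsum_eq (f := fun m : ℤ => F (c - m)) ?_ |>.symm
    intro m hm
    by_contra hcon
    refine hm ?_
    have hneg : m < 0 := by
      by_contra hc
      exact hcon ⟨m.toNat, by simp; omega⟩
    simp [hF, lubichZ, hneg]
  rw [e1, e2, e3]
  refine tsum_congr fun m => ?_
  have : ¬ ((m : ℤ) < 0) := by omega
  simp only [hF, sub_sub_cancel, lubichZ, this, if_false, Int.toNat_natCast]
  congr 2
  push_cast
  ring

/-- The symbol of the fourth order matrix is its Fourier multiplier. -/
theorem FourierRep.A4_mulVec {α a b : ℝ} (h1 : 1 < α) (h2 : α < 2) {P : Shifts} {N : ℕ}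
    (hN : 0 < N) (hab : a < b) (hv : FourierRep μ k φ v) (h0 : ∀ x, x ≤ a ∨ b ≤ x → v x = 0)
    (i : Fin (N - 1)) :
    (((A4 α P (N - 1) *ᵥ fun j => v (node a b N j)) i : ℝ) : ℂ) =
      ∫ ω, φ ω * symbol α (P.weight α) P.shift (k ω * step a b N) *
        Complex.exp (-((k ω * node a b N i : ℝ) : ℂ) * Complex.I) ∂μ := by
  have e1 : (A4 α P (N - 1) *ᵥ fun j => v (node a b N j)) i =
      ∑ l, P.weight α l * ∑' m : ℕ, lubich α m *
        v (a + (((P.shift l + (i : ℤ) : ℤ) : ℝ) + 1) * step a b N - m * step a b N) := by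
    simp only [← sum_lubichZ_mul_node hN hab h0, Finset.mul_sum]
    rw [Finset.sum_comm, Matrix.mulVec, dotProduct]
    refine Finset.sum_congr rfl fun j _ => ?_
    rw [A4_eq_sum, Matrix.sum_apply, Finset.sum_mul]
    refine Finset.sum_congr rfl fun l _ => ?_
    simp only [Matrix.smul_apply, A1, Matrix.of_apply, smul_eq_mul]
    ring
  have hsb : ∀ ω, ‖symBase (Complex.exp (((k ω * step a b N : ℝ) : ℂ) * Complex.I)) ^ (α : ℂ)‖ ≤
      ∑' m, |lubich α m| := by
    intro ω
    rw [symBase_cpow_eq_tsum h1 h2]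
    refine (norm_tsum_le_tsum_norm ?_).trans (le_of_eq (tsum_congr fun m => ?_))
    · simp only [norm_lubich_mul_exp]
      exact summable_lubich h1 h2
    · rw [norm_lubich_mul_exp]
  have hint : ∀ y, Integrable (fun ω => φ ω *
      symBase (Complex.exp (((k ω * step a b N : ℝ) : ℂ) * Complex.I)) ^ (α : ℂ) *
        Complex.exp (-((k ω * y : ℝ) : ℂ) * Complex.I)) μ := by
    intro y
    refine integrable_mul_phase hv.measurable (hv.integrable.mul_bdd ?_
      (Eventually.of_forall hsb)) y
    refine Measurable.aestronglyMeasurable ?_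
    exact (continuous_symBase_cpow h1 h2).measurable.comp (hv.measurable.mul_const _)
  rw [e1]
  push_cast [Complex.ofReal_sum, Complex.ofReal_mul]
  have e2 : ∀ l, (P.weight α l : ℂ) * ((∑' m : ℕ, lubich α m *
      v (a + (((P.shift l + (i : ℤ) : ℤ) : ℝ) + 1) * step a b N - m * step a b N) : ℝ) : ℂ) =
      ∫ ω, (P.weight α l : ℂ) * (φ ω *
        symBase (Complex.exp (((k ω * step a b N : ℝ) : ℂ) * Complex.I)) ^ (α : ℂ) *
        Complex.exp (-((k ω * (a + (((P.shift l + (i : ℤ) : ℤ) : ℝ) + 1) * step a b N) : ℝ) : ℂ) *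
          Complex.I)) ∂μ := by
    intro l
    rw [hv.tsum_lubich_mul h1 h2, integral_const_mul]
  push_cast [Complex.ofReal_tsum] at e2
  rw [Finset.sum_congr rfl fun l _ => e2 l, ← integral_finsetSum]
  · refine integral_congr_ae (Eventually.of_forall fun ω => ?_)
    simp only
    rw [symbol, Finset.mul_sum, Finset.mul_sum, Finset.sum_mul]
    refine Finset.sum_congr rfl fun l _ => ?_
    have : Complex.exp (-((k ω : ℂ) * (a + ((P.shift l + ((i : ℕ) : ℂ)) + 1) * step a b N)) *
        Complex.I) = Complex.exp (((k ω * step a b N : ℝ) : ℂ) * Complex.I) ^ (-P.shift l) *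
          Complex.exp (-((k ω * node a b N i : ℝ) : ℂ) * Complex.I) := by
      rw [← Complex.exp_int_mul, ← Complex.exp_add, node]
      congr 1
      push_cast
      ring
    rw [this]
    push_cast
    ring
  · intro l _
    have := (hint (a + (((P.shift l + (i : ℤ) : ℤ) : ℝ) + 1) * step a b N)).const_mul
      (P.weight α l : ℂ)
    push_cast at this
    exact this

theorem node_rev {a b : ℝ} {N : ℕ} (i : Fin (N - 1)) :
    node a b N i.rev = a + b - node a b N i := by
  have hi := i.2
  have hN : (0 : ℝ) < N := by exact_mod_cast (by omega : 0 < N)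
  have e : ((i.rev : ℕ) : ℝ) + ((i : ℕ) : ℝ) + 2 = N := by
    have : (i.rev : ℕ) + (i : ℕ) + 2 = N := by
      rw [Fin.val_rev]; omega
    exact_mod_cast this
  have hsN : N * step a b N = b - a := by rw [step]; field_simp
  rw [node, node]
  have : ((i.rev : ℕ) : ℝ) = N - 2 - (i : ℕ) := by linarith
  rw [this]
  linear_combination hsN

theorem FourierRep.comp_sub (hv : FourierRep μ k φ v) (c : ℝ) :
    FourierRep μ (fun ω => -k ω)
      (fun ω => φ ω * Complex.exp (-((k ω * c : ℝ) : ℂ) * Complex.I)) (fun x => v (c - x)) := by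
  refine ⟨hv.measurable.neg, integrable_mul_phase hv.measurable hv.integrable c, fun x => ?_⟩
  rw [hv.eq]
  refine integral_congr_ae (Eventually.of_forall fun ω => ?_)
  simp only
  rw [mul_assoc, ← Complex.exp_add]
  congr 2
  push_cast
  ring

/-- Reversing the order of the indices transposes a Toeplitz matrix. -/
theorem A4_transpose_mulVec {α : ℝ} {P : Shifts} {n : ℕ} (w : Fin n → ℝ) (i : Fin n) :
    ((A4 α P n)ᵀ *ᵥ w) i = (A4 α P n *ᵥ fun j => w j.rev) i.rev := by
  simp only [Matrix.mulVec, dotProduct, Matrix.transpose_apply]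
  rw [← Equiv.sum_comp Fin.revPerm]
  refine Finset.sum_congr rfl fun j _ => ?_
  simp only [Fin.revPerm_apply]
  congr 1
  rw [A4_eq_sum, Matrix.sum_apply, Matrix.sum_apply]
  refine Finset.sum_congr rfl fun l _ => ?_
  simp only [Matrix.smul_apply, A1, Matrix.of_apply]
  congr 2
  have := i.2
  have := j.2
  simp only [Fin.val_rev]
  omega

/-- By index reversal the transpose acts on the mirrored function `x ↦ v (a + b - x)`, whose
frequencies have the opposite sign; hence the symbol at `-θ`. -/
theorem FourierRep.A4_transpose_mulVec {α a b : ℝ} (h1 : 1 < α) (h2 : α < 2) {P : Shifts} {N : ℕ}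
    (hN : 0 < N) (hab : a < b) (hv : FourierRep μ k φ v) (h0 : ∀ x, x ≤ a ∨ b ≤ x → v x = 0)
    (i : Fin (N - 1)) :
    ((((A4 α P (N - 1))ᵀ *ᵥ fun j => v (node a b N j)) i : ℝ) : ℂ) =
      ∫ ω, φ ω * symbol α (P.weight α) P.shift (-(k ω * step a b N)) *
        Complex.exp (-((k ω * node a b N i : ℝ) : ℂ) * Complex.I) ∂μ := by
  rw [WSLD.A4_transpose_mulVec]
  simp only [node_rev]
  rw [(hv.comp_sub (a + b)).A4_mulVec h1 h2 hN hab (fun x hx => h0 _ (by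
    rcases hx with hx | hx
    · right; linarith
    · left; linarith))]
  refine integral_congr_ae (Eventually.of_forall fun ω => ?_)
  simp only
  rw [node_rev, mul_right_comm, mul_assoc (φ ω), ← Complex.exp_add, neg_mul, mul_right_comm]
  congr 3 <;> push_cast <;> ring

end WSLD

namespace WSLD

open Filter Topology

/-! ### Difference and Riemann-Liouville operators with both one-sided parts -/

variable {Ω : Type*} [MeasurableSpace Ω] {μ : Measure Ω} {k : Ω → ℝ} {φ : Ω → ℂ} {v : ℝ → ℝ}

/-- The matrix `h^{-α} (A + κ Aᵀ)`. -/
noncomputable def diffMatrix (α κ : ℝ) (P : Shifts) (a b : ℝ) (N : ℕ) :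
    Matrix (Fin (N - 1)) (Fin (N - 1)) ℝ :=
  (step a b N ^ α)⁻¹ • (A4 α P (N - 1) + κ • (A4 α P (N - 1))ᵀ)

/-- The Fourier multiplier of `diffMatrix`. -/
noncomputable def diffSymbol (α κ : ℝ) (P : Shifts) (h θ : ℝ) : ℂ :=
  ((h ^ α)⁻¹ : ℝ) * (symbol α (P.weight α) P.shift (θ * h) +
    κ * symbol α (P.weight α) P.shift (-(θ * h)))

/-- The operator `D_left + κ D_right`. -/
noncomputable def twoSidedRL (α κ a b : ℝ) (v : ℝ → ℝ) (x : ℝ) : ℝ :=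
  leftRL α a v x + κ * rightRL α b v x

/-- The Fourier multiplier of `twoSidedRL`. -/
noncomputable def rlSymbol (α κ θ : ℝ) : ℂ :=
  (-(θ * Complex.I)) ^ (α : ℂ) + κ * (θ * Complex.I) ^ (α : ℂ)

theorem measurable_symbol {α : ℝ} (h1 : 1 < α) (h2 : α < 2) {ι : Type*} [Fintype ι] {w : ι → ℝ}
    {sh : ι → ℤ} : Measurable (symbol α w sh) := by
  refine Continuous.measurable ?_
  exact (continuous_symBase_cpow h1 h2).mul (continuous_finsetSum _ fun l _ =>
    continuous_const.mul (continuous_exp_zpow _))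

theorem measurable_diffSymbol {α : ℝ} (h1 : 1 < α) (h2 : α < 2) (κ : ℝ) (P : Shifts) (h : ℝ) :
    Measurable (diffSymbol α κ P h) := by
  have := measurable_symbol h1 h2 (w := P.weight α) (sh := P.shift)
  unfold diffSymbol
  exact measurable_const.mul ((this.comp (measurable_id.mul_const h)).add
    (measurable_const.mul (this.comp (measurable_id.mul_const h).neg)))

theorem measurable_rlSymbol (α κ : ℝ) : Measurable (rlSymbol α κ) := by
  unfold rlSymbol
  fun_prop

theorem norm_mul_I_cpow (α θ : ℝ) : ‖((θ : ℂ) * Complex.I) ^ (α : ℂ)‖ = |θ| ^ α := by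
  rw [Complex.norm_cpow_real]; simp

theorem norm_neg_mul_I_cpow (α θ : ℝ) : ‖(-((θ : ℂ) * Complex.I)) ^ (α : ℂ)‖ = |θ| ^ α := by
  rw [Complex.norm_cpow_real]; simp

theorem norm_rlSymbol_le {α κ : ℝ} (hκ : 0 ≤ κ) (θ : ℝ) :
    ‖rlSymbol α κ θ‖ ≤ (1 + κ) * |θ| ^ α := by
  refine (norm_add_le _ _).trans ?_
  rw [norm_mul, norm_mul_I_cpow, norm_neg_mul_I_cpow, Complex.norm_real, Real.norm_of_nonneg hκ]
  linarith

/-- Consistency of the difference operator on the level of Fourier multipliers. -/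
theorem exists_diffSymbol_bounds {α κ : ℝ} (h1 : 1 < α) (hκ : 0 ≤ κ) {P : Shifts}
    (hP : IsStableFourthOrder α (P.weight α) P.shift) :
    ∃ C : ℝ, 0 ≤ C ∧ ∀ h θ : ℝ, 0 < h → ‖diffSymbol α κ P h θ‖ ≤ C * |θ| ^ α ∧
      ‖diffSymbol α κ P h θ - rlSymbol α κ θ‖ ≤ C * h ^ 4 * |θ| ^ (α + 4) := by
  obtain ⟨C, hC, hb⟩ := hP.exists_norm_symbol_sub_le h1
  refine ⟨C * (1 + κ), by positivity, fun h θ hh => ?_⟩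
  have hha : 0 < h ^ α := Real.rpow_pos_of_pos hh α
  have ha : |θ * h| = |θ| * h := by rw [abs_mul, abs_of_pos hh]
  have hr : |θ * h| ^ α = |θ| ^ α * h ^ α := by rw [ha, Real.mul_rpow (abs_nonneg _) hh.le]
  have h4 : h ^ (α + 4) = h ^ α * h ^ 4 := by
    rw [Real.rpow_add hh]; norm_cast
  have hr4 : |θ * h| ^ (α + 4) = |θ| ^ (α + 4) * (h ^ α * h ^ 4) := by
    rw [ha, Real.mul_rpow (abs_nonneg _) hh.le, h4]
  have p1 := hb (θ * h)
  have p2 := hb (-(θ * h))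
  rw [abs_neg] at p2
  rw [hr, hr4] at p1 p2
  constructor
  · rw [diffSymbol, norm_mul, Complex.norm_real, Real.norm_of_nonneg (by positivity),
      inv_mul_le_iff₀ hha]
    refine (norm_add_le _ _).trans ?_
    rw [norm_mul, Complex.norm_real, Real.norm_of_nonneg hκ]
    have := mul_le_mul_of_nonneg_left p2.1 hκ
    linarith [p1.1]
  · have e : diffSymbol α κ P h θ - rlSymbol α κ θ = ((h ^ α)⁻¹ : ℝ) *
        ((symbol α (P.weight α) P.shift (θ * h) - (-(((θ * h : ℝ) : ℂ) * Complex.I)) ^ (α : ℂ)) +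
        κ * (symbol α (P.weight α) P.shift (-(θ * h)) -
          (-(((-(θ * h) : ℝ) : ℂ) * Complex.I)) ^ (α : ℂ))) := by
      have hc : ((h ^ α : ℝ) : ℂ) = (h : ℂ) ^ (α : ℂ) := Complex.ofReal_cpow hh.le α
      have hne : ((h ^ α : ℝ) : ℂ) ≠ 0 := by exact_mod_cast hha.ne'
      have e1 : (-(((θ * h : ℝ) : ℂ) * Complex.I)) ^ (α : ℂ) =
          ((h ^ α : ℝ) : ℂ) * (-((θ : ℂ) * Complex.I)) ^ (α : ℂ) := by
        rw [hc, mul_comm ((h : ℂ) ^ (α : ℂ)), ← mul_cpow_of_re (by simp) (by simpa using hh)]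
        congr 1; push_cast; ring
      have e2 : (-(((-(θ * h) : ℝ) : ℂ) * Complex.I)) ^ (α : ℂ) =
          ((h ^ α : ℝ) : ℂ) * ((θ : ℂ) * Complex.I) ^ (α : ℂ) := by
        rw [hc, mul_comm ((h : ℂ) ^ (α : ℂ)), ← mul_cpow_of_re (by simp) (by simpa using hh)]
        congr 1; push_cast; ring
      rw [e1, e2, diffSymbol, rlSymbol, Complex.ofReal_inv]
      field_simp
      ring
    rw [e, norm_mul, Complex.norm_real, Real.norm_of_nonneg (by positivity),
      inv_mul_le_iff₀ hha]
    refine (norm_add_le _ _).trans ?_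
    rw [norm_mul, Complex.norm_real, Real.norm_of_nonneg hκ]
    have := mul_le_mul_of_nonneg_left p2.2 hκ
    linarith [p1.2]

theorem integrable_mul_symbol {m : ℝ → ℂ} (hm : Measurable m) {α C : ℝ} (hα : 0 ≤ α)
    (hb : ∀ θ, ‖m θ‖ ≤ C * |θ| ^ α) (hk : Measurable k) (hφ : Integrable φ μ)
    (hi : Integrable (fun ω => (1 + |k ω|) ^ α * ‖φ ω‖) μ) :
    Integrable (fun ω => φ ω * m (k ω)) μ := by
  refine (hi.const_mul |C|).mono' (hφ.aestronglyMeasurable.mul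
    (hm.comp hk).aestronglyMeasurable) (Eventually.of_forall fun ω => ?_)
  rw [norm_mul, mul_comm]
  have h1 : C * |k ω| ^ α ≤ |C| * (1 + |k ω|) ^ α := by
    have : |k ω| ^ α ≤ (1 + |k ω|) ^ α := by gcongr; linarith
    exact mul_le_mul (le_abs_self C) this (by positivity) (abs_nonneg _)
  calc ‖m (k ω)‖ * ‖φ ω‖ ≤ (|C| * (1 + |k ω|) ^ α) * ‖φ ω‖ := by
        gcongr; exact (hb _).trans h1
    _ = _ := by ring

theorem FourierRep.diffMatrix_mulVec {α κ a b : ℝ} (h1 : 1 < α) (h2 : α < 2)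
    {P : Shifts} {N : ℕ} (hN : 0 < N)
    (hab : a < b) (hv : FourierRep μ k φ v)
    (h0 : ∀ x, x ≤ a ∨ b ≤ x → v x = 0) (i : Fin (N - 1)) :
    (((diffMatrix α κ P a b N *ᵥ fun j => v (node a b N j)) i : ℝ) : ℂ) =
      ∫ ω, φ ω * diffSymbol α κ P (step a b N) (k ω) *
        Complex.exp (-((k ω * node a b N i : ℝ) : ℂ) * Complex.I) ∂μ := by
  have e1 : (diffMatrix α κ P a b N *ᵥ fun j => v (node a b N j)) i =
      (step a b N ^ α)⁻¹ * ((A4 α P (N - 1) *ᵥ fun j => v (node a b N j)) i +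
        κ * ((A4 α P (N - 1))ᵀ *ᵥ fun j => v (node a b N j)) i) := by
    rw [diffMatrix, Matrix.smul_mulVec, Matrix.add_mulVec, Matrix.smul_mulVec]
    simp
  have hi : ∀ c : ℝ, Integrable (fun ω => φ ω * symbol α (P.weight α) P.shift (k ω * c) *
      Complex.exp (-((k ω * node a b N i : ℝ) : ℂ) * Complex.I)) μ := by
    intro c
    refine integrable_mul_phase hv.measurable (hv.integrable.mul_bdd ?_ (Eventually.of_forall
      fun ω => norm_symbol_le (by linarith) _ _ _)) _
    exact ((measurable_symbol h1 h2).comp (hv.measurable.mul_const c)).aestronglyMeasurable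
  rw [e1, Complex.ofReal_mul, Complex.ofReal_add, Complex.ofReal_mul]
  rw [hv.A4_mulVec h1 h2 hN hab h0, hv.A4_transpose_mulVec h1 h2 hN hab h0, ← integral_const_mul,
    ← integral_add, ← integral_const_mul]
  · refine integral_congr_ae (Eventually.of_forall fun ω => ?_)
    simp only [diffSymbol]
    ring
  · exact hi _
  · have := (hi (-step a b N)).const_mul (κ : ℂ)
    simpa only [mul_neg] using this

theorem FourierRep.twoSidedRL_eq [SigmaFinite μ] {α κ a b : ℝ} (h1 : 1 < α) (h2 : α < 2)
    (hv : FourierRep μ k φ v) (hk2 : Integrable (fun ω => (1 + |k ω|) ^ 2 * ‖φ ω‖) μ)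
    (h0 : ∀ x, x ≤ a ∨ b ≤ x → v x = 0) {x : ℝ} (hx : x ∈ Ioo a b) :
    (twoSidedRL α κ a b v x : ℂ) = ∫ ω, φ ω * rlSymbol α κ (k ω) *
      Complex.exp (-((k ω * x : ℝ) : ℂ) * Complex.I) ∂μ := by
  rw [twoSidedRL, Complex.ofReal_add, Complex.ofReal_mul]
  have hi : Integrable (fun ω => (1 + |k ω|) ^ α * ‖φ ω‖) μ := by
    refine hk2.mono' ?_ (Eventually.of_forall fun ω => ?_)
    · exact ((measurable_const.add (continuous_abs.measurable.comp hv.measurable)).pow_const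
        α).aestronglyMeasurable.mul hv.integrable.aestronglyMeasurable.norm
    · rw [Real.norm_of_nonneg (by positivity)]
      gcongr
      have := Real.rpow_le_rpow_of_exponent_le (by linarith [abs_nonneg (k ω)] : 1 ≤ 1 + |k ω|)
        h2.le
      exact_mod_cast this
  rw [hv.leftRL_eq h1 h2 hk2 (fun x hx => h0 x (Or.inl hx)) hx.1,
    hv.rightRL_eq h1 h2 hk2 (fun x hx => h0 x (Or.inr hx)) hx.2, ← integral_const_mul,
    ← integral_add]
  · refine integral_congr_ae (Eventually.of_forall fun ω => ?_)
    simp only [rlSymbol]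
    ring
  · have := integrable_mul_phase hv.measurable (integrable_mul_symbol
      (m := fun θ => (-((θ : ℂ) * Complex.I)) ^ (α : ℂ)) (C := 1) (by fun_prop) (by linarith)
      (fun θ => by rw [norm_neg_mul_I_cpow, one_mul]) hv.measurable hv.integrable hi) x
    refine this.congr (Eventually.of_forall fun ω => ?_)
    simp only
    ring
  · have := integrable_mul_phase hv.measurable (integrable_mul_symbol
      (m := fun θ => ((θ : ℂ) * Complex.I) ^ (α : ℂ)) (C := 1) (by fun_prop) (by linarith)
      (fun θ => by rw [norm_mul_I_cpow, one_mul]) hv.measurable hv.integrable hi) x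
    refine (this.const_mul (κ : ℂ)).congr (Eventually.of_forall fun ω => ?_)
    simp only
    ring

end WSLD

namespace WSLD

/-! ### The error bound for alternating direction schemes on meshes -/

/-- The stability constant of `adi_error_bound`. -/
noncomputable def adiConst (M T : ℝ) : ℝ :=
  T + 2 * (M * (T * (M * (1 + T)))) + M * (M * (T * (2 * (M * (T * (M * (1 + T)))) +
    M * (M * (1 + T ^ 2 + 2 * (T * (1 + T)))))))

theorem toLpLin_dissipative {ι : Type*} [Fintype ι] [DecidableEq ι] {B : Matrix ι ι ℝ}
    (hB : ∀ v, v ⬝ᵥ (B *ᵥ v) ≤ 0) :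
    Dissipative (Matrix.toLpLinAlgEquiv (n := ι) (R := ℝ) 2 B : Module.End ℝ (EuclideanSpace ℝ ι)) := by
  intro v
  have := hB v.ofLp
  refine le_of_eq_of_le ?_ this
  rw [PiLp.inner_apply, dotProduct]
  refine Finset.sum_congr rfl fun i _ => ?_
  simp [Matrix.toLpLinAlgEquiv]

theorem norm_toLp_le_of_abs_le {ι : Type*} [Fintype ι] {v : ι → ℝ} {E : ℝ} (hE : 0 ≤ E)
    (h : ∀ i, |v i| ≤ E) : ‖(WithLp.toLp 2 v : EuclideanSpace ℝ ι)‖ ≤ Real.sqrt (Fintype.card ι) * E := by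
  rw [EuclideanSpace.norm_eq]
  rw [← Real.sqrt_sq hE, ← Real.sqrt_mul (by positivity)]
  refine Real.sqrt_le_sqrt ?_
  calc ∑ i, ‖v i‖ ^ 2 ≤ ∑ _i : ι, E ^ 2 := by
        refine Finset.sum_le_sum fun i _ => ?_
        rw [Real.norm_eq_abs]
        have := h i
        gcongr
    _ = _ := by simp

/-- Mesh version of `adi_error_bound`. -/
theorem adi_mesh_error_bound {ι : Type*} [Fintype ι] [DecidableEq ι] {x y : ι → ℝ}
    {Bx By : Matrix ι ι ℝ} (hBx : ∀ v, v ⬝ᵥ (Bx *ᵥ v) ≤ 0) (hBy : ∀ v, v ⬝ᵥ (By *ᵥ v) ≤ 0)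
    (hXB : Commute (Matrix.diagonal x) By) (hYB : Commute (Matrix.diagonal y) Bx)
    (hBB : Commute Bx By) {M : ℝ} (hM : 0 ≤ M) (hxM : ∀ i, |x i| ≤ M) (hyM : ∀ i, |y i| ≤ M)
    {τ T ε : ℝ} (hτ : 0 ≤ τ) (hε : 0 ≤ ε) {N : ℕ} (hN : N * τ ≤ T) (hτT : τ ≤ T)
    (e a b d g : ℕ → ι → ℝ) (he0 : e 0 = 0)
    (he : ∀ n < N, ((1 - (τ / 2) • (Matrix.diagonal x * Matrix.diagonal x * Bx)) *
        (1 - (τ / 2) • (Matrix.diagonal y * Matrix.diagonal y * By))) *ᵥ e (n + 1) =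
      ((1 + (τ / 2) • (Matrix.diagonal x * Matrix.diagonal x * Bx)) *
        (1 + (τ / 2) • (Matrix.diagonal y * Matrix.diagonal y * By))) *ᵥ e n +
      τ • (a n + (Matrix.diagonal x * Matrix.diagonal x) *ᵥ b n +
        (Matrix.diagonal y * Matrix.diagonal y) *ᵥ d n +
        (Matrix.diagonal x * Matrix.diagonal x * (Matrix.diagonal y * Matrix.diagonal y)) *ᵥ g n))
    (ha : ∀ n < N, ∀ i, |a n i| ≤ ε) (hax : ∀ n < N, ∀ i, |(Bx *ᵥ a n) i| ≤ ε)
    (hay : ∀ n < N, ∀ i, |(By *ᵥ a n) i| ≤ ε) (haxy : ∀ n < N, ∀ i, |((Bx * By) *ᵥ a n) i| ≤ ε)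
    (hb : ∀ n < N, ∀ i, |b n i| ≤ ε) (hby : ∀ n < N, ∀ i, |(By *ᵥ b n) i| ≤ ε)
    (hd : ∀ n < N, ∀ i, |d n i| ≤ ε) (hdx : ∀ n < N, ∀ i, |(Bx *ᵥ d n) i| ≤ ε)
    (hg : ∀ n < N, ∀ i, |g n i| ≤ ε) (n : ℕ) (hn : n ≤ N) :
    Real.sqrt (∑ i, e n i ^ 2) ≤ adiConst M T * (Real.sqrt (Fintype.card ι) * ε) := by
  set Φ := Matrix.toLpLinAlgEquiv (n := ι) (R := ℝ) 2 with hΦ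
  have hap : ∀ (A : Matrix ι ι ℝ) (v : ι → ℝ), Φ A (WithLp.toLp 2 v) = WithLp.toLp 2 (A *ᵥ v) :=
    fun A v => Matrix.toLpLin_toLp 2 2 A v
  have hsym : ∀ z : ι → ℝ, ∀ v w : EuclideanSpace ℝ ι,
      inner ℝ (Φ (Matrix.diagonal z) v) w = inner ℝ v (Φ (Matrix.diagonal z) w) := by
    intro z v w
    have k : ∀ (v : EuclideanSpace ℝ ι) i, (Φ (Matrix.diagonal z) v) i = z i * v i := by
      intro v i
      simp [hΦ, Matrix.toLpLinAlgEquiv, Matrix.mulVec_diagonal]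
    rw [PiLp.inner_apply, PiLp.inner_apply]
    refine Finset.sum_congr rfl fun i _ => ?_
    rw [k, k]
    simp
    ring
  have hbd : ∀ z : ι → ℝ, (∀ i, |z i| ≤ M) → ∀ v : EuclideanSpace ℝ ι,
      ‖Φ (Matrix.diagonal z) v‖ ≤ M * ‖v‖ := by
    intro z hz v
    have k : ∀ i, (Φ (Matrix.diagonal z) v) i = z i * v i := by
      intro i
      simp [hΦ, Matrix.toLpLinAlgEquiv, Matrix.mulVec_diagonal]
    have hr : M * ‖v‖ = Real.sqrt (M ^ 2 * ∑ i, ‖v i‖ ^ 2) := by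
      rw [Real.sqrt_mul (by positivity), Real.sqrt_sq hM, EuclideanSpace.norm_eq]
    rw [hr, EuclideanSpace.norm_eq, Finset.mul_sum]
    refine Real.sqrt_le_sqrt (Finset.sum_le_sum fun i _ => ?_)
    rw [k, norm_mul, mul_pow, Real.norm_eq_abs]
    have := hz i
    gcongr
  have hcomm : ∀ {A B : Matrix ι ι ℝ}, Commute A B → Commute (Φ A) (Φ B) := fun h => h.map Φ
  have hcard : 0 ≤ Real.sqrt (Fintype.card ι) * ε := by positivity
  have hdx' : Dissipative (Φ Bx) := toLpLin_dissipative hBx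
  have hdy' : Dissipative (Φ By) := toLpLin_dissipative hBy
  have key := adi_error_bound (hsym x) (hsym y) hdx' hdy' (hcomm (Matrix.commute_diagonal x y)) (hcomm hXB) (hcomm hYB)
    (hcomm hBB) hM (hbd x hxM) (hbd y hyM) hτ hcard hN hτT
    (fun n => WithLp.toLp 2 (e n)) (fun n => WithLp.toLp 2 (a n)) (fun n => WithLp.toLp 2 (b n))
    (fun n => WithLp.toLp 2 (d n)) (fun n => WithLp.toLp 2 (g n)) (by simp [he0]) ?_
    (fun n hn => norm_toLp_le_of_abs_le hε (ha n hn)) ?_ ?_ ?_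
    (fun n hn => norm_toLp_le_of_abs_le hε (hb n hn)) ?_
    (fun n hn => norm_toLp_le_of_abs_le hε (hd n hn)) ?_
    (fun n hn => norm_toLp_le_of_abs_le hε (hg n hn)) n hn
  · refine le_of_eq_of_le ?_ key
    rw [EuclideanSpace.norm_eq]
    simp
  · intro n hn
    have h : Φ ((1 - (τ / 2) • (Matrix.diagonal x * Matrix.diagonal x * Bx)) *
        (1 - (τ / 2) • (Matrix.diagonal y * Matrix.diagonal y * By))) (WithLp.toLp 2 (e (n + 1))) =
      Φ ((1 + (τ / 2) • (Matrix.diagonal x * Matrix.diagonal x * Bx)) *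
        (1 + (τ / 2) • (Matrix.diagonal y * Matrix.diagonal y * By))) (WithLp.toLp 2 (e n)) +
      τ • (WithLp.toLp 2 (a n) + Φ (Matrix.diagonal x * Matrix.diagonal x) (WithLp.toLp 2 (b n)) +
        Φ (Matrix.diagonal y * Matrix.diagonal y) (WithLp.toLp 2 (d n)) +
        Φ (Matrix.diagonal x * Matrix.diagonal x * (Matrix.diagonal y * Matrix.diagonal y))
          (WithLp.toLp 2 (g n))) := by
      simp only [hap]
      rw [he n hn]
      rfl
    simp only [map_mul, map_sub, map_add, map_one, map_smul] at h
    simpa only [Module.End.mul_apply] using h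
  · intro n hn
    simp only [hap]
    exact norm_toLp_le_of_abs_le hε (hax n hn)
  · intro n hn
    simp only [hap]
    exact norm_toLp_le_of_abs_le hε (hay n hn)
  · intro n hn
    simp only [hap, Matrix.mulVec_mulVec]
    exact norm_toLp_le_of_abs_le hε (haxy n hn)
  · intro n hn
    simp only [hap]
    exact norm_toLp_le_of_abs_le hε (hby n hn)
  · intro n hn
    simp only [hap]
    exact norm_toLp_le_of_abs_le hε (hdx n hn)

end WSLD

namespace WSLD

open Filter Topology

/-! ### Midpoint rules in time -/

/-- Midpoint formulas for a function with three bounded derivatives. -/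
theorem midpoint_bounds {f₀ f₁ f₂ f₃ : ℝ → ℝ} {T K t τ : ℝ} (ht : 0 ≤ t) (hτ : 0 ≤ τ)
    (htT : t + τ ≤ T)
    (h₀ : ∀ s ∈ Icc 0 T, HasDerivWithinAt f₀ (f₁ s) (Icc 0 T) s)
    (h₁ : ∀ s ∈ Icc 0 T, HasDerivWithinAt f₁ (f₂ s) (Icc 0 T) s)
    (h₂ : ∀ s ∈ Icc 0 T, HasDerivWithinAt f₂ (f₃ s) (Icc 0 T) s)
    (b₁ : ∀ s ∈ Icc 0 T, |f₁ s| ≤ K) (b₂ : ∀ s ∈ Icc 0 T, |f₂ s| ≤ K)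
    (b₃ : ∀ s ∈ Icc 0 T, |f₃ s| ≤ K) :
    |f₀ (t + τ) - f₀ t| ≤ K * τ ∧
      |(f₀ (t + τ) + f₀ t) / 2 - f₀ (t + τ / 2)| ≤ K * τ ^ 2 ∧
      |f₀ (t + τ) - f₀ t - τ * f₁ (t + τ / 2)| ≤ K * τ ^ 3 := by
  set m := t + τ / 2 with hm
  have hsub : Icc t (t + τ) ⊆ Icc 0 T := Icc_subset_Icc ht htT
  have htm : t ∈ Icc t (t + τ) := ⟨le_rfl, by linarith⟩
  have htm' : t + τ ∈ Icc t (t + τ) := ⟨by linarith, le_rfl⟩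
  have hmm : m ∈ Icc t (t + τ) := ⟨by linarith, by linarith⟩
  have hK : 0 ≤ K := (abs_nonneg _).trans (b₁ t (hsub htm))
  have mvt : ∀ {f f' : ℝ → ℝ} {C : ℝ},
      (∀ s ∈ Icc t (t + τ), HasDerivWithinAt f (f' s) (Icc t (t + τ)) s) →
      (∀ s ∈ Icc t (t + τ), |f' s| ≤ C) → ∀ s ∈ Icc t (t + τ), ∀ r ∈ Icc t (t + τ),
      |f r - f s| ≤ C * τ := by
    intro f f' C hf hC s hs r hr
    have h := (convex_Icc t (t + τ)).norm_image_sub_le_of_norm_hasDerivWithin_le hf hC hs hr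
    have hC0 : 0 ≤ C := (abs_nonneg _).trans (hC t htm)
    refine h.trans ?_
    have : ‖r - s‖ ≤ τ := by
      rw [Real.norm_eq_abs, abs_le]
      constructor <;> linarith [hs.1, hs.2, hr.1, hr.2]
    gcongr
  have d₀ := fun s hs => (h₀ s (hsub hs)).mono hsub
  have d₁ := fun s hs => (h₁ s (hsub hs)).mono hsub
  have d₂ := fun s hs => (h₂ s (hsub hs)).mono hsub
  have r₁ : ∀ s ∈ Icc t (t + τ), |f₁ s - f₁ m| ≤ K * τ := fun s hs =>
    mvt d₁ (fun s hs => b₂ s (hsub hs)) m hmm s hs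
  have r₂ : ∀ s ∈ Icc t (t + τ), |f₂ s - f₂ m| ≤ K * τ := fun s hs =>
    mvt d₂ (fun s hs => b₃ s (hsub hs)) m hmm s hs
  refine ⟨mvt d₀ (fun s hs => b₁ s (hsub hs)) t htm _ htm', ?_, ?_⟩
  · have e : ∀ s ∈ Icc t (t + τ), |f₀ s - f₀ m - f₁ m * (s - m)| ≤ K * τ * τ := by
      intro s hs
      have := mvt (f := fun s => f₀ s - f₁ m * (s - m)) (f' := fun s => f₁ s - f₁ m)
        (fun s hs => by
          have k1 := (((hasDerivAt_id s).sub_const m).const_mul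
            (f₁ m)).hasDerivWithinAt (s := Icc t (t + τ))
          exact ((d₀ s hs).sub k1).congr_deriv (by simp)) r₁ m hmm s hs
      simp only [sub_self, mul_zero, sub_zero] at this
      rwa [sub_right_comm] at this
    have e1 := abs_le.1 (e _ htm)
    have e2 := abs_le.1 (e _ htm')
    rw [abs_le]
    have k1 : f₁ m * (t - m) + f₁ m * (t + τ - m) = 0 := by rw [hm]; ring
    constructor <;> nlinarith
  · have e : ∀ s ∈ Icc t (t + τ), |f₁ s - f₁ m - f₂ m * (s - m)| ≤ K * τ * τ := by
      intro s hs
      have := mvt (f := fun s => f₁ s - f₂ m * (s - m)) (f' := fun s => f₂ s - f₂ m)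
        (fun s hs => by
          have k1 := (((hasDerivAt_id s).sub_const m).const_mul
            (f₂ m)).hasDerivWithinAt (s := Icc t (t + τ))
          exact ((d₁ s hs).sub k1).congr_deriv (by simp)) r₂ m hmm s hs
      simp only [sub_self, mul_zero, sub_zero] at this
      rwa [sub_right_comm] at this
    -- The quadratic term takes the same value at `t` and `t + τ`, symmetric about `m`, so it
    -- disappears from the difference and a third order error remains.
    have := mvt (f := fun s => f₀ s - f₁ m * s - f₂ m * (s - m) ^ 2 / 2)
      (f' := fun s => f₁ s - f₁ m - f₂ m * (s - m)) (fun s hs => by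
        have k1 := (((hasDerivAt_id s).const_mul (f₁ m))).hasDerivWithinAt (s := Icc t (t + τ))
        have k2 := (((((hasDerivAt_id s).sub_const m).pow 2).const_mul
            (f₂ m)).div_const 2).hasDerivWithinAt (s := Icc t (t + τ))
        refine (((d₀ s hs).sub k1).sub k2).congr_deriv ?_
        simp
        ring) e t htm _ htm'
    refine le_of_eq_of_le ?_ (this.trans (le_of_eq (by ring)))
    congr 1
    rw [hm]
    ring

/-! ### Fourier multipliers in the plane -/

/-- The functional `F` acts on functions supported in `[a,b]` by the Fourier multiplier `m` and
evaluation at `x`, and `m` is bounded by `C (1+|θ|)^p`. -/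
structure IsMultiplierAt (a b x p C : ℝ) (m : ℝ → ℂ) (F : (ℝ → ℝ) → ℝ) : Prop where
  measurable : Measurable m
  norm_le : ∀ θ, ‖m θ‖ ≤ C * (1 + |θ|) ^ p
  map_zero : F (fun _ => 0) = 0
  eq : ∀ {k : ℝ × ℝ → ℝ} {φ : ℝ × ℝ → ℂ} {v : ℝ → ℝ}, FourierRep volume k φ v →
    Integrable (fun ω => (1 + |k ω|) ^ p * ‖φ ω‖) → (∀ x, x ≤ a ∨ b ≤ x → v x = 0) →
    (F v : ℂ) = ∫ ω, φ ω * m (k ω) * Complex.exp (-((k ω * x : ℝ) : ℂ) * Complex.I)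

theorem IsMultiplierAt.nonneg {a b x p C : ℝ} {m : ℝ → ℂ} {F : (ℝ → ℝ) → ℝ}
    (h : IsMultiplierAt a b x p C m F) : 0 ≤ C := by
  have := (norm_nonneg _).trans (h.norm_le 0)
  simpa using this

theorem isMultiplierAt_eval (a b x : ℝ) {p : ℝ} (hp : 0 ≤ p) :
    IsMultiplierAt a b x p 1 (fun _ => 1) (fun v => v x) where
  measurable := measurable_const
  norm_le θ := by
    have := Real.one_le_rpow (by linarith [abs_nonneg θ] : 1 ≤ 1 + |θ|) hp
    simpa using this
  map_zero := rfl
  eq hv _ _ := by simp only [hv.eq, mul_one]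

theorem abs_rpow_le_one_add {p : ℝ} (hp : 0 ≤ p) (θ : ℝ) : |θ| ^ p ≤ (1 + |θ|) ^ p := by
  gcongr; linarith

/-- The rows of the difference matrix and of its truncation error are multipliers, uniformly in
the mesh. -/
theorem exists_isMultiplierAt_diff {α κ a b : ℝ} (h1 : 1 < α) (h2 : α < 2) (hκ : 0 ≤ κ)
    (hab : a < b) {P : Shifts} (hP : IsStableFourthOrder α (P.weight α) P.shift) :
    ∃ C : ℝ, 1 ≤ C ∧ ∀ N : ℕ, 0 < N → ∀ i : Fin (N - 1),
      (∃ m, IsMultiplierAt a b (node a b N i) α C m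
        (fun v => (diffMatrix α κ P a b N *ᵥ fun j => v (node a b N j)) i)) ∧
      (∃ m, IsMultiplierAt a b (node a b N i) (α + 4) (C * step a b N ^ 4) m
        (fun v => (diffMatrix α κ P a b N *ᵥ fun j => v (node a b N j)) i -
          twoSidedRL α κ a b v (node a b N i))) := by
  obtain ⟨C, hC, hb⟩ := exists_diffSymbol_bounds h1 hκ hP
  refine ⟨C + 1, by linarith, fun N hN i => ?_⟩
  have hN' : (0 : ℝ) < N := by exact_mod_cast hN
  have hs : 0 < step a b N := div_pos (by linarith) hN'
  have hsN : N * step a b N = b - a := by rw [step]; field_simp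
  have hx : node a b N i ∈ Ioo a b := by
    have hi := i.2
    have : ((i : ℕ) : ℝ) + 1 < N := by exact_mod_cast (by omega : (i : ℕ) + 1 < N)
    rw [node]
    constructor
    · have : 0 < (((i : ℕ) : ℝ) + 1) * step a b N := by positivity
      linarith
    · nlinarith
  have hα : 0 ≤ α := by linarith
  constructor
  · refine ⟨_, measurable_diffSymbol h1 h2 κ P (step a b N), fun θ => ?_, ?_,
      fun hv _ h0 => hv.diffMatrix_mulVec h1 h2 hN hab h0 i⟩
    · refine ((hb _ θ hs).1).trans ?_
      have := abs_rpow_le_one_add hα θ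
      gcongr
      linarith
    · have : (fun _ : Fin (N - 1) => (0 : ℝ)) = 0 := rfl
      simp [this]
  · refine ⟨fun θ => diffSymbol α κ P (step a b N) θ - rlSymbol α κ θ,
      (measurable_diffSymbol h1 h2 κ P _).sub (measurable_rlSymbol α κ), fun θ => ?_, ?_, ?_⟩
    · refine ((hb _ θ hs).2).trans ?_
      have := abs_rpow_le_one_add (by linarith : 0 ≤ α + 4) θ
      gcongr
      linarith
    · have : (fun _ : Fin (N - 1) => (0 : ℝ)) = 0 := rfl
      simp [this, twoSidedRL, leftRL, rightRL]
    · intro k φ v hv hi h0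
      have hmono : ∀ {q : ℝ}, q ≤ α + 4 → Integrable (fun ω => (1 + |k ω|) ^ q * ‖φ ω‖) := by
        intro q hq
        refine hi.mono' ?_ (Eventually.of_forall fun ω => ?_)
        · exact ((measurable_const.add (continuous_abs.measurable.comp hv.measurable)).pow_const
            q).aestronglyMeasurable.mul hv.integrable.aestronglyMeasurable.norm
        · rw [Real.norm_of_nonneg (by positivity)]
          gcongr
          linarith [abs_nonneg (k ω)]
      have hk2 : Integrable (fun ω => (1 + |k ω|) ^ 2 * ‖φ ω‖) := by
        have := hmono (q := (2 : ℕ)) (by push_cast; linarith)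
        simpa only [Real.rpow_natCast] using this
      have hkα := hmono (q := α) (by linarith)
      rw [Complex.ofReal_sub, hv.diffMatrix_mulVec h1 h2 hN hab h0 i,
        hv.twoSidedRL_eq h1 h2 hk2 h0 hx, ← integral_sub]
      · refine integral_congr_ae (Eventually.of_forall fun ω => ?_)
        simp only
        ring
      · exact integrable_mul_phase hv.measurable (integrable_mul_symbol
          (measurable_diffSymbol h1 h2 κ P _) hα (fun θ => (hb _ θ hs).1) hv.measurable
          hv.integrable hkα) _
      · exact integrable_mul_phase hv.measurable (integrable_mul_symbol
          (measurable_rlSymbol α κ) hα (norm_rlSymbol_le hκ) hv.measurable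
          hv.integrable hkα) _

/-- Bound for a product of multipliers in the two coordinates. -/
theorem abs_multiplier_le {xL xR yL yR x y p q C D K : ℝ} {m n : ℝ → ℂ} {F G : (ℝ → ℝ) → ℝ}
    (hp : 0 ≤ p) (hq : 0 ≤ q) (hF : IsMultiplierAt xL xR x p C m F)
    (hG : IsMultiplierAt yL yR y q D n G) {V : ℝ × ℝ → ℝ} (hV : FourierBound p q K V)
    (h0 : ∀ z ∉ domain xL xR yL yR, V z = 0) :
    |G fun y => F fun x => V (x, y)| ≤ C * D * K := by
  set φ : ℝ × ℝ → ℂ := fun ω => (((2 * Real.pi) ^ 2)⁻¹ : ℝ) * fourier2 V ω with hφ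
  have hf2 := hV.integrable_fourier2 hp hq
  have hφi : Integrable φ := hf2.const_mul _
  have hc : ‖((((2 * Real.pi) ^ 2)⁻¹ : ℝ) : ℂ)‖ ≤ 1 := by
    rw [Complex.norm_real, Real.norm_of_nonneg (by positivity)]
    refine inv_le_one_of_one_le₀ ?_
    have := Real.pi_gt_three
    nlinarith
  have hφn : ∀ ω, ‖φ ω‖ ≤ ‖fourier2 V ω‖ := by
    intro ω
    rw [hφ, norm_mul]
    exact mul_le_of_le_one_left (norm_nonneg _) hc
  have hw : ∀ {s t : ℝ}, s ≤ p → t ≤ q → Integrable (fun ω : ℝ × ℝ =>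
      (1 + |ω.1|) ^ s * (1 + |ω.2|) ^ t * ‖φ ω‖) := by
    intro s t hs ht
    refine hV.integrable_fourier.mono' ?_ (Eventually.of_forall fun ω => ?_)
    · refine AEStronglyMeasurable.mul ?_ hφi.aestronglyMeasurable.norm
      refine Measurable.aestronglyMeasurable ?_
      have : Measurable fun r : ℝ => |r| := continuous_abs.measurable
      fun_prop
    · rw [Real.norm_of_nonneg (by positivity)]
      gcongr
      · linarith [abs_nonneg ω.1]
      · linarith [abs_nonneg ω.2]
      · exact hφn ω
  -- For frozen `y`, plane inversion is a Fourier integral in `x` over both frequencies, with `k =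
  -- ω₁`. Applying `F` multiplies the density by `m ω₁`, and the result is a Fourier integral in `y`
  -- with `k = ω₂`, ready for `G`.
  have hrep : ∀ y, FourierRep volume Prod.fst
      (fun ω : ℝ × ℝ => φ ω * Complex.exp (-((ω.2 * y : ℝ) : ℂ) * Complex.I))
      (fun x => V (x, y)) := by
    intro y
    refine ⟨measurable_fst, integrable_mul_phase measurable_snd hφi y, fun x => ?_⟩
    rw [eq_integral_fourier2 hV.continuous hV.integrable hf2]
    refine integral_congr_ae (Eventually.of_forall fun ω => ?_)
    simp only
    rw [mul_assoc _ (Complex.exp _), ← Complex.exp_add]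
    congr 2
    push_cast
    ring
  set φ' : ℝ × ℝ → ℂ := fun ω => φ ω * m ω.1 *
    Complex.exp (-((ω.1 * x : ℝ) : ℂ) * Complex.I) with hφ'
  have hm1 : ∀ ω : ℝ × ℝ, ‖φ' ω‖ ≤ C * ((1 + |ω.1|) ^ p * ‖φ ω‖) := by
    intro ω
    rw [hφ', norm_mul, norm_exp_neg_ofReal_mul_I, mul_one, norm_mul, mul_comm]
    calc _ ≤ (C * (1 + |ω.1|) ^ p) * ‖φ ω‖ := by gcongr; exact hF.norm_le _
      _ = _ := by ring
  have hφ'm : AEStronglyMeasurable φ' volume := by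
    refine (hφi.aestronglyMeasurable.mul
      (hF.measurable.comp measurable_fst).aestronglyMeasurable).mul ?_
    refine Measurable.aestronglyMeasurable ?_
    fun_prop
  have hφ'w : Integrable (fun ω : ℝ × ℝ => (1 + |ω.2|) ^ q * ‖φ' ω‖) := by
    refine ((hw le_rfl le_rfl).const_mul C).mono' ?_ (Eventually.of_forall fun ω => ?_)
    · refine AEStronglyMeasurable.mul ?_ hφ'm.norm
      refine Measurable.aestronglyMeasurable ?_
      have : Measurable fun r : ℝ => |r| := continuous_abs.measurable
      fun_prop
    · rw [Real.norm_of_nonneg (by positivity)]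
      calc _ ≤ (1 + |ω.2|) ^ q * (C * ((1 + |ω.1|) ^ p * ‖φ ω‖)) := by gcongr; exact hm1 ω
        _ = _ := by ring
  have hφ'i : Integrable φ' := by
    refine hφ'w.mono' hφ'm (Eventually.of_forall fun ω => ?_)
    exact le_mul_of_one_le_left (norm_nonneg _)
      (Real.one_le_rpow (by linarith [abs_nonneg ω.2]) hq)
  have hrep' : FourierRep volume Prod.snd φ' (fun y => F fun x => V (x, y)) := by
    refine ⟨measurable_snd, hφ'i, fun y => ?_⟩
    rw [hF.eq (hrep y) ?_ ?_]
    · refine integral_congr_ae (Eventually.of_forall fun ω => ?_)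
      simp only [hφ']
      ring
    · have := hw (s := p) (t := 0) le_rfl hq
      simp only [Real.rpow_zero, mul_one] at this
      refine this.congr (Eventually.of_forall fun ω => ?_)
      simp only
      rw [norm_mul (φ ω), norm_exp_neg_ofReal_mul_I, mul_one]
    · intro x hx
      refine h0 _ fun hz => ?_
      have := hz.1
      simp only [mem_Ioo] at this
      rcases hx with hx | hx <;> linarith [this.1, this.2]
  have hz : ∀ y, y ≤ yL ∨ yR ≤ y → (F fun x => V (x, y)) = 0 := by
    intro y hy
    have : (fun x => V (x, y)) = fun _ => 0 := by
      funext x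
      refine h0 _ fun hz => ?_
      have := hz.2
      simp only [mem_Ioo] at this
      rcases hy with hy | hy <;> linarith [this.1, this.2]
    rw [this, hF.map_zero]
  have e := hG.eq hrep' hφ'w hz
  have habs : |G fun y => F fun x => V (x, y)| = ‖((G fun y => F fun x => V (x, y) : ℝ) : ℂ)‖ := by
    rw [Complex.norm_real, Real.norm_eq_abs]
  rw [habs, e]
  refine (norm_integral_le_integral_norm _).trans ?_
  have hCD : 0 ≤ C * D := mul_nonneg hF.nonneg hG.nonneg
  calc _ ≤ ∫ ω : ℝ × ℝ, C * D * ((1 + |ω.1|) ^ p * (1 + |ω.2|) ^ q * ‖fourier2 V ω‖) := by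
        refine integral_mono_of_nonneg (Eventually.of_forall fun ω => norm_nonneg _)
          (hV.integrable_fourier.const_mul _) (Eventually.of_forall fun ω => ?_)
        simp only
        rw [norm_mul, norm_exp_neg_ofReal_mul_I, mul_one, norm_mul]
        calc ‖φ' ω‖ * ‖n ω.2‖ ≤ (C * ((1 + |ω.1|) ^ p * ‖φ ω‖)) * (D * (1 + |ω.2|) ^ q) :=
              mul_le_mul (hm1 ω) (hG.norm_le _) (norm_nonneg _) (by have := hF.nonneg; positivity)
          _ = C * D * ((1 + |ω.1|) ^ p * (1 + |ω.2|) ^ q * ‖φ ω‖) := by ring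
          _ ≤ _ := by gcongr; exact hφn ω
    _ ≤ _ := by
        rw [integral_const_mul]
        exact mul_le_mul_of_nonneg_left hV.integral_le hCD

end WSLD

namespace WSLD

open Filter Topology

/-! ### Bounds for mesh functions of the solution class -/

theorem fourier2_comp_swap (V : ℝ × ℝ → ℝ) (ω : ℝ × ℝ) :
    fourier2 (fun p => V p.swap) ω = fourier2 V ω.swap := by
  rw [fourier2, fourier2, Measure.volume_eq_prod, ← integral_prod_swap]
  refine integral_congr_ae (Eventually.of_forall fun p => ?_)
  simp only [Prod.swap_swap, Prod.fst_swap, Prod.snd_swap]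
  rw [add_comm]

theorem FourierBound.swap {a b K : ℝ} {V : ℝ × ℝ → ℝ} (h : FourierBound a b K V) :
    FourierBound b a K fun p => V p.swap := by
  have e : (fun ω : ℝ × ℝ => (1 + |ω.1|) ^ b * (1 + |ω.2|) ^ a *
      ‖fourier2 (fun p => V p.swap) ω‖) = fun ω : ℝ × ℝ =>
      (fun ω : ℝ × ℝ => (1 + |ω.1|) ^ a * (1 + |ω.2|) ^ b * ‖fourier2 V ω‖) ω.swap := by
    funext ω
    simp only [fourier2_comp_swap, Prod.fst_swap, Prod.snd_swap]
    ring
  refine ⟨h.continuous.comp continuous_swap, ?_, ?_, ?_⟩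
  · exact h.integrable.swap
  · rw [e]
    exact h.integrable_fourier.swap
  · have := integral_prod_swap (μ := (volume : Measure ℝ)) (ν := (volume : Measure ℝ))
      (fun ω : ℝ × ℝ => (1 + |ω.1|) ^ a * (1 + |ω.2|) ^ b * ‖fourier2 V ω‖)
    rw [e]
    exact this.le.trans h.integral_le

theorem swap_notMem_domain {xL xR yL yR : ℝ} {z : ℝ × ℝ} (h : z ∉ domain yL yR xL xR) :
    z.swap ∉ domain xL xR yL yR := fun hz => h ⟨hz.2, hz.1⟩

/-- Uniform bounds for difference quotients and truncation errors of functions in the Fourier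
classes. -/
theorem exists_row_bounds {α β κα κβ xL xR yL yR : ℝ} (hα : 1 < α ∧ α < 2) (hβ : 1 < β ∧ β < 2)
    (hκα : 0 ≤ κα) (hκβ : 0 ≤ κβ) (hx : xL < xR) (hy : yL < yR) {P : Shifts}
    (hPα : IsStableFourthOrder α (P.weight α) P.shift)
    (hPβ : IsStableFourthOrder β (P.weight β) P.shift) :
    ∃ C : ℝ, 1 ≤ C ∧ ∀ Nx Ny : ℕ, 0 < Nx → 0 < Ny → ∀ (i : Fin (Nx - 1)) (j : Fin (Ny - 1))
      (R S : (ℝ → ℝ) → ℝ)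
      (_ : R = fun v => (diffMatrix α κα P xL xR Nx *ᵥ fun i' => v (node xL xR Nx i')) i)
      (_ : S = fun v => (diffMatrix β κβ P yL yR Ny *ᵥ fun j' => v (node yL yR Ny j')) j)
      (V : ℝ × ℝ → ℝ) (K : ℝ), (∀ z ∉ domain xL xR yL yR, V z = 0) →
      (FourierBound α β K V → |V (node xL xR Nx i, node yL yR Ny j)| ≤ C * K ∧
        |R fun x => V (x, node yL yR Ny j)| ≤ C * K ∧
        |S fun y => V (node xL xR Nx i, y)| ≤ C * K ∧
        |S fun y => R fun x => V (x, y)| ≤ C * K) ∧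
      (FourierBound (α + 4) β K V →
        |(R fun x => V (x, node yL yR Ny j)) -
          twoSidedRL α κα xL xR (fun x => V (x, node yL yR Ny j)) (node xL xR Nx i)| ≤
            C * step xL xR Nx ^ 4 * K ∧
        |S fun y => (R fun x => V (x, y)) -
          twoSidedRL α κα xL xR (fun x => V (x, y)) (node xL xR Nx i)| ≤
            C * step xL xR Nx ^ 4 * K) ∧
      (FourierBound α (β + 4) K V →
        |(S fun y => V (node xL xR Nx i, y)) -
          twoSidedRL β κβ yL yR (fun y => V (node xL xR Nx i, y)) (node yL yR Ny j)| ≤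
            C * step yL yR Ny ^ 4 * K ∧
        |R fun x => (S fun y => V (x, y)) -
          twoSidedRL β κβ yL yR (fun y => V (x, y)) (node yL yR Ny j)| ≤
            C * step yL yR Ny ^ 4 * K) := by
  obtain ⟨C, hC, hCx⟩ := exists_isMultiplierAt_diff hα.1 hα.2 hκα hx hPα
  obtain ⟨D, hD, hDy⟩ := exists_isMultiplierAt_diff hβ.1 hβ.2 hκβ hy hPβ
  have hα0 : 0 ≤ α := by linarith [hα.1]
  have hβ0 : 0 ≤ β := by linarith [hβ.1]
  have hα4 : 0 ≤ α + 4 := by linarith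
  have hβ4 : 0 ≤ β + 4 := by linarith
  have hCD : 1 ≤ C * D := one_le_mul_of_one_le_of_one_le hC hD
  refine ⟨C * D, hCD, fun Nx Ny hNx hNy i j R S hR hS V K h0 => ?_⟩
  subst hR hS
  obtain ⟨⟨m, hm⟩, ⟨m', hm'⟩⟩ := hCx Nx hNx i
  obtain ⟨⟨n, hn⟩, ⟨n', hn'⟩⟩ := hDy Ny hNy j
  have ex := isMultiplierAt_eval xL xR (node xL xR Nx i) hα0
  have ey := isMultiplierAt_eval yL yR (node yL yR Ny j) hβ0
  have hKn : ∀ {a b : ℝ}, FourierBound a b K V → 0 ≤ K := fun h =>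
    (integral_nonneg fun ω => by positivity).trans h.integral_le
  have hsx : 0 ≤ step xL xR Nx := div_nonneg (by linarith) (Nat.cast_nonneg _)
  have hsy : 0 ≤ step yL yR Ny := div_nonneg (by linarith) (Nat.cast_nonneg _)
  have hCle : C ≤ C * D := le_mul_of_one_le_right (by linarith) hD
  have hDle : D ≤ C * D := le_mul_of_one_le_left (by linarith) hC
  refine ⟨fun h => ?_, fun h => ?_, fun h => ?_⟩
  · have hK := hKn h
    refine ⟨?_, ?_, ?_, abs_multiplier_le hα0 hβ0 hm hn h h0⟩
    · refine (abs_multiplier_le hα0 hβ0 ex ey h h0).trans ?_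
      gcongr
    · refine (abs_multiplier_le hα0 hβ0 hm ey h h0).trans ?_
      rw [mul_one]
      gcongr
    · refine (abs_multiplier_le hα0 hβ0 ex hn h h0).trans ?_
      rw [one_mul]
      gcongr
  · have hK := hKn h
    constructor
    · refine (abs_multiplier_le hα4 hβ0 hm' ey h h0).trans ?_
      rw [mul_one]
      gcongr
    · refine (abs_multiplier_le hα4 hβ0 hm' hn h h0).trans (le_of_eq ?_)
      ring
  · have hK := hKn h
    have h0' : ∀ z ∉ domain yL yR xL xR, (fun p : ℝ × ℝ => V p.swap) z = 0 :=
      fun z hz => h0 _ (swap_notMem_domain hz)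
    constructor
    · refine (abs_multiplier_le hβ4 hα0 hn' ex h.swap h0').trans ?_
      rw [mul_one]
      gcongr
    · refine (abs_multiplier_le hβ4 hα0 hn' hm h.swap h0').trans (le_of_eq ?_)
      ring

/-! ### The matrices of the scheme -/

theorem coeffMatrix_eq {α κ a b : ℝ} {P : Shifts} {N : ℕ} {dp dm : ℝ → ℝ} (hab : a < b)
    (hN : 0 < N) (hdm : ∀ i : Fin (N - 1), dm (node a b N i) = κ * dp (node a b N i)) :
    coeffMatrix α P a b N dp dm = step a b N ^ α •
      (Matrix.diagonal (fun i => dp (node a b N i)) * diffMatrix α κ P a b N) := by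
  have hs : 0 < step a b N := div_pos (by linarith) (by exact_mod_cast hN)
  have hs' : step a b N ^ α ≠ 0 := (Real.rpow_pos_of_pos hs _).ne'
  ext i j
  simp only [coeffMatrix, diffMatrix, Matrix.add_apply, Matrix.smul_apply, Matrix.diagonal_mul,
    Matrix.transpose_apply, smul_eq_mul, hdm]
  field_simp

theorem Ax_eq {α κ xL xR τ : ℝ} {P : Shifts} {Nx Ny : ℕ} {dp dm : ℝ → ℝ} (hx : xL < xR)
    (hN : 0 < Nx) (hdm : ∀ i : Fin (Nx - 1), dm (node xL xR Nx i) = κ * dp (node xL xR Nx i)) :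
    Ax α P xL xR Nx Ny τ dp dm = (τ / 2) • (Matrix.diagonal (fun l : Idx Nx Ny =>
      dp (node xL xR Nx l.2)) * (1 ⊗ₖ diffMatrix α κ P xL xR Nx)) := by
  have hs : 0 < step xL xR Nx := div_pos (by linarith) (by exact_mod_cast hN)
  have hs' : step xL xR Nx ^ α ≠ 0 := (Real.rpow_pos_of_pos hs _).ne'
  rw [Ax, coeffMatrix_eq hx hN hdm]
  ext k l
  simp only [Matrix.smul_apply, Matrix.diagonal_mul, Matrix.kroneckerMap_apply, smul_eq_mul]
  field_simp

theorem Ay_eq {β κ yL yR τ : ℝ} {P : Shifts} {Nx Ny : ℕ} {ep em : ℝ → ℝ} (hy : yL < yR)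
    (hN : 0 < Ny) (hem : ∀ j : Fin (Ny - 1), em (node yL yR Ny j) = κ * ep (node yL yR Ny j)) :
    Ay β P yL yR Nx Ny τ ep em = (τ / 2) • (Matrix.diagonal (fun l : Idx Nx Ny =>
      ep (node yL yR Ny l.1)) * (diffMatrix β κ P yL yR Ny ⊗ₖ 1)) := by
  have hs : 0 < step yL yR Ny := div_pos (by linarith) (by exact_mod_cast hN)
  have hs' : step yL yR Ny ^ β ≠ 0 := (Real.rpow_pos_of_pos hs _).ne'
  rw [Ay, coeffMatrix_eq hy hN hem]
  ext k l
  simp only [Matrix.smul_apply, Matrix.diagonal_mul, Matrix.kroneckerMap_apply, smul_eq_mul]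
  field_simp

theorem dotProduct_diffMatrix_nonpos {α κ a b : ℝ} (h1 : 1 < α) (h2 : α < 2) (hκ : 0 ≤ κ)
    (hab : a < b) {P : Shifts} (h : IsStableFourthOrder α (P.weight α) P.shift) {N : ℕ}
    (v : Fin (N - 1) → ℝ) : v ⬝ᵥ (diffMatrix α κ P a b N *ᵥ v) ≤ 0 := by
  have hs : 0 ≤ step a b N := div_nonneg (by linarith) (Nat.cast_nonneg _)
  rw [diffMatrix, Matrix.smul_mulVec, dotProduct_smul, smul_eq_mul]
  exact mul_nonpos_of_nonneg_of_nonpos (by positivity)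
    (dotProduct_A4_add_transpose_nonpos h1 h2 hκ h v)

theorem commute_diagonal_snd_kronecker_one {m n : Type*} [Fintype m] [Fintype n] [DecidableEq m]
    [DecidableEq n] (x : n → ℝ) (B : Matrix m m ℝ) :
    Commute (Matrix.diagonal fun l : m × n => x l.2) (B ⊗ₖ (1 : Matrix n n ℝ)) := by
  ext k l
  rw [Matrix.diagonal_mul, Matrix.mul_diagonal, Matrix.kroneckerMap_apply]
  by_cases h : k.2 = l.2
  · rw [h]; ring
  · rw [Matrix.one_apply_ne h]; ring

theorem commute_diagonal_fst_one_kronecker {m n : Type*} [Fintype m] [Fintype n] [DecidableEq m]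
    [DecidableEq n] (y : m → ℝ) (B : Matrix n n ℝ) :
    Commute (Matrix.diagonal fun l : m × n => y l.1) ((1 : Matrix m m ℝ) ⊗ₖ B) := by
  ext k l
  rw [Matrix.diagonal_mul, Matrix.mul_diagonal, Matrix.kroneckerMap_apply]
  by_cases h : k.1 = l.1
  · rw [h]; ring
  · rw [Matrix.one_apply_ne h]; ring

theorem commute_one_kronecker_kronecker_one {m n : Type*} [Fintype m] [Fintype n] [DecidableEq m]
    [DecidableEq n] (A : Matrix n n ℝ) (B : Matrix m m ℝ) :
    Commute ((1 : Matrix m m ℝ) ⊗ₖ A) (B ⊗ₖ (1 : Matrix n n ℝ)) := by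
  rw [Commute, SemiconjBy, ← Matrix.mul_kronecker_mul, ← Matrix.mul_kronecker_mul]
  simp

/-- The residual of one step of the scheme, split according to the coefficients. -/
theorem residual_identity {ι : Type*} [Fintype ι] [DecidableEq ι] {X Y Bx By : Matrix ι ι ℝ}
    (hYB : Commute Y Bx) {τ : ℝ} (hτ : τ ≠ 0) {w w' z F Lx Ly : ι → ℝ}
    (hz : z = (X * X) *ᵥ Lx + (Y * Y) *ᵥ Ly + F) {U U' : ι → ℝ}
    (hU : ((1 - (τ / 2) • (X * X * Bx)) * (1 - (τ / 2) • (Y * Y * By))) *ᵥ U' =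
      ((1 + (τ / 2) • (X * X * Bx)) * (1 + (τ / 2) • (Y * Y * By))) *ᵥ U + τ • F) :
    ((1 - (τ / 2) • (X * X * Bx)) * (1 - (τ / 2) • (Y * Y * By))) *ᵥ (w' - U') =
      ((1 + (τ / 2) • (X * X * Bx)) * (1 + (τ / 2) • (Y * Y * By))) *ᵥ (w - U) +
      τ • ((τ⁻¹ • (w' - w) - z) + (X * X) *ᵥ (Lx - (1 / 2 : ℝ) • (Bx *ᵥ (w' + w))) +
        (Y * Y) *ᵥ (Ly - (1 / 2 : ℝ) • (By *ᵥ (w' + w))) +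
        (X * X * (Y * Y)) *ᵥ ((τ / 4) • ((Bx * By) *ᵥ (w' - w)))) := by
  have hc : ∀ v, Bx *ᵥ (Y *ᵥ v) = Y *ᵥ (Bx *ᵥ v) := fun v => by
    rw [Matrix.mulVec_mulVec, Matrix.mulVec_mulVec, hYB.eq]
  obtain ⟨q, hq⟩ : ∃ q, q = τ⁻¹ • (w' - w) := ⟨_, rfl⟩
  have hw : w' = w + τ • q := by
    rw [hq, smul_smul, mul_inv_cancel₀ hτ, one_smul]; abel
  rw [← hq, Matrix.mulVec_sub, hU, hz, Matrix.mulVec_sub, hw]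
  simp only [sub_mul, mul_sub, add_mul, mul_add, one_mul, mul_one, Matrix.sub_mulVec,
    Matrix.add_mulVec, Matrix.mulVec_add, Matrix.mulVec_sub, Matrix.smul_mulVec,
    Matrix.mulVec_smul, Matrix.one_mulVec, smul_mul_assoc, mul_smul_comm, ← Matrix.mulVec_mulVec,
    hc]
  module

end WSLD

namespace WSLD

open Filter Topology

/-! ### Consistency of the scheme -/

/-- The derivatives see only `z` near `x`, where the integral uses values strictly between `a` and
`b`. This allows passing from `u` to its zero extension. -/
theorem leftRL_congr {α a b x : ℝ} {v w : ℝ → ℝ} (hx : x ∈ Ioo a b)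
    (h : ∀ ξ ∈ Ioo a b, v ξ = w ξ) : leftRL α a v x = leftRL α a w x := by
  have e : (fun z => ∫ ξ in a..z, (z - ξ) ^ (1 - α) * v ξ) =ᶠ[𝓝 x]
      fun z => ∫ ξ in a..z, (z - ξ) ^ (1 - α) * w ξ := by
    filter_upwards [Ioo_mem_nhds hx.1 hx.2] with z hz
    rw [intervalIntegral.integral_of_le hz.1.le, intervalIntegral.integral_of_le hz.1.le]
    refine setIntegral_congr_fun measurableSet_Ioc fun ξ hξ => ?_
    rw [h ξ ⟨hξ.1, hξ.2.trans_lt hz.2⟩]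
  rw [leftRL, leftRL, e.deriv.deriv_eq]

theorem rightRL_congr {α a b x : ℝ} {v w : ℝ → ℝ} (hx : x ∈ Ioo a b)
    (h : ∀ ξ ∈ Ioo a b, v ξ = w ξ) : rightRL α b v x = rightRL α b w x := by
  rw [rightRL_eq_leftRL, rightRL_eq_leftRL]
  refine leftRL_congr (b := -a) ⟨by linarith [hx.2], by linarith [hx.1]⟩ fun ξ hξ => ?_
  exact h _ ⟨by linarith [hξ.2], by linarith [hξ.1]⟩

theorem twoSidedRL_congr {α κ a b x : ℝ} {v w : ℝ → ℝ} (hx : x ∈ Ioo a b)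
    (h : ∀ ξ ∈ Ioo a b, v ξ = w ξ) : twoSidedRL α κ a b v x = twoSidedRL α κ a b w x := by
  rw [twoSidedRL, twoSidedRL, leftRL_congr hx h, rightRL_congr hx h]

theorem node_mem_Ioo {a b : ℝ} (hab : a < b) {N : ℕ} (hN : 0 < N) (i : Fin (N - 1)) :
    node a b N i ∈ Ioo a b := by
  have hN' : (0 : ℝ) < N := by exact_mod_cast hN
  have hs : 0 < step a b N := div_pos (by linarith) hN'
  have hsN : N * step a b N = b - a := by rw [step]; field_simp
  have hi := i.2
  have : ((i : ℕ) : ℝ) + 1 < N := by exact_mod_cast (by omega : (i : ℕ) + 1 < N)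
  rw [node]
  constructor
  · have : 0 < (((i : ℕ) : ℝ) + 1) * step a b N := by positivity
    linarith
  · nlinarith

variable {α β κα κβ xL xR yL yR T : ℝ} {u : ℝ → ℝ → ℝ → ℝ}

theorem timeDeriv_of_mem {n : ℕ} {s : ℝ} {p : ℝ × ℝ} (hp : p ∈ domain xL xR yL yR) :
    timeDeriv xL xR yL yR T u n s p =
      iteratedDerivWithin n (fun s => u p.1 p.2 s) (Icc 0 T) s := by
  rw [timeDeriv, zeroExt, indicator_of_mem hp]

theorem timeDeriv_zero_of_mem {s : ℝ} {p : ℝ × ℝ} (hp : p ∈ domain xL xR yL yR) :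
    timeDeriv xL xR yL yR T u 0 s p = u p.1 p.2 s := by
  rw [timeDeriv_of_mem hp, iteratedDerivWithin_zero]

theorem timeDeriv_of_notMem {n : ℕ} {s : ℝ} {p : ℝ × ℝ} (hp : p ∉ domain xL xR yL yR) :
    timeDeriv xL xR yL yR T u n s p = 0 := by
  rw [timeDeriv, zeroExt, indicator_of_notMem hp]

theorem IsSmoothSolution.hasDerivWithinAt (h : IsSmoothSolution α β xL xR yL yR T u) (hT : 0 < T)
    {n : ℕ} (hn : n < 3) {s : ℝ} (hs : s ∈ Icc 0 T) {p : ℝ × ℝ} (hp : p ∈ domain xL xR yL yR) :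
    HasDerivWithinAt (fun s => timeDeriv xL xR yL yR T u n s p)
      (timeDeriv xL xR yL yR T u (n + 1) s p) (Icc 0 T) s := by
  simp only [timeDeriv_of_mem hp, iteratedDerivWithin_succ]
  refine DifferentiableWithinAt.hasDerivWithinAt ?_
  exact (h.contDiffOn p.1 p.2 hp).differentiableOn_iteratedDerivWithin (by exact_mod_cast hn)
    (uniqueDiffOn_Icc hT) s hs

/-- Midpoint formulas for linear images of a vector valued function. -/
theorem mulVec_midpoint_bounds {ι : Type*} [Fintype ι] {W : ℕ → ℝ → ι → ℝ} {M : Matrix ι ι ℝ}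
    {K t τ : ℝ} (ht : 0 ≤ t) (hτ : 0 < τ) (htT : t + τ ≤ T)
    (hW : ∀ n < 3, ∀ s ∈ Icc 0 T, ∀ l,
      HasDerivWithinAt (fun s => W n s l) (W (n + 1) s l) (Icc 0 T) s)
    (hM : ∀ n ∈ ({1, 2, 3} : Set ℕ), ∀ s ∈ Icc 0 T, ∀ k, |(M *ᵥ W n s) k| ≤ K) (k : ι) :
    |(M *ᵥ (W 0 (t + τ) - W 0 t)) k| ≤ K * τ ∧
      |(M *ᵥ ((1 / 2 : ℝ) • (W 0 (t + τ) + W 0 t) - W 0 (t + τ / 2))) k| ≤ K * τ ^ 2 ∧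
      |(M *ᵥ (τ⁻¹ • (W 0 (t + τ) - W 0 t) - W 1 (t + τ / 2))) k| ≤ K * τ ^ 2 := by
  have hd : ∀ n < 3, ∀ s ∈ Icc 0 T,
      HasDerivWithinAt (fun s => (M *ᵥ W n s) k) ((M *ᵥ W (n + 1) s) k) (Icc 0 T) s := by
    intro n hn s hs
    simp only [Matrix.mulVec, dotProduct]
    exact HasDerivWithinAt.fun_sum fun l _ => (hW n hn s hs l).const_mul _
  obtain ⟨h1, h2, h3⟩ := midpoint_bounds ht hτ.le htT (hd 0 (by norm_num)) (hd 1 (by norm_num))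
    (hd 2 (by norm_num)) (fun s hs => hM 1 (by simp) s hs k) (fun s hs => hM 2 (by simp) s hs k)
    (fun s hs => hM 3 (by simp) s hs k)
  simp only [Matrix.mulVec_sub, Matrix.mulVec_add, Matrix.mulVec_smul, Pi.sub_apply, Pi.add_apply,
    Pi.smul_apply, smul_eq_mul]
  refine ⟨h1, ?_, ?_⟩
  · convert h2 using 2
    ring
  · have e : τ⁻¹ * ((M *ᵥ W 0 (t + τ)) k - (M *ᵥ W 0 t) k) - (M *ᵥ W 1 (t + τ / 2)) k =
        τ⁻¹ * ((M *ᵥ W 0 (t + τ)) k - (M *ᵥ W 0 t) k - τ * (M *ᵥ W (0 + 1) (t + τ / 2)) k) := by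
      field_simp
    rw [e, abs_mul, abs_of_pos (inv_pos.2 hτ), inv_mul_le_iff₀ hτ]
    exact h3.trans (le_of_eq (by ring))

/-- The parts of the local truncation error are of order `τ² + Δx⁴ + Δy⁴`. -/
theorem IsSmoothSolution.exists_consistency_bound (h : IsSmoothSolution α β xL xR yL yR T u)
    (hα : 1 < α ∧ α < 2) (hβ : 1 < β ∧ β < 2) (hκα : 0 ≤ κα) (hκβ : 0 ≤ κβ) (hx : xL < xR)
    (hy : yL < yR) (hT : 0 < T) {P : Shifts} (hPα : IsStableFourthOrder α (P.weight α) P.shift)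
    (hPβ : IsStableFourthOrder β (P.weight β) P.shift) :
    ∃ C : ℝ, 0 ≤ C ∧ ∀ (Nx Ny : ℕ), 0 < Nx → 0 < Ny →
      ∀ (W : ℕ → ℝ → Idx Nx Ny → ℝ) (Lx Ly : ℝ → Idx Nx Ny → ℝ)
      (Bx By : Matrix (Idx Nx Ny) (Idx Nx Ny) ℝ) (t τ ε : ℝ),
      (W = fun n s l => timeDeriv xL xR yL yR T u n s (node xL xR Nx l.2, node yL yR Ny l.1)) →
      (Lx = fun s l => twoSidedRL α κα xL xR
        (fun x => timeDeriv xL xR yL yR T u 0 s (x, node yL yR Ny l.1)) (node xL xR Nx l.2)) →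
      (Ly = fun s l => twoSidedRL β κβ yL yR
        (fun y => timeDeriv xL xR yL yR T u 0 s (node xL xR Nx l.2, y)) (node yL yR Ny l.1)) →
      (Bx = 1 ⊗ₖ diffMatrix α κα P xL xR Nx) → (By = diffMatrix β κβ P yL yR Ny ⊗ₖ 1) →
      0 ≤ t → 0 < τ → t + τ ≤ T →
      (ε = τ ^ 2 + step xL xR Nx ^ 4 + step yL yR Ny ^ 4) →
      ∀ (a b d : Idx Nx Ny → ℝ), (a = τ⁻¹ • (W 0 (t + τ) - W 0 t) - W 1 (t + τ / 2)) →
      (b = Lx (t + τ / 2) - (1 / 2 : ℝ) • (Bx *ᵥ (W 0 (t + τ) + W 0 t))) →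
      (d = Ly (t + τ / 2) - (1 / 2 : ℝ) • (By *ᵥ (W 0 (t + τ) + W 0 t))) →
      ∀ k, |a k| ≤ C * ε ∧ |(Bx *ᵥ a) k| ≤ C * ε ∧ |(By *ᵥ a) k| ≤ C * ε ∧
        |((Bx * By) *ᵥ a) k| ≤ C * ε ∧ |b k| ≤ C * ε ∧ |(By *ᵥ b) k| ≤ C * ε ∧
        |d k| ≤ C * ε ∧ |(Bx *ᵥ d) k| ≤ C * ε ∧
        |((τ / 4) • ((Bx * By) *ᵥ (W 0 (t + τ) - W 0 t))) k| ≤ C * ε := by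
  obtain ⟨C, hC, hrow⟩ := exists_row_bounds hα hβ hκα hκβ hx hy hPα hPβ
  obtain ⟨Ks, hKs⟩ := h.space
  obtain ⟨Kt, hKt⟩ := h.time
  have hC0 : 0 ≤ C := by linarith
  refine ⟨C * (|Ks| + |Kt|), by positivity, ?_⟩
  intro Nx Ny hNx hNy W Lx Ly Bx By t τ ε hW hLx hLy hBx hBy ht hτ htT hε a b d ha hb hd k
  set K := C * (|Ks| + |Kt|) with hK
  have hK0 : 0 ≤ K := by positivity
  have hsx : 0 ≤ step xL xR Nx := div_nonneg (by linarith) (Nat.cast_nonneg _)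
  have hsy : 0 ≤ step yL yR Ny := div_nonneg (by linarith) (Nat.cast_nonneg _)
  have hCt : C * Kt ≤ K := by
    rw [hK]; gcongr; linarith [le_abs_self Kt, abs_nonneg Ks]
  have hCs : ∀ r : ℝ, 0 ≤ r → C * r ^ 4 * Ks ≤ K * r ^ 4 := fun r hr => by
    calc C * r ^ 4 * Ks = C * Ks * r ^ 4 := by ring
      _ ≤ _ := by rw [hK]; gcongr; linarith [le_abs_self Ks, abs_nonneg Kt]
  have hcomm : Bx * By = By * Bx := by
    rw [hBx, hBy]; exact (commute_one_kronecker_kronecker_one _ _).eq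
  have hm : t + τ / 2 ∈ Icc 0 T := ⟨by linarith, by linarith⟩
  have hoff : ∀ n s, ∀ z ∉ domain xL xR yL yR, timeDeriv xL xR yL yR T u n s z = 0 :=
    fun n s z hz => timeDeriv_of_notMem hz
  have hder : ∀ n < 3, ∀ s ∈ Icc 0 T, ∀ l,
      HasDerivWithinAt (fun s => W n s l) (W (n + 1) s l) (Icc 0 T) s := by
    intro n hn s hs l
    rw [hW]
    exact h.hasDerivWithinAt hT hn hs ⟨node_mem_Ioo hx hNx _, node_mem_Ioo hy hNy _⟩
  have hBB : ∀ v l, ((Bx * By) *ᵥ v) l = (diffMatrix β κβ P yL yR Ny *ᵥ fun j =>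
      (diffMatrix α κα P xL xR Nx *ᵥ fun i => v (j, i)) l.2) l.1 := by
    intro v l
    rw [hcomm, ← Matrix.mulVec_mulVec, hBx, hBy, kronecker_one_mulVec]
    simp only [one_kronecker_mulVec]
  have row : ∀ n ∈ ({1, 2, 3} : Set ℕ), ∀ s ∈ Icc 0 T, ∀ l, |W n s l| ≤ K ∧
      |(Bx *ᵥ W n s) l| ≤ K ∧ |(By *ᵥ W n s) l| ≤ K ∧ |((Bx * By) *ᵥ W n s) l| ≤ K := by
    intro n hn s hs l
    obtain ⟨h1, h2, h3, h4⟩ := (hrow Nx Ny hNx hNy l.2 l.1 _ _ rfl rfl _ Kt (hoff n s)).1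
      (hKt n hn s hs)
    rw [hBB, hBx, hBy, one_kronecker_mulVec, kronecker_one_mulVec, hW]
    exact ⟨h1.trans hCt, h2.trans hCt, h3.trans hCt, h4.trans hCt⟩
  have m1 := fun l => mulVec_midpoint_bounds (M := 1) ht hτ htT hder
    (fun n hn s hs l => by rw [Matrix.one_mulVec]; exact (row n hn s hs l).1) l
  have mx := mulVec_midpoint_bounds ht hτ htT hder (fun n hn s hs l => (row n hn s hs l).2.1)
  have my := mulVec_midpoint_bounds ht hτ htT hder (fun n hn s hs l => (row n hn s hs l).2.2.1)
  have mxy := mulVec_midpoint_bounds ht hτ htT hder (fun n hn s hs l => (row n hn s hs l).2.2.2)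
  simp only [Matrix.one_mulVec] at m1
  obtain ⟨x1, x2⟩ := (hrow Nx Ny hNx hNy k.2 k.1 _ _ rfl rfl _ Ks (hoff 0 (t + τ / 2))).2.1
    (hKs _ hm).1
  obtain ⟨y1, y2⟩ := (hrow Nx Ny hNx hNy k.2 k.1 _ _ rfl rfl _ Ks (hoff 0 (t + τ / 2))).2.2
    (hKs _ hm).2
  have bx : |(Bx *ᵥ W 0 (t + τ / 2) - Lx (t + τ / 2)) k| ≤ K * step xL xR Nx ^ 4 := by
    rw [Pi.sub_apply, hBx, one_kronecker_mulVec, hLx, hW]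
    exact x1.trans (hCs _ hsx)
  have bxy : |(By *ᵥ (Bx *ᵥ W 0 (t + τ / 2) - Lx (t + τ / 2))) k| ≤ K * step xL xR Nx ^ 4 := by
    rw [hBy, kronecker_one_mulVec]
    simp only [Pi.sub_apply, hBx, one_kronecker_mulVec, hLx, hW]
    exact x2.trans (hCs _ hsx)
  have dy : |(By *ᵥ W 0 (t + τ / 2) - Ly (t + τ / 2)) k| ≤ K * step yL yR Ny ^ 4 := by
    rw [Pi.sub_apply, hBy, kronecker_one_mulVec, hLy, hW]
    exact y1.trans (hCs _ hsy)
  have dyx : |(Bx *ᵥ (By *ᵥ W 0 (t + τ / 2) - Ly (t + τ / 2))) k| ≤ K * step yL yR Ny ^ 4 := by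
    rw [hBx, one_kronecker_mulVec]
    simp only [Pi.sub_apply, hBy, kronecker_one_mulVec, hLy, hW]
    exact y2.trans (hCs _ hsy)
  -- The first part is the time averaging error under `Bx`, of order `τ²`; the second is the spatial
  -- truncation error at the midpoint.
  have eb : b = -(Bx *ᵥ ((1 / 2 : ℝ) • (W 0 (t + τ) + W 0 t) - W 0 (t + τ / 2))) -
      (Bx *ᵥ W 0 (t + τ / 2) - Lx (t + τ / 2)) := by
    rw [hb, Matrix.mulVec_sub, Matrix.mulVec_smul]; abel
  have ed : d = -(By *ᵥ ((1 / 2 : ℝ) • (W 0 (t + τ) + W 0 t) - W 0 (t + τ / 2))) -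
      (By *ᵥ W 0 (t + τ / 2) - Ly (t + τ / 2)) := by
    rw [hd, Matrix.mulVec_sub, Matrix.mulVec_smul]; abel
  have hsum : ∀ p q r : ℝ, |p| ≤ K * τ ^ 2 → |q| ≤ K * r ^ 4 → |-p - q| ≤ K * τ ^ 2 + K * r ^ 4 :=
    fun p q r hp hq => (abs_sub _ _).trans (by rw [abs_neg]; exact add_le_add hp hq)
  have p1 : 0 ≤ K * τ ^ 2 := by positivity
  have p2 : 0 ≤ K * step xL xR Nx ^ 4 := by positivity
  have p3 : 0 ≤ K * step yL yR Ny ^ 4 := by positivity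
  have hKε : K * ε = K * τ ^ 2 + K * step xL xR Nx ^ 4 + K * step yL yR Ny ^ 4 := by
    rw [hε]; ring
  rw [hKε]
  subst ha
  refine ⟨?_, ?_, ?_, ?_, ?_, ?_, ?_, ?_, ?_⟩
  · linarith [(m1 k).2.2]
  · linarith [(mx k).2.2]
  · linarith [(my k).2.2]
  · linarith [(mxy k).2.2]
  · have := hsum _ _ _ (mx k).2.1 bx
    rw [eb, Pi.sub_apply, Pi.neg_apply]
    linarith
  · have := hsum _ _ _ (mxy k).2.1 bxy
    rw [eb, Matrix.mulVec_sub, Matrix.mulVec_neg, Matrix.mulVec_mulVec, ← hcomm, Pi.sub_apply,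
      Pi.neg_apply]
    linarith
  · have := hsum _ _ _ (my k).2.1 dy
    rw [ed, Pi.sub_apply, Pi.neg_apply]
    linarith
  · have := hsum _ _ _ (mxy k).2.1 dyx
    rw [ed, Matrix.mulVec_sub, Matrix.mulVec_neg, Matrix.mulVec_mulVec, Pi.sub_apply,
      Pi.neg_apply]
    linarith
  · rw [Pi.smul_apply, smul_eq_mul, abs_mul, abs_of_nonneg (by positivity : 0 ≤ τ / 4)]
    have := mul_le_mul_of_nonneg_left (mxy k).1 (by positivity : 0 ≤ τ / 4)
    nlinarith

/-- The differential equation at the mesh points. -/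
theorem IsExactSolution.timeDeriv_one_eq {dp dm ep em : ℝ → ℝ} {f : ℝ → ℝ → ℝ → ℝ}
    {u₀ : ℝ → ℝ → ℝ} (hu : IsExactSolution α β xL xR yL yR T dp dm ep em f u₀ u)
    (h : IsSmoothSolution α β xL xR yL yR T u) (hT : 0 < T)
    (hdm : ∀ x ∈ Ioo xL xR, dm x = κα * dp x) (hem : ∀ y ∈ Ioo yL yR, em y = κβ * ep y)
    {x y t : ℝ} (hx : x ∈ Ioo xL xR) (hy : y ∈ Ioo yL yR) (ht : t ∈ Ioc 0 T) :
    timeDeriv xL xR yL yR T u 1 t (x, y) =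
      dp x * twoSidedRL α κα xL xR (fun ξ => timeDeriv xL xR yL yR T u 0 t (ξ, y)) x +
      ep y * twoSidedRL β κβ yL yR (fun η => timeDeriv xL xR yL yR T u 0 t (x, η)) y +
      f x y t := by
  have hp : (x, y) ∈ domain xL xR yL yR := ⟨hx, hy⟩
  have ht' : t ∈ Icc 0 T := Ioc_subset_Icc_self ht
  have d1 := h.hasDerivWithinAt hT (n := 0) (by norm_num) ht' hp
  simp only [timeDeriv_zero_of_mem hp] at d1
  have e := (uniqueDiffOn_Icc hT t ht').eq_deriv _ d1 (hu.pde x y t hp ht)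
  rw [zero_add] at e
  rw [e, hdm x hx, hem y hy,
    twoSidedRL_congr (w := fun ξ => u ξ y t) hx
      fun ξ hξ => timeDeriv_zero_of_mem (p := (ξ, y)) ⟨hξ, hy⟩,
    twoSidedRL_congr (w := fun η => u x η t) hy
      fun η hη => timeDeriv_zero_of_mem (p := (x, η)) ⟨hx, hη⟩, twoSidedRL, twoSidedRL]
  ring

end WSLD

/-! ### The convergence theorem. -/

theorem theorem4p6
    (α β : ℝ) (hα : 1 < α ∧ α < 2) (hβ : 1 < β ∧ β < 2)
    (xL xR yL yR T : ℝ) (hx : xL < xR) (hy : yL < yR) (hT : 0 < T)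
    (P : WSLD.Shifts) (hP : P.Effective) (hPα : P.Nondegenerate α) (hPβ : P.Nondegenerate β)
    (dp dm ep em : ℝ → ℝ)
    (hd : ∀ x ∈ Set.Ioo xL xR, 0 ≤ dp x) (hdb : BddAbove (dp '' Set.Ioo xL xR))
    (he : ∀ y ∈ Set.Ioo yL yR, 0 ≤ ep y) (heb : BddAbove (ep '' Set.Ioo yL yR))
    (κα κβ : ℝ) (hκα : 0 ≤ κα) (hκβ : 0 ≤ κβ)
    (hdm : ∀ x ∈ Set.Ioo xL xR, dm x = κα * dp x)
    (hem : ∀ y ∈ Set.Ioo yL yR, em y = κβ * ep y)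
    (f : ℝ → ℝ → ℝ → ℝ) (u₀ : ℝ → ℝ → ℝ) (u : ℝ → ℝ → ℝ → ℝ)
    (hu : WSLD.IsExactSolution α β xL xR yL yR T dp dm ep em f u₀ u)
    (hreg : WSLD.IsSmoothSolution α β xL xR yL yR T u) :
    ∃ C : ℝ, 0 < C ∧
      ∀ Nx Ny Nt : ℕ, 0 < Nx → 0 < Ny → 0 < Nt →
        ∀ U : ℕ → WSLD.Idx Nx Ny → ℝ,
          WSLD.IsSchemeSolution α β P xL xR yL yR T dp dm ep em f u₀ Nx Ny Nt U →
          ∀ n ≤ Nt,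
            WSLD.discreteNorm xL xR yL yR Nx Ny
                (fun k => u (WSLD.node xL xR Nx k.2) (WSLD.node yL yR Ny k.1) (n * (T / Nt)) - U n k)
              ≤ C * ((T / Nt) ^ 2 + WSLD.step xL xR Nx ^ 4 + WSLD.step yL yR Ny ^ 4) := by
  have sα := WSLD.Shifts.isStableFourthOrder hα.1 hα.2 hP hPα
  have sβ := WSLD.Shifts.isStableFourthOrder hβ.1 hβ.2 hP hPβ
  obtain ⟨C, hC, hcons⟩ := hreg.exists_consistency_bound hα hβ hκα hκβ hx hy hT sα sβ
  obtain ⟨Md, hMd⟩ := hdb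
  obtain ⟨Me, hMe⟩ := heb
  set M := √|Md| + √|Me| with hM
  have hM0 : 0 ≤ M := by positivity
  set L := √((xR - xL) * (yR - yL)) with hL
  -- `L` is the square root of the area and dominates `√(Δx Δy)` times the root of the number of
  -- mesh points; the summand `1` only ensures positivity.
  refine ⟨L * |WSLD.adiConst M T| * C + 1, by positivity, ?_⟩
  intro Nx Ny Nt hNx hNy hNt U hU n hn
  have hNt' : (0 : ℝ) < Nt := by exact_mod_cast hNt
  have hNx' : (0 : ℝ) < Nx := by exact_mod_cast hNx
  have hNy' : (0 : ℝ) < Ny := by exact_mod_cast hNy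
  set τ := T / (Nt : ℝ) with hτ
  have hτ0 : 0 < τ := div_pos hT hNt'
  have hNτ : Nt * τ = T := by rw [hτ]; field_simp
  have hτT : τ ≤ T := by
    rw [← hNτ]
    exact le_mul_of_one_le_left hτ0.le (by exact_mod_cast hNt)
  have hsx : 0 ≤ WSLD.step xL xR Nx := div_nonneg (by linarith) hNx'.le
  have hsy : 0 ≤ WSLD.step yL yR Ny := div_nonneg (by linarith) hNy'.le
  set ε := τ ^ 2 + WSLD.step xL xR Nx ^ 4 + WSLD.step yL yR Ny ^ 4 with hε
  have hε0 : 0 ≤ ε := by positivity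
  have hnx := fun l : WSLD.Idx Nx Ny => WSLD.node_mem_Ioo hx hNx l.2
  have hny := fun l : WSLD.Idx Nx Ny => WSLD.node_mem_Ioo hy hNy l.1
  have hnd : ∀ l : WSLD.Idx Nx Ny, (WSLD.node xL xR Nx l.2, WSLD.node yL yR Ny l.1) ∈
      WSLD.domain xL xR yL yR := fun l => ⟨hnx l, hny l⟩
  obtain ⟨W, hW⟩ : ∃ W : ℕ → ℝ → WSLD.Idx Nx Ny → ℝ, W = fun n s l =>
    WSLD.timeDeriv xL xR yL yR T u n s (WSLD.node xL xR Nx l.2, WSLD.node yL yR Ny l.1) := ⟨_, rfl⟩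
  obtain ⟨Lx, hLx⟩ : ∃ Lx : ℝ → WSLD.Idx Nx Ny → ℝ, Lx = fun s l => WSLD.twoSidedRL α κα xL xR
    (fun x => WSLD.timeDeriv xL xR yL yR T u 0 s (x, WSLD.node yL yR Ny l.1))
      (WSLD.node xL xR Nx l.2) := ⟨_, rfl⟩
  obtain ⟨Ly, hLy⟩ : ∃ Ly : ℝ → WSLD.Idx Nx Ny → ℝ, Ly = fun s l => WSLD.twoSidedRL β κβ yL yR
    (fun y => WSLD.timeDeriv xL xR yL yR T u 0 s (WSLD.node xL xR Nx l.2, y))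
      (WSLD.node yL yR Ny l.1) := ⟨_, rfl⟩
  obtain ⟨Bx, hBx⟩ : ∃ Bx : Matrix (WSLD.Idx Nx Ny) (WSLD.Idx Nx Ny) ℝ,
    Bx = Matrix.kroneckerMap (· * ·) 1 (WSLD.diffMatrix α κα P xL xR Nx) := ⟨_, rfl⟩
  obtain ⟨By, hBy⟩ : ∃ By : Matrix (WSLD.Idx Nx Ny) (WSLD.Idx Nx Ny) ℝ,
    By = Matrix.kroneckerMap (· * ·) (WSLD.diffMatrix β κβ P yL yR Ny) 1 := ⟨_, rfl⟩
  -- The weights `X`, `Y` of the abstract bound are the square roots of the coefficients, which need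
  -- only be nonnegative and bounded.
  set x : WSLD.Idx Nx Ny → ℝ := fun l => √(dp (WSLD.node xL xR Nx l.2)) with hxd
  set y : WSLD.Idx Nx Ny → ℝ := fun l => √(ep (WSLD.node yL yR Ny l.1)) with hyd
  have hxx : Matrix.diagonal x * Matrix.diagonal x =
      Matrix.diagonal fun l => dp (WSLD.node xL xR Nx l.2) := by
    rw [Matrix.diagonal_mul_diagonal]
    congr 1
    funext l
    exact Real.mul_self_sqrt (hd _ (hnx l))
  have hyy : Matrix.diagonal y * Matrix.diagonal y =
      Matrix.diagonal fun l => ep (WSLD.node yL yR Ny l.1) := by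
    rw [Matrix.diagonal_mul_diagonal]
    congr 1
    funext l
    exact Real.mul_self_sqrt (he _ (hny l))
  have hxM : ∀ l, |x l| ≤ M := fun l => by
    rw [hxd, abs_of_nonneg (Real.sqrt_nonneg _)]
    have : √(dp (WSLD.node xL xR Nx l.2)) ≤ √|Md| :=
      Real.sqrt_le_sqrt ((hMd ⟨_, hnx l, rfl⟩).trans (le_abs_self _))
    linarith [Real.sqrt_nonneg |Me|]
  have hyM : ∀ l, |y l| ≤ M := fun l => by
    rw [hyd, abs_of_nonneg (Real.sqrt_nonneg _)]
    have : √(ep (WSLD.node yL yR Ny l.1)) ≤ √|Me| :=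
      Real.sqrt_le_sqrt ((hMe ⟨_, hny l, rfl⟩).trans (le_abs_self _))
    linarith [Real.sqrt_nonneg |Md|]
  have hYB : Commute (Matrix.diagonal y) Bx := by
    rw [hBx]
    exact WSLD.commute_diagonal_fst_one_kronecker (fun j => √(ep (WSLD.node yL yR Ny j))) _
  have hXB : Commute (Matrix.diagonal x) By := by
    rw [hBy]
    exact WSLD.commute_diagonal_snd_kronecker_one (fun i => √(dp (WSLD.node xL xR Nx i))) _
  have hBB : Commute Bx By := by
    rw [hBx, hBy]
    exact WSLD.commute_one_kronecker_kronecker_one _ _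
  have hBxn : ∀ v, v ⬝ᵥ (Bx *ᵥ v) ≤ 0 := fun v => by
    rw [hBx]
    exact WSLD.dotProduct_one_kronecker_nonpos
      (fun v => WSLD.dotProduct_diffMatrix_nonpos hα.1 hα.2 hκα hx sα v) v
  have hByn : ∀ v, v ⬝ᵥ (By *ᵥ v) ≤ 0 := fun v => by
    rw [hBy]
    exact WSLD.dotProduct_kronecker_one_nonpos
      (fun v => WSLD.dotProduct_diffMatrix_nonpos hβ.1 hβ.2 hκβ hy sβ v) v
  have hAx : WSLD.Ax α P xL xR Nx Ny τ dp dm =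
      (τ / 2) • (Matrix.diagonal x * Matrix.diagonal x * Bx) := by
    rw [hxx, hBx]
    exact WSLD.Ax_eq hx hNx fun i => hdm _ (WSLD.node_mem_Ioo hx hNx i)
  have hAy : WSLD.Ay β P yL yR Nx Ny τ ep em =
      (τ / 2) • (Matrix.diagonal y * Matrix.diagonal y * By) := by
    rw [hyy, hBy]
    exact WSLD.Ay_eq hy hNy fun j => hem _ (WSLD.node_mem_Ioo hy hNy j)
  have hW0 : ∀ s, W 0 s = fun l =>
      u (WSLD.node xL xR Nx l.2) (WSLD.node yL yR Ny l.1) s := fun s => by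
    rw [hW]
    funext l
    exact WSLD.timeDeriv_zero_of_mem (hnd l)
  have htime : ∀ n < Nt, 0 ≤ n * τ ∧ n * τ + τ ≤ T := fun n hn => by
    refine ⟨by positivity, ?_⟩
    have : ((n : ℝ) + 1) ≤ Nt := by exact_mod_cast hn
    rw [← hNτ]
    nlinarith
  have hpde : ∀ n < Nt, W 1 (n * τ + τ / 2) =
      (Matrix.diagonal x * Matrix.diagonal x) *ᵥ Lx (n * τ + τ / 2) +
      (Matrix.diagonal y * Matrix.diagonal y) *ᵥ Ly (n * τ + τ / 2) +
      fun l => f (WSLD.node xL xR Nx l.2) (WSLD.node yL yR Ny l.1) ((n + 1 / 2) * τ) := by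
    intro n hn
    obtain ⟨h1, h2⟩ := htime n hn
    funext l
    rw [hxx, hyy, Pi.add_apply, Pi.add_apply, Matrix.mulVec_diagonal, Matrix.mulVec_diagonal, hW,
      hLx, hLy]
    have := hu.timeDeriv_one_eq hreg hT hdm hem (hnx l) (hny l)
      (t := n * τ + τ / 2) ⟨by linarith, by linarith⟩
    rw [show ((n : ℝ) + 1 / 2) * τ = n * τ + τ / 2 by ring]
    exact this
  have hb := fun n (hn : n < Nt) => hcons Nx Ny hNx hNy W Lx Ly Bx By (n * τ) τ ε hW hLx hLy hBx hBy
    (htime n hn).1 hτ0 (htime n hn).2 hε _ _ _ rfl rfl rfl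
  have key := WSLD.adi_mesh_error_bound hBxn hByn hXB hYB hBB hM0 hxM hyM hτ0.le
    (mul_nonneg hC hε0) hNτ.le hτT (fun n => W 0 (n * τ) - U n)
    (fun n => τ⁻¹ • (W 0 (n * τ + τ) - W 0 (n * τ)) - W 1 (n * τ + τ / 2))
    (fun n => Lx (n * τ + τ / 2) - (1 / 2 : ℝ) • (Bx *ᵥ (W 0 (n * τ + τ) + W 0 (n * τ))))
    (fun n => Ly (n * τ + τ / 2) - (1 / 2 : ℝ) • (By *ᵥ (W 0 (n * τ + τ) + W 0 (n * τ))))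
    (fun n => (τ / 4) • ((Bx * By) *ᵥ (W 0 (n * τ + τ) - W 0 (n * τ)))) ?_ ?_
    (fun n hn k => (hb n hn k).1) (fun n hn k => (hb n hn k).2.1)
    (fun n hn k => (hb n hn k).2.2.1) (fun n hn k => (hb n hn k).2.2.2.1)
    (fun n hn k => (hb n hn k).2.2.2.2.1) (fun n hn k => (hb n hn k).2.2.2.2.2.1)
    (fun n hn k => (hb n hn k).2.2.2.2.2.2.1) (fun n hn k => (hb n hn k).2.2.2.2.2.2.2.1)
    (fun n hn k => (hb n hn k).2.2.2.2.2.2.2.2) n hn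
  · have hcard : WSLD.step xL xR Nx * WSLD.step yL yR Ny *
        (Fintype.card (WSLD.Idx Nx Ny) : ℝ) ≤ (xR - xL) * (yR - yL) := by
      have hc : (Fintype.card (WSLD.Idx Nx Ny) : ℝ) ≤ Nx * Ny := by
        rw [Fintype.card_prod, Fintype.card_fin, Fintype.card_fin, mul_comm]
        exact_mod_cast Nat.mul_le_mul (Nat.sub_le _ _) (Nat.sub_le _ _)
      calc _ ≤ WSLD.step xL xR Nx * WSLD.step yL yR Ny * (Nx * Ny) := by gcongr
        _ = _ := by
          rw [WSLD.step, WSLD.step]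
          field_simp
    have hs : √(WSLD.step xL xR Nx * WSLD.step yL yR Ny) *
        √(Fintype.card (WSLD.Idx Nx Ny) : ℝ) ≤ L := by
      rw [← Real.sqrt_mul (by positivity)]
      exact Real.sqrt_le_sqrt hcard
    rw [WSLD.discreteNorm, Real.sqrt_mul (by positivity)]
    simp only [hW0, Pi.sub_apply] at key
    calc _ ≤ √(WSLD.step xL xR Nx * WSLD.step yL yR Ny) * (|WSLD.adiConst M T| *
          (√(Fintype.card (WSLD.Idx Nx Ny) : ℝ) * (C * ε))) := by
          refine mul_le_mul_of_nonneg_left (key.trans ?_) (Real.sqrt_nonneg _)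
          gcongr
          exact le_abs_self _
      _ = (√(WSLD.step xL xR Nx * WSLD.step yL yR Ny) *
          √(Fintype.card (WSLD.Idx Nx Ny) : ℝ)) * (|WSLD.adiConst M T| * C * ε) := by ring
      _ ≤ L * (|WSLD.adiConst M T| * C * ε) := by gcongr
      _ ≤ (L * |WSLD.adiConst M T| * C + 1) * ε := by linarith
  · simp only [Nat.cast_zero, zero_mul, hW0]
    funext l
    rw [Pi.sub_apply, hu.initial _ _ (hnd l), hU.initial, sub_self, Pi.zero_apply]
  · intro n hn
    have hrec := hU.recursion n hn
    rw [← hτ, hAx, hAy] at hrec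
    have := WSLD.residual_identity hYB hτ0.ne' (w := W 0 (n * τ)) (w' := W 0 (n * τ + τ))
      (hpde n hn) hrec
    rw [← this]
    simp only [Nat.cast_add, Nat.cast_one, add_mul, one_mul]
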